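/- Let $n\ge 2$ and let $\Omega\subset\mathbb{R}^n$ be a bounded open set with Lipschitz boundary. Let $\mathbb{M}^{n\times n}_{\mathrm{sym}}$ be the space of symmetric $n\times n$ matrices with the Euclidean scalar product $A:B=\operatorname{tr}(AB^T)$, and let $\mathcal{M}_b(\Omega;\mathbb{M}^{n\times n}_{\mathrm{sym}})$ be the space of bounded Radon measures on $\Omega$ with values in $\mathbb{M}^{n\times n}_{\mathrm{sym}}$; weak* convergence in it is convergence against all test functions in $C_0(\Omega;\mathbb{M}^{n\times n}_{\mathrm{sym}})$, the continuous functions on $\overline\Omega$ that vanish on $\partial\Omega$. The space $BD(\Omega)$ consists of the $u\in L^1(\Omega;\mathbb{R}^n)$ whose distributional symmetrised gradient $\mathrm{E}u$, with components $\mathrm{E}_{ij}u=\frac12(D_ju^i+D_iu^j)$, belongs to $\mathcal{M}_b(\Omega;\mathbb{M}^{n\times n}_{\mathrm{sym}})$; $u_k\overset{*}{\rightharpoonup}u$ weakly* in $BD(\Omega)$ means that $u_k\to u$ strongly in $L^1(\Omega;\mathbb{R}^n)$ and $\mathrm{E}u_k\overset{*}{\rightharpoonup}\mathrm{E}u$ weakly*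 in $\mathcal{M}_b(\Omega;\mathbb{M}^{n\times n}_{\mathrm{sym}})$. For $A\subset\Omega$ let $\operatorname{Cap}_n(A,\Omega)$ be the infimum of $\int_\Omega|\nabla v|^n\,dx$ over all $v\in W^{1,n}_0(\Omega)$ with $v\ge 1$ a.e. in a neighbourhood of $A$. For $\alpha\in W^{1,n}(\Omega)$ let $\widetilde\alpha$ denote a $\operatorname{Cap}_n$-quasicontinuous representative of $\alpha$, that is, a function with $\widetilde\alpha=\alpha$ a.e. in $\Omega$ such that for every $\varepsilon>0$ there is a set $A_\varepsilon\subset\Omega$ with $\operatorname{Cap}_n(A_\varepsilon,\Omega)<\varepsilon$ for which $\widetilde\alpha|_{\Omega\setminus A_\varepsilon}$ is continuous. Let $\alpha_k,\alpha\in W^{1,n}(\Omega)$ and $u_k,u\in BD(\Omega)$, $k\in\mathbb{N}$, and let $M\geq 0$. Assume that $$\|\alpha_k\|_{L^\infty(\Omega)}\le M\ \text{ for all } k,\qquad \alpha_k\rightharpoonup\alpha\ \text{ weakly in } W^{1,n}(\Omega),\qquad u_k\overset{*}{\rightharpoonup}u\ \text{ weakly* in } BD(\Omega).$$ Then, for any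 choice of quasicontinuous representatives, each $\widetilde\alpha_k$ is integrable with respect to $|\mathrm{E}u_k|$ and $\widetilde\alpha$ is integrable with respect to $|\mathrm{E}u|$ (so that the measures $\widetilde\alpha_k\,\mathrm{E}u_k$ and $\widetilde\alpha\,\mathrm{E}u$ are well defined and bounded), and there exist a subsequence $(k_j)_j$ and a measure $\eta\in\mathcal{M}_b(\Omega;\mathbb{M}^{n\times n}_{\mathrm{sym}})$, concentrated on an at most countable subset of $\Omega$, such that $$\widetilde\alpha_{k_j}\,\mathrm{E}u_{k_j}\overset{*}{\rightharpoonup}\widetilde\alpha\,\mathrm{E}u+\eta\quad\text{weakly* in }\mathcal{M}_b(\Omega;\mathbb{M}^{n\times n}_{\mathrm{sym}})\text{ as } j\to\infty.$$ -/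

import Mathlib

open MeasureTheory Filter Topology
open scoped ENNReal NNReal Distributions ZeroAtInfty

noncomputable section

/-- `ℝⁿ` with the Euclidean norm. -/
abbrev Rn (n : ℕ) : Type := EuclideanSpace ℝ (Fin n)

/-- Lebesgue measure restricted to the open set `Ω`. -/
abbrev volOn {n : ℕ} (Ω : TopologicalSpace.Opens (Rn n)) : Measure (Rn n) :=
  volume.restrict (Ω : Set (Rn n))

/-- The `i`-th partial derivative of a function on `ℝⁿ`. -/
def partialD {n : ℕ} (i : Fin n) (φ : Rn n → ℝ) (x : Rn n) : ℝ :=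
  fderiv ℝ φ x (EuclideanSpace.single i 1)

/-- The exponent `n` of `W^{1,n}` is at least `1` when `n ≥ 2`. -/
instance factOneLeDim {n : ℕ} [h : n.AtLeastTwo] : Fact ((1 : ℝ≥0∞) ≤ (n : ℝ≥0∞)) :=
  ⟨by exact_mod_cast (le_trans one_le_two h.prop)⟩

/-- `Ω` has Lipschitz boundary: near each boundary point, `Ω` is the strict subgraph, in some unit
direction `ν`, of a Lipschitz function of the component `y - ⟪ν, y⟫ ν` orthogonal to `ν`. -/
def HasLipschitzBoundary {n : ℕ} (Ω : TopologicalSpace.Opens (Rn n)) : Prop :=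
  ∀ x ∈ frontier (Ω : Set (Rn n)),
    ∃ (ν : Rn n) (K : ℝ≥0) (g : Rn n → ℝ), ‖ν‖ = 1 ∧ LipschitzWith K g ∧
      ∀ᶠ y in 𝓝 x, y ∈ Ω ↔ inner ℝ ν y < g (y - inner ℝ ν y • ν)

section Sobolev

variable {n : ℕ} (Ω : TopologicalSpace.Opens (Rn n)) (p : ℝ≥0∞)

/-- `g` is the weak gradient of `a` in `Ω`. -/
def HasWeakGrad (a : Rn n → ℝ) (g : Rn n → Rn n) : Prop :=
  ∀ (φ : 𝓓(Ω, ℝ)) (i : Fin n),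
    ∫ x, a x * partialD i φ x ∂(volOn Ω) = -∫ x, g x i * φ x ∂(volOn Ω)

variable {Ω p}

theorem continuous_partialD (φ : 𝓓(Ω, ℝ)) (i : Fin n) : Continuous (partialD i φ) :=
  ((φ.contDiff.continuous_fderiv (by simp)).clm_apply continuous_const)

theorem hasCompactSupport_partialD (φ : 𝓓(Ω, ℝ)) (i : Fin n) :
    HasCompactSupport (partialD i φ) :=
  (φ.hasCompactSupport.fderiv (𝕜 := ℝ)).comp_left
    (g := fun L : Rn n →L[ℝ] ℝ => L (EuclideanSpace.single i 1)) (by simp)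

theorem integrable_Lp_mul [Fact (1 ≤ p)] {f : Rn n → ℝ} (hf : MemLp f p (volOn Ω))
    {w : Rn n → ℝ} (hw : Continuous w) (hc : HasCompactSupport w) :
    Integrable (fun x => f x * w x) (volOn Ω) := by
  simpa [smul_eq_mul] using
    (hf.locallyIntegrable Fact.out).integrable_smul_right_of_hasCompactSupport hw hc

variable (Ω p)

/-- The Sobolev space `W^{1,p}(Ω)`, as the space of pairs `(a, ∇a)` in `L^p × L^p` in which the
second entry is the weak gradient of the first; it carries the (product) norm, topology and vector
space structure induced from `L^p(Ω) × L^p(Ω; ℝⁿ)`. -/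
def W1p [Fact (1 ≤ p)] : Submodule ℝ (Lp ℝ p (volOn Ω) × Lp (Rn n) p (volOn Ω)) where
  carrier := {w | HasWeakGrad Ω w.1 w.2}
  zero_mem' := by
    intro φ i
    have h1 : ∫ x, (((0 : Lp ℝ p (volOn Ω)) : Rn n → ℝ) x) * partialD i φ x ∂(volOn Ω) = 0 := by
      refine integral_eq_zero_of_ae ?_
      filter_upwards [Lp.coeFn_zero ℝ p (volOn Ω)] with x hx
      rw [hx]; simp
    have h2 : ∫ x, (((0 : Lp (Rn n) p (volOn Ω)) : Rn n → Rn n) x) i * φ x ∂(volOn Ω) = 0 := by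
      refine integral_eq_zero_of_ae ?_
      filter_upwards [Lp.coeFn_zero (Rn n) p (volOn Ω)] with x hx
      rw [hx]; simp
    simp only [Prod.fst_zero, Prod.snd_zero]
    rw [h1, h2, neg_zero]
  add_mem' := by
    intro v w hv hw φ i
    have hcomp : ∀ g : Lp (Rn n) p (volOn Ω), MemLp (fun x => g x i) p (volOn Ω) := fun g =>
      (EuclideanSpace.proj i : Rn n →L[ℝ] ℝ).comp_memLp' (Lp.memLp g)
    have h1 : ∫ x, (v + w).1 x * partialD i φ x ∂(volOn Ω)
        = ∫ x, (v.1 x * partialD i φ x + w.1 x * partialD i φ x) ∂(volOn Ω) := by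
      refine integral_congr_ae ?_
      filter_upwards [Lp.coeFn_add v.1 w.1] with x hx
      simp only [Prod.fst_add, hx, Pi.add_apply, add_mul]
    have h2 : ∫ x, (v + w).2 x i * φ x ∂(volOn Ω)
        = ∫ x, (v.2 x i * φ x + w.2 x i * φ x) ∂(volOn Ω) := by
      refine integral_congr_ae ?_
      filter_upwards [Lp.coeFn_add v.2 w.2] with x hx
      simp only [Prod.snd_add, hx, Pi.add_apply, PiLp.add_apply, add_mul]
    rw [h1, h2, integral_add, integral_add, hv φ i, hw φ i]
    · ring
    · exact integrable_Lp_mul (hcomp _) φ.continuous φ.hasCompactSupport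
    · exact integrable_Lp_mul (hcomp _) φ.continuous φ.hasCompactSupport
    · exact integrable_Lp_mul (Lp.memLp _) (continuous_partialD φ i) (hasCompactSupport_partialD φ i)
    · exact integrable_Lp_mul (Lp.memLp _) (continuous_partialD φ i) (hasCompactSupport_partialD φ i)
  smul_mem' := by
    intro c v hv φ i
    have h1 : ∫ x, (c • v).1 x * partialD i φ x ∂(volOn Ω)
        = ∫ x, c * (v.1 x * partialD i φ x) ∂(volOn Ω) := by
      refine integral_congr_ae ?_
      filter_upwards [Lp.coeFn_smul c v.1] with x hx
      simp only [Prod.smul_fst, hx, Pi.smul_apply, smul_eq_mul, mul_assoc]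
    have h2 : ∫ x, (c • v).2 x i * φ x ∂(volOn Ω) = ∫ x, c * (v.2 x i * φ x) ∂(volOn Ω) := by
      refine integral_congr_ae ?_
      filter_upwards [Lp.coeFn_smul c v.2] with x hx
      simp only [Prod.smul_snd, hx, Pi.smul_apply, PiLp.smul_apply, smul_eq_mul, mul_assoc]
    rw [h1, h2, integral_const_mul, integral_const_mul, hv φ i]
    ring

variable {Ω p}

/-- The function underlying an element of `W^{1,p}(Ω)` (defined up to null sets of `Ω`). -/
def W1p.fn [Fact (1 ≤ p)] (w : W1p Ω p) : Rn n → ℝ := w.1.1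

/-- The weak gradient of an element of `W^{1,p}(Ω)`. -/
def W1p.grad [Fact (1 ≤ p)] (w : W1p Ω p) : Rn n → Rn n := w.1.2

variable (Ω p)

/-- `W₀^{1,p}(Ω)`: the closure of `C_c^∞(Ω)` in `W^{1,p}(Ω)`. -/
def W10p [Fact (1 ≤ p)] : Set (W1p Ω p) :=
  closure {w | ∃ φ : 𝓓(Ω, ℝ), W1p.fn w =ᵐ[volOn Ω] φ}

/-- The `p`-capacity of `A ⊆ Ω` relative to `Ω`: the infimum of `∫_Ω |∇v|^p` over all
`v ∈ W₀^{1,p}(Ω)` with `v ≥ 1` a.e. in a neighbourhood of `A` (it is `∞` if there is no such `v`). -/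
def capacity [Fact (1 ≤ p)] (A : Set (Rn n)) : ℝ≥0∞ :=
  ⨅ (v : W1p Ω p) (_ : v ∈ W10p Ω p ∧ ∃ U : Set (Rn n), IsOpen U ∧ A ⊆ U ∧ U ⊆ Ω ∧
      ∀ᵐ x ∂(volume.restrict U), 1 ≤ W1p.fn v x),
    ∫⁻ x, ‖W1p.grad v x‖ₑ ^ p.toReal ∂(volOn Ω)

/-- `f` is `Cap_p`-quasicontinuous on `Ω`. The values of `f` outside `Ω` play no role. -/
def IsQuasicontinuous [Fact (1 ≤ p)] (f : Rn n → ℝ) : Prop :=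
  ∀ ε : ℝ≥0∞, 0 < ε → ∃ A : Set (Rn n), A ⊆ Ω ∧ capacity Ω p A < ε ∧
    ContinuousOn f ((Ω : Set (Rn n)) \ A)

variable {Ω p}

/-- `f` is a `Cap_p`-quasicontinuous representative of `a ∈ W^{1,p}(Ω)`. -/
def IsQuasicontinuousRep [Fact (1 ≤ p)] (a : W1p Ω p) (f : Rn n → ℝ) : Prop :=
  IsQuasicontinuous Ω p f ∧ f =ᵐ[volOn Ω] W1p.fn a

/-- Weak convergence of sequences in the normed space `W^{1,p}(Ω)`. -/
def WeakConvW1p [Fact (1 ≤ p)] (a : ℕ → W1p Ω p) (b : W1p Ω p) : Prop :=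
  Tendsto (fun k => toWeakSpace ℝ (W1p Ω p) (a k)) atTop (𝓝 (toWeakSpace ℝ (W1p Ω p) b))

end Sobolev

section BD

/-- The space of symmetric `n × n` matrices, with the Euclidean (Frobenius) scalar product
`A : B = ∑ i j, A i j * B i j`; the entry `A i j` is the coordinate of index `(i, j)`. -/
def SymMat (n : ℕ) : Submodule ℝ (EuclideanSpace ℝ (Fin n × Fin n)) where
  carrier := {A | ∀ i j, A (i, j) = A (j, i)}
  zero_mem' := by intro i j; simp
  add_mem' := by intro A B hA hB i j; simp [hA i j, hB i j]
  smul_mem' := by intro c A hA i j; simp [hA i j]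

variable {n : ℕ}

/-- `𝓜_b(Ω; 𝕄_sym)`: the countably additive Borel vector measures on `Ω` with values in the
symmetric matrices. As the target is finite dimensional, these have finite total variation. -/
abbrev MatMeasure (Ω : TopologicalSpace.Opens (Rn n)) : Type := VectorMeasure Ω (SymMat n)

variable {Ω : TopologicalSpace.Opens (Rn n)}

/-- The duality `⟨μ, φ⟩ = ∫_Ω φ : dμ` between `𝓜_b(Ω; 𝕄_sym)` and `C₀(Ω; 𝕄_sym)`. -/
def MatMeasure.pairing (μ : MatMeasure Ω) (φ : C₀(Ω, SymMat n)) : ℝ :=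
  μ.integral φ (innerSL ℝ : SymMat n →L[ℝ] SymMat n →L[ℝ] ℝ)

/-- Weak* convergence in `𝓜_b(Ω; 𝕄_sym)`, the dual of `C₀(Ω; 𝕄_sym)`. -/
def MatMeasure.WeakStarConv (μ : ℕ → MatMeasure Ω) (ν : MatMeasure Ω) : Prop :=
  ∀ φ : C₀(Ω, SymMat n), Tendsto (fun k => (μ k).pairing φ) atTop (𝓝 (ν.pairing φ))

/-- The measure `f μ`, i.e. `B ↦ ∫_B f dμ`, for `f` integrable with respect to `|μ|`. -/
def MatMeasure.mulFn (f : Rn n → ℝ) (μ : MatMeasure Ω) : MatMeasure Ω :=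
  μ.withDensity (fun x : Ω => f x) (ContinuousLinearMap.lsmul ℝ ℝ)

/-- `|μ|` vanishes outside some at most countable subset of `Ω`. -/
def MatMeasure.ConcentratedOnCountable (μ : MatMeasure Ω) : Prop :=
  ∃ S : Set Ω, S.Countable ∧ μ.variation Sᶜ = 0

/-- The measure `μ` is the distributional symmetrised gradient of `u` in `Ω`:
`μ_{ij} = (D_j u^i + D_i u^j) / 2` in the sense of distributions. -/
def HasSymGrad (u : Lp (Rn n) 1 (volOn Ω)) (μ : MatMeasure Ω) : Prop :=
  ∀ (φ : 𝓓(Ω, ℝ)) (i j : Fin n),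
    (μ.integral (fun x : Ω => φ x) (ContinuousLinearMap.lsmul ℝ ℝ) : SymMat n).1 (i, j)
      = -∫ x, (u x i * partialD j φ x + u x j * partialD i φ x) / 2 ∂(volOn Ω)

variable (Ω)

/-- `BD(Ω)`: the functions in `L¹(Ω; ℝⁿ)` whose distributional symmetrised gradient is a bounded
measure. -/
def BD : Set (Lp (Rn n) 1 (volOn Ω)) := {u | ∃ μ : MatMeasure Ω, HasSymGrad u μ}

variable {Ω}

/-- The measure `Eu`, for `u ∈ BD(Ω)`. -/
def BD.E (u : BD Ω) : MatMeasure Ω := Classical.choose u.2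

theorem BD.hasSymGrad_E (u : BD Ω) : HasSymGrad (u : Lp (Rn n) 1 (volOn Ω)) (BD.E u) :=
  Classical.choose_spec u.2

/-- Weak* convergence in `BD(Ω)`. -/
def BD.WeakStarConv (u : ℕ → BD Ω) (v : BD Ω) : Prop :=
  Tendsto (fun k => (u k : Lp (Rn n) 1 (volOn Ω))) atTop (𝓝 (v : Lp (Rn n) 1 (volOn Ω))) ∧
    MatMeasure.WeakStarConv (fun k => BD.E (u k)) (BD.E v)

end BD

end

/-! Write `α̃_k Eu_k = α̃_k E(u_k - u) + α̃_k Eu`. Integration by parts turns the pairing of `φ`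
with an entry of `α̃ Ew` into minus the integral of `w` against `∇(φ α)`, symmetrised
(`productTerm`). This makes sense because `w` lies locally in `L^{n/(n-1)}`, the dual exponent of
`∇α ∈ L^n`. For the fixed field `u` the expression is a bounded linear functional of `α ∈ W^{1,n}`,
so weak convergence gives `α̃_k Eu → α̃ Eu`.

The defect `η` is therefore the limit of `α̃_k E(u_k - u)`. Test it with `ψ²`. The term containing
`∇ψ` vanishes, since `α_k` is bounded and `u_k → u` in `L¹`. The other term is the integral of `ψ
(u_k - u)` against `ψ ∇α_k`; Hölder and the Sobolev inequality for `ψ (u_k - u)` bound it by `|E(u_k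
- u)|(ψ)`, up to `∇ψ` terms, times `(∫ ψ |∇α_k|^n)^{1/n}`. If `μ` and `Λ` are weak* limits of these
two families of measures, then `|η(ψ²)| ≤ κ μ(ψ) Λ(ψ)^{1/n}` for `0 ≤ ψ ≤ 1`. A set without atoms of
`Λ` can be cut into countably many pieces of `Λ`-mass at most `ε`; summing the estimate over the
pieces gives `κ μ ε^{1/n}`, so `η` vanishes there. It lives on the atoms of `Λ`, which are at most
countable. This is the concentration-compactness scheme (`measure_le_of_forall_test`,
`SymGradData.exists_abs_limit_le`).

Two inputs are needed. The first is Strauss's inequality `‖w‖_{n/(n-1)} ≤ C ‖Ew‖_1`, although the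
full gradient of `w` is not controlled in `L¹`. It follows the Gagliardo–Nirenberg argument, but
along directions `ξ` taken from several bases: the derivative of `ξ · w` along `ξ` involves only
`Ew` (`lintegral_rpow_le_symPartNorm`, `SymGradData.exists_sobolev`).

The second is the meaning of `α̃ Eu`, for which sets of small capacity must be negligible for
`|Eu|`. The tool is `SymGradData.tendsto_lintegral_sq`: if smooth, uniformly bounded `z_k` tend to
zero in `W^{1,n}_loc`, then `∫_K z_k² d|Eu| → 0`. Indeed the signed pairing with `χ z_k²` tends to
zero by duality for every test function `χ`, and since `z_k² ≥ 0` and the Jordan parts are mutually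
singular, cutoffs separate the two parts. Applied to differences of mollifications of `α`, this
gives a Cauchy sequence in `L²(|Eu|)` on compact sets; applied to mollified capacitary potentials,
it identifies the limit with every quasicontinuous representative (`SymGradData.tendsto_moll_rep`).
The bound on `α̃` and the formula by `productTerm` follow. -/

noncomputable section

/-! ### Strauss's inequality for compactly supported `C¹` fields -/

section KornSobolev

variable {n : ℕ}

/-- The entry `(i, j)` of the symmetrised gradient of the field with components `w`. -/
def symPart (w : Fin n → Rn n → ℝ) (i j : Fin n) (x : Rn n) : ℝ :=
  (partialD j (w i) x + partialD i (w j) x) / 2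

/-- The sum of the absolute values of the entries of the symmetrised gradient. -/
def symPartNorm (w : Fin n → Rn n → ℝ) (x : Rn n) : ℝ≥0∞ :=
  ∑ i, ∑ j, ‖symPart w i j x‖ₑ

theorem fderiv_apply_eq_sum (φ : Rn n → ℝ) (x ξ : Rn n) :
    fderiv ℝ φ x ξ = ∑ l, ξ l * partialD l φ x := by
  conv_lhs => rw [← (EuclideanSpace.basisFun (Fin n) ℝ).sum_repr ξ]
  simp [partialD, map_sum]

theorem continuous_partialD_of_contDiff {φ : Rn n → ℝ} (hφ : ContDiff ℝ 1 φ) (i : Fin n) :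
    Continuous (partialD i φ) :=
  (hφ.continuous_fderiv (by simp)).clm_apply continuous_const

theorem measurable_symPartNorm {w : Fin n → Rn n → ℝ} (hw : ∀ i, ContDiff ℝ 1 (w i)) :
    Measurable (symPartNorm w) := by
  unfold symPartNorm symPart
  refine Finset.measurable_sum _ fun i _ => Finset.measurable_sum _ fun j _ => ?_
  refine Measurable.enorm (Measurable.div_const (Measurable.add ?_ ?_) _)
  · exact (continuous_partialD_of_contDiff (hw i) j).measurable
  · exact (continuous_partialD_of_contDiff (hw j) i).measurable

/-- The coefficients `ξ k * ξ l` are symmetric, so the antisymmetric part of the gradient drops out.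
This is why the component of `w` along `ξ` can be integrated along `ξ` knowing only the symmetrised
gradient. -/
theorem sum_mul_fderiv_eq_symPart (w : Fin n → Rn n → ℝ) (x ξ : Rn n) :
    ∑ k, ξ k * fderiv ℝ (w k) x ξ = ∑ k, ∑ l, ξ k * ξ l * symPart w k l x := by
  simp only [fderiv_apply_eq_sum, Finset.mul_sum]
  have h : ∑ k, ∑ l, ξ k * ξ l * symPart w k l x
      = (∑ k, ∑ l, ξ k * (ξ l * partialD l (w k) x)
        + ∑ k, ∑ l, ξ l * (ξ k * partialD k (w l) x)) / 2 := by
    rw [← Finset.sum_add_distrib, Finset.sum_div]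
    refine Finset.sum_congr rfl fun k _ => ?_
    rw [← Finset.sum_add_distrib, Finset.sum_div]
    refine Finset.sum_congr rfl fun l _ => ?_
    simp only [symPart]; ring
  rw [h, Finset.sum_comm (f := fun k l => ξ l * (ξ k * partialD k (w l) x))]
  ring

theorem enorm_sum_mul_symPart_le (w : Fin n → Rn n → ℝ) (x ξ : Rn n) {D : ℝ≥0}
    (hD : ∀ k l, ‖ξ k * ξ l‖₊ ≤ D) :
    ‖∑ k, ∑ l, ξ k * ξ l * symPart w k l x‖ₑ ≤ D * symPartNorm w x := by
  unfold symPartNorm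
  rw [Finset.mul_sum]
  refine (enorm_sum_le _ _).trans (Finset.sum_le_sum fun k _ => ?_)
  rw [Finset.mul_sum]
  refine (enorm_sum_le _ _).trans (Finset.sum_le_sum fun l _ => ?_)
  rw [enorm_mul]
  gcongr
  exact_mod_cast hD k l

/-- The product over the directions of a basis of the directional components is controlled by the
symmetrised gradient. -/
theorem lintegral_prod_directional_le [NeZero n] {q : ℝ} (hq : Real.HolderConjugate n q)
    (A : (Fin n → ℝ) ≃L[ℝ] Rn n) :
    ∃ C : ℝ≥0, ∀ w : Fin n → Rn n → ℝ, (∀ i, ContDiff ℝ 1 (w i)) →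
      (∀ i, HasCompactSupport (w i)) →
      ∫⁻ x, ∏ i, ‖∑ k, A (Pi.single i 1) k * w k x‖ₑ ^ ((1 : ℝ) / (n - 1 : ℝ)) ≤
        C * (∫⁻ x, symPartNorm w x) ^ q := by
  classical
  set c := Measure.addHaarScalarFactor (volume : Measure (Rn n))
    ((volume : Measure (Fin n → ℝ)).map A)
  have hc : 0 < c := Measure.addHaarScalarFactor_pos_of_isAddHaarMeasure ..
  have h2c : (volume : Measure (Rn n)) = c • ((volume : Measure (Fin n → ℝ)).map A) :=
    Measure.isAddLeftInvariant_eq_smul ..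
  set D : ℝ≥0 := ∑ i, ∑ k, ∑ l, ‖A (Pi.single i 1) k * A (Pi.single i 1) l‖₊
  have hD : ∀ i k l, ‖A (Pi.single i 1) k * A (Pi.single i 1) l‖₊ ≤ D := by
    intro i k l
    refine le_trans ?_ (Finset.single_le_sum (f := fun i => ∑ k, ∑ l,
      ‖A (Pi.single i 1) k * A (Pi.single i 1) l‖₊) (fun _ _ => zero_le) (Finset.mem_univ i))
    refine le_trans ?_ (Finset.single_le_sum (f := fun k => ∑ l,
      ‖A (Pi.single i 1) k * A (Pi.single i 1) l‖₊) (fun _ _ => zero_le) (Finset.mem_univ k))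
    exact Finset.single_le_sum (f := fun l => ‖A (Pi.single i 1) k * A (Pi.single i 1) l‖₊)
      (fun _ _ => zero_le) (Finset.mem_univ l)
  have hq0 : 0 ≤ q := hq.symm.nonneg
  -- The change of variables `x = A t` has the Jacobian factor `c`. It appears once outside on the
  -- left, and its inverse appears inside the power on the right.
  refine ⟨c * (D * c⁻¹) ^ q, fun w hw hws => ?_⟩
  have hcv : ∀ F : Rn n → ℝ≥0∞, Measurable F → ∫⁻ x, F x = c * ∫⁻ t, F (A t) := by
    intro F hF
    conv_lhs => rw [h2c]
    rw [lintegral_smul_measure, lintegral_map hF A.continuous.measurable]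
    rfl
  have hmeasE := measurable_symPartNorm hw
  have hwc : ∀ k, Continuous (w k) := fun k => (hw k).continuous
  rw [hcv _ (by fun_prop), hcv _ hmeasE]
  -- Varying the coordinate `t i` moves `A t` along the direction `A (Pi.single i 1)`, so the
  -- fundamental theorem of calculus on that line applies to the component of `w` in this same
  -- direction.
  have key : ∀ t : Fin n → ℝ, ∀ i, ‖∑ k, A (Pi.single i 1) k * w k (A t)‖ₑ
      ≤ ∫⁻ s, D * symPartNorm w (A (Function.update t i s)) := by
    intro t i
    set g : ℝ → ℝ := fun s => ∑ k, A (Pi.single i 1) k * w k (A (Function.update t i s)) with hg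
    have hup : ∀ s, HasDerivAt (fun s => A (Function.update t i s)) (A (Pi.single i 1)) s :=
      fun s =>
      A.toContinuousLinearMap.hasFDerivAt.comp_hasDerivAt s (hasDerivAt_update t i s)
    have hder : ∀ s, HasDerivAt g (∑ k, A (Pi.single i 1) k *
        fderiv ℝ (w k) (A (Function.update t i s)) (A (Pi.single i 1))) s := by
      intro s
      refine HasDerivAt.fun_sum fun k _ => HasDerivAt.const_mul _ ?_
      exact ((hw k).differentiable one_ne_zero _).hasFDerivAt.comp_hasDerivAt s (hup s)
    have hgC : ContDiff ℝ 1 g := by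
      refine ContDiff.sum fun k _ => contDiff_const.mul ((hw k).comp ?_)
      exact A.contDiff.comp (by convert! contDiff_update 1 t i)
    have hgs : HasCompactSupport g := by
      have : ∀ k, HasCompactSupport fun s => w k (A (Function.update t i s)) := fun k =>
        (hws k).comp_isClosedEmbedding (A.toHomeomorph.isClosedEmbedding.comp
          (isClosedEmbedding_update t i))
      have h2 : HasCompactSupport (∑ k, fun s => A (Pi.single i 1) k *
          w k (A (Function.update t i s))) := by
        refine Finset.sum_induction _ HasCompactSupport (fun a b => HasCompactSupport.add)
          HasCompactSupport.zero fun k _ => (this k).mul_left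
      convert h2 using 1
      ext s; simp [hg]
    calc ‖∑ k, A (Pi.single i 1) k * w k (A t)‖ₑ = ‖g (t i)‖ₑ := by simp [hg]
      _ ≤ ∫⁻ s in Set.Iic (t i), ‖deriv g s‖ₑ := hgs.enorm_le_lintegral_Ici_deriv hgC _
      _ ≤ ∫⁻ s, ‖deriv g s‖ₑ := setLIntegral_le_lintegral _ _
      _ ≤ _ := by
        refine lintegral_mono fun s => ?_
        rw [(hder s).deriv, sum_mul_fderiv_eq_symPart]
        exact enorm_sum_mul_symPart_le w _ _ (hD i)
  have hn1 : (0 : ℝ) ≤ 1 / (n - 1 : ℝ) := by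
    have := hq.lt
    have : (0 : ℝ) ≤ n - 1 := by linarith
    positivity
  -- The grid-lines inequality behind Gagliardo–Nirenberg–Sobolev, for the single function `D *
  -- symPartNorm w (A t)`.
  have hgrid := lintegral_prod_lintegral_pow_le (fun _ : Fin n => (volume : Measure ℝ))
    (p := q) (by simpa using hq) (f := fun t => D * symPartNorm w (A t))
    ((hmeasE.comp A.continuous.measurable).const_mul _)
  simp only [Fintype.card_fin] at hgrid
  calc c * ∫⁻ t, ∏ i, ‖∑ k, A (Pi.single i 1) k * w k (A t)‖ₑ ^ ((1 : ℝ) / (n - 1 : ℝ))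
      ≤ c * ∫⁻ t, ∏ i, (∫⁻ s, D * symPartNorm w (A (Function.update t i s)))
          ^ ((1 : ℝ) / (n - 1 : ℝ)) := by
        gcongr with t i
        exact key t i
    _ ≤ c * (∫⁻ t, D * symPartNorm w (A t)) ^ q := by gcongr; exact hgrid
    _ = _ := by
        rw [lintegral_const_mul (f := fun t => symPartNorm w (A t)) _
          (hmeasE.comp A.continuous.measurable)]
        push_cast
        rw [ENNReal.coe_rpow_of_nonneg _ hq0]
        push_cast
        rw [ENNReal.coe_inv hc.ne', mul_assoc, ← ENNReal.mul_rpow_of_nonneg _ _ hq0]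
        congr 2
        rw [mul_assoc, ← mul_assoc (c : ℝ≥0∞)⁻¹, ENNReal.inv_mul_cancel (by exact_mod_cast hc.ne')
          (by simp), one_mul]

/-- The point of parameter `t` on the moment curve. -/
def momentVec (n : ℕ) (t : ℕ) : Rn n := WithLp.toLp 2 fun k => (t : ℝ) ^ (k : ℕ)

/-- The linear parametrisation of `ℝⁿ` by the coordinates in a basis of points on the moment
curve. -/
theorem exists_equiv_momentVec (σ : Fin n → ℕ) (hσ : Function.Injective σ) :
    ∃ A : (Fin n → ℝ) ≃L[ℝ] Rn n, ∀ i, A (Pi.single i 1) = momentVec n (σ i) := by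
  set V := (Matrix.vandermonde fun i => (σ i : ℝ)).transpose
  have hdet : IsUnit V.det := by
    rw [Matrix.det_transpose, isUnit_iff_ne_zero, Matrix.det_vandermonde_ne_zero_iff]
    exact Nat.cast_injective.comp hσ
  let e : (Fin n → ℝ) ≃ₗ[ℝ] (Fin n → ℝ) := Matrix.toLinearEquiv' V
    (Matrix.invertibleOfIsUnitDet V hdet)
  refine ⟨(e.toContinuousLinearEquiv).trans (EuclideanSpace.equiv (Fin n) ℝ).symm, fun i => ?_⟩
  ext k
  change (V.mulVec (Pi.single i 1)) k = _
  simp [momentVec, V, Matrix.vandermonde]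

/-- Distinct nodes make the Vandermonde matrix invertible, and an injective linear map in finite
dimension is bounded below. -/
theorem exists_norm_le_momentVec (σ : Fin n → ℕ) (hσ : Function.Injective σ) :
    ∃ C : ℝ, 0 < C ∧ ∀ w : Fin n → ℝ, ∀ r : ℝ, 0 ≤ r →
      (∀ i, |∑ k, momentVec n (σ i) k * w k| ≤ r) → ‖w‖ ≤ C * r := by
  set V := Matrix.vandermonde fun i => (σ i : ℝ)
  have hdet : IsUnit V.det := by
    rw [isUnit_iff_ne_zero, Matrix.det_vandermonde_ne_zero_iff]
    exact Nat.cast_injective.comp hσ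
  have hinj : LinearMap.ker (Matrix.toLin' V) = ⊥ := by
    rw [LinearMap.ker_eq_bot]
    exact Matrix.mulVec_injective_iff_isUnit.2 ((Matrix.isUnit_iff_isUnit_det V).2 hdet)
  obtain ⟨K, hK0, hK⟩ := LinearMap.exists_antilipschitzWith _ hinj
  refine ⟨K, hK0, fun w r hr h => ?_⟩
  have h1 := hK.le_mul_dist w 0
  simp only [map_zero, dist_zero_right] at h1
  refine h1.trans ?_
  gcongr
  rw [pi_norm_le_iff_of_nonneg hr]
  intro i
  have : Matrix.toLin' V w i = ∑ k, momentVec n (σ i) k * w k := by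
    simp [V, Matrix.mulVec, dotProduct, momentVec, Matrix.vandermonde]
  rw [this]
  exact h i

/-- Pigeonhole on `2 n - 1` points of the moment curve, any `n` of which form a basis. If fewer than
`n` components of `w` were large, then `n` components would be small; these come from a basis, so
`w` itself would be smaller than its own norm unless `w = 0`. The constant exceeds every basis
constant strictly, which makes this a contradiction. -/
theorem exists_directions (n : ℕ) [NeZero n] :
    ∃ C : ℝ, 0 < C ∧ ∀ w : Fin n → ℝ, ∃ σ : Fin n ↪ Fin (2 * n - 1),
      ∀ i, ‖w‖ ≤ C * |∑ k, momentVec n (σ i) k * w k| := by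
  classical
  have hex : ∀ σ : Fin n ↪ Fin (2 * n - 1), ∃ C : ℝ, 0 < C ∧ ∀ w : Fin n → ℝ, ∀ r : ℝ, 0 ≤ r →
      (∀ i, |∑ k, momentVec n (σ i) k * w k| ≤ r) → ‖w‖ ≤ C * r := fun σ =>
    exists_norm_le_momentVec (fun i => (σ i : ℕ)) (Fin.val_injective.comp σ.injective)
  choose Cσ hCσ hCσ' using hex
  set C : ℝ := 1 + ∑ σ, Cσ σ
  have hCpos : 0 < C := by
    have : 0 ≤ ∑ σ, Cσ σ := Finset.sum_nonneg fun σ _ => (hCσ σ).le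
    simp only [C]; linarith
  have hle : ∀ σ, Cσ σ < C := fun σ => by
    have := Finset.single_le_sum (f := Cσ) (fun σ _ => (hCσ σ).le) (Finset.mem_univ σ)
    simp only [C]; linarith
  refine ⟨C, hCpos, fun w => ?_⟩
  set S : Finset (Fin (2 * n - 1)) := Finset.univ.filter
    fun t => ‖w‖ ≤ C * |∑ k, momentVec n t k * w k|
  by_cases hS : n ≤ S.card
  · obtain ⟨T, hTS, hT⟩ := Finset.exists_subset_card_eq hS
    refine ⟨(T.orderEmbOfFin hT).toEmbedding, fun i => ?_⟩
    have := hTS (T.orderEmbOfFin_mem hT i)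
    simpa [S] using this
  · have hcard : n ≤ Sᶜ.card := by
      rw [Finset.card_compl, Fintype.card_fin]; omega
    obtain ⟨T, hTS, hT⟩ := Finset.exists_subset_card_eq hcard
    set σ := (T.orderEmbOfFin hT).toEmbedding
    have h1 : ∀ i, |∑ k, momentVec n (σ i) k * w k| ≤ ‖w‖ / C := by
      intro i
      have := hTS (T.orderEmbOfFin_mem hT i)
      simp only [S, Finset.compl_filter, Finset.mem_filter, Finset.mem_univ, true_and,
        not_le] at this
      rw [le_div_iff₀ hCpos, mul_comm]
      exact this.le
    have h2 := hCσ' σ w (‖w‖ / C) (by positivity) h1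
    have h3 : ‖w‖ = 0 := by
      by_contra hne
      have hpos : 0 < ‖w‖ := lt_of_le_of_ne (norm_nonneg _) (Ne.symm hne)
      have : Cσ σ * (‖w‖ / C) < ‖w‖ := by
        rw [mul_div_assoc', div_lt_iff₀ hCpos, mul_comm]
        exact mul_lt_mul_of_pos_left (hle σ) hpos
      linarith
    exact ⟨σ, fun i => by rw [h3]; positivity⟩

/-- **Korn–Sobolev inequality** (Strauss): the `L^{n/(n-1)}` norm of a compactly supported `C¹`
field is controlled by the `L¹` norm of its symmetrised gradient. -/
theorem lintegral_rpow_le_symPartNorm [NeZero n] {q : ℝ} (hq : Real.HolderConjugate n q) :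
    ∃ C : ℝ≥0, ∀ w : Fin n → Rn n → ℝ, (∀ i, ContDiff ℝ 1 (w i)) →
      (∀ i, HasCompactSupport (w i)) →
      ∫⁻ x, ‖(fun i => w i x : Fin n → ℝ)‖ₑ ^ q ≤ C * (∫⁻ x, symPartNorm w x) ^ q := by
  classical
  have hex : ∀ σ : Fin n ↪ Fin (2 * n - 1), ∃ C : ℝ≥0, ∀ w : Fin n → Rn n → ℝ,
      (∀ i, ContDiff ℝ 1 (w i)) → (∀ i, HasCompactSupport (w i)) →
      ∫⁻ x, ∏ i, ‖∑ k, momentVec n (σ i) k * w k x‖ₑ ^ ((1 : ℝ) / (n - 1 : ℝ)) ≤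
        C * (∫⁻ x, symPartNorm w x) ^ q := by
    intro σ
    obtain ⟨A, hA⟩ := exists_equiv_momentVec (fun i => (σ i : ℕ))
      (Fin.val_injective.comp σ.injective)
    simpa only [hA] using lintegral_prod_directional_le hq A
  choose Cσ hCσ using hex
  obtain ⟨C₀, hC₀, hdir⟩ := exists_directions n
  have hn : (1 : ℝ) < n := hq.lt
  have hn1 : (0 : ℝ) < n - 1 := by linarith
  have hq0 : 0 ≤ q := hq.symm.nonneg
  -- The good choice `σ` of directions depends on the point `x`, so the pointwise bound takes the
  -- sum over all the finitely many `σ`.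
  refine ⟨C₀.toNNReal ^ q * ∑ σ, Cσ σ, fun w hw hws => ?_⟩
  have hwc : ∀ k, Continuous (w k) := fun k => (hw k).continuous
  have hpt : ∀ x, ‖(fun i => w i x : Fin n → ℝ)‖ₑ ^ q ≤ (C₀.toNNReal : ℝ≥0∞) ^ q *
      ∑ σ : Fin n ↪ Fin (2 * n - 1),
        ∏ i, ‖∑ k, momentVec n (σ i) k * w k x‖ₑ ^ ((1 : ℝ) / (n - 1 : ℝ)) := by
    intro x
    obtain ⟨σ, hσ⟩ := hdir fun i => w i x
    -- The power `q = n / (n - 1)` of the norm is a product of `n` equal factors, one for each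
    -- direction.
    have hexp : q = (1 / (n - 1 : ℝ)) * n := by
      rw [hq.conjugate_eq]; field_simp
    have e1 : ‖(fun i => w i x : Fin n → ℝ)‖ₑ ^ q
        = ∏ _i : Fin n, ‖(fun i => w i x : Fin n → ℝ)‖ₑ ^ ((1 : ℝ) / (n - 1 : ℝ)) := by
      rw [Finset.prod_const, Finset.card_univ, Fintype.card_fin, ← ENNReal.rpow_natCast,
        ← ENNReal.rpow_mul, ← hexp]
    have e2 : (C₀.toNNReal : ℝ≥0∞) ^ q
        = ∏ _i : Fin n, (C₀.toNNReal : ℝ≥0∞) ^ ((1 : ℝ) / (n - 1 : ℝ)) := by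
      rw [Finset.prod_const, Finset.card_univ, Fintype.card_fin, ← ENNReal.rpow_natCast,
        ← ENNReal.rpow_mul, ← hexp]
    calc _ ≤ (C₀.toNNReal : ℝ≥0∞) ^ q *
          ∏ i, ‖∑ k, momentVec n (σ i) k * w k x‖ₑ ^ ((1 : ℝ) / (n - 1 : ℝ)) := by
          rw [e1, e2, ← Finset.prod_mul_distrib]
          refine Finset.prod_le_prod' fun i _ => ?_
          rw [← ENNReal.mul_rpow_of_nonneg _ _ (by positivity)]
          refine ENNReal.rpow_le_rpow ?_ (by positivity)
          have := hσ i
          rw [← ofReal_norm, ← ofReal_norm, ← ENNReal.ofReal.eq_1, ← ENNReal.ofReal_mul hC₀.le]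
          exact ENNReal.ofReal_le_ofReal this
      _ ≤ _ := by
          gcongr
          exact Finset.single_le_sum (f := fun σ : Fin n ↪ Fin (2 * n - 1) =>
            ∏ i, ‖∑ k, momentVec n (σ i) k * w k x‖ₑ ^ ((1 : ℝ) / (n - 1 : ℝ)))
            (fun _ _ => zero_le) (Finset.mem_univ σ)
  have hm : ∀ σ : Fin n ↪ Fin (2 * n - 1), Measurable fun x =>
      ∏ i, ‖∑ k, momentVec n (σ i) k * w k x‖ₑ ^ ((1 : ℝ) / (n - 1 : ℝ)) := fun σ => by fun_prop
  calc _ ≤ ∫⁻ x, (C₀.toNNReal : ℝ≥0∞) ^ q * ∑ σ : Fin n ↪ Fin (2 * n - 1),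
        ∏ i, ‖∑ k, momentVec n (σ i) k * w k x‖ₑ ^ ((1 : ℝ) / (n - 1 : ℝ)) := lintegral_mono hpt
    _ = (C₀.toNNReal : ℝ≥0∞) ^ q * ∑ σ : Fin n ↪ Fin (2 * n - 1),
        ∫⁻ x, ∏ i, ‖∑ k, momentVec n (σ i) k * w k x‖ₑ ^ ((1 : ℝ) / (n - 1 : ℝ)) := by
        rw [lintegral_const_mul _ (Finset.measurable_sum _ fun σ _ => hm σ),
          lintegral_finsetSum _ fun σ _ => hm σ]
    _ ≤ (C₀.toNNReal : ℝ≥0∞) ^ q * ∑ σ : Fin n ↪ Fin (2 * n - 1),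
        (Cσ σ * (∫⁻ x, symPartNorm w x) ^ q) := by
        gcongr with σ
        exact hCσ σ w hw hws
    _ = _ := by
        rw [← Finset.sum_mul, ← mul_assoc]
        push_cast
        rw [ENNReal.coe_rpow_of_nonneg _ hq0]

end KornSobolev

end

noncomputable section

/-! ### Mollification and its convergence in `L^p` -/

section Mollifier

variable {n : ℕ}

/-- A bump function supported in the ball of radius `1 / (j + 1)`. -/
def mollBump (n j : ℕ) : ContDiffBump (0 : Rn n) where
  rIn := 1 / (2 * ((j : ℝ) + 1))
  rOut := 1 / ((j : ℝ) + 1)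
  rIn_pos := by positivity
  rIn_lt_rOut := by
    apply one_div_lt_one_div_of_lt <;> linarith [(Nat.cast_nonneg j : (0 : ℝ) ≤ j)]

/-- The standard mollifier at scale `1 / (j + 1)`. -/
def mollKer (j : ℕ) : Rn n → ℝ := (mollBump n j).normed volume

/-- The mollification of `f` at scale `1 / (j + 1)`. -/
def moll (j : ℕ) (f : Rn n → ℝ) : Rn n → ℝ :=
  convolution (mollKer j) f (ContinuousLinearMap.lsmul ℝ ℝ) volume

theorem mollBump_rOut_tendsto : Tendsto (fun j => (mollBump n j).rOut) atTop (𝓝 0) :=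
  tendsto_one_div_add_atTop_nhds_zero_nat

theorem moll_apply (j : ℕ) (f : Rn n → ℝ) (x : Rn n) :
    moll j f x = ∫ y, mollKer j (x - y) * f y := by
  simp [moll, convolution_eq_swap]

theorem moll_apply' (j : ℕ) (f : Rn n → ℝ) (x : Rn n) :
    moll j f x = ∫ t, mollKer j t * f (x - t) := by
  simp [moll, convolution_def]

theorem mollKer_nonneg (j : ℕ) (x : Rn n) : 0 ≤ mollKer j x := (mollBump n j).nonneg_normed x

theorem integral_mollKer (j : ℕ) : ∫ x : Rn n, mollKer j x = 1 := (mollBump n j).integral_normed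

theorem contDiff_mollKer (j : ℕ) : ContDiff ℝ (⊤ : ℕ∞) (mollKer j : Rn n → ℝ) :=
  (mollBump n j).contDiff_normed

theorem hasCompactSupport_mollKer (j : ℕ) : HasCompactSupport (mollKer j : Rn n → ℝ) :=
  (mollBump n j).hasCompactSupport_normed

theorem integrable_mollKer (j : ℕ) : Integrable (mollKer j : Rn n → ℝ) :=
  (contDiff_mollKer j).continuous.integrable_of_hasCompactSupport (hasCompactSupport_mollKer j)

theorem mollKer_eq_zero {j : ℕ} {x : Rn n} (h : 1 / ((j : ℝ) + 1) ≤ ‖x‖) : mollKer j x = 0 := by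
  have : x ∉ Function.support (mollKer j : Rn n → ℝ) := by
    rw [mollKer, ContDiffBump.support_normed_eq]
    simpa [mollBump] using h
  simpa using this

theorem lintegral_mollKer (j : ℕ) : ∫⁻ x : Rn n, ‖mollKer j x‖ₑ = 1 := by
  have h := ofReal_integral_eq_lintegral_ofReal (integrable_mollKer (n := n) j)
    (Eventually.of_forall (mollKer_nonneg j))
  rw [integral_mollKer] at h
  rw [← ENNReal.ofReal_one, h]
  exact lintegral_congr fun x => Real.enorm_of_nonneg (mollKer_nonneg j x)

theorem contDiff_moll (j : ℕ) {f : Rn n → ℝ} (hf : LocallyIntegrable f) :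
    ContDiff ℝ (⊤ : ℕ∞) (moll j f) :=
  (hasCompactSupport_mollKer j).contDiff_convolution_left _ (contDiff_mollKer j) hf

theorem hasCompactSupport_moll (j : ℕ) {f : Rn n → ℝ} (hf : HasCompactSupport f) :
    HasCompactSupport (moll j f) :=
  (hasCompactSupport_mollKer j).convolution _ hf

theorem partialD_moll (j : ℕ) {f : Rn n → ℝ} (hf : LocallyIntegrable f) (i : Fin n) (x : Rn n) :
    partialD i (moll j f) x = ∫ y, partialD i (mollKer j) (x - y) * f y := by
  have hd := (hasCompactSupport_mollKer (n := n) j).hasFDerivAt_convolution_left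
    (ContinuousLinearMap.lsmul ℝ ℝ) ((contDiff_mollKer j).of_le (by norm_num)) hf x
  rw [partialD, moll, hd.fderiv, convolution_eq_swap]
  have hi : ConvolutionExistsAt (fderiv ℝ (mollKer j)) f x
      ((ContinuousLinearMap.lsmul ℝ ℝ).precompL (Rn n)) volume :=
    ((hasCompactSupport_mollKer j).fderiv (𝕜 := ℝ)).convolutionExists_left _
      ((contDiff_mollKer j).continuous_fderiv (by simp)) hf x
  rw [ContinuousLinearMap.integral_apply (hi.integrable_swap)]
  rfl

theorem integrable_mollKer_mul (j : ℕ) {f : Rn n → ℝ} (hf : LocallyIntegrable f) (x : Rn n) :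
    Integrable fun y => mollKer j (x - y) * f y :=
  ((hasCompactSupport_mollKer j).convolutionExists_left (ContinuousLinearMap.lsmul ℝ ℝ)
    (contDiff_mollKer j).continuous hf x).integrable_swap

theorem moll_sub (j : ℕ) {f g : Rn n → ℝ} (hf : LocallyIntegrable f) (hg : LocallyIntegrable g) :
    moll j (f - g) = moll j f - moll j g := by
  ext x
  rw [Pi.sub_apply, moll_apply, moll_apply, moll_apply, ← integral_sub
    (integrable_mollKer_mul j hf x) (integrable_mollKer_mul j hg x)]
  simp [mul_sub]

theorem abs_moll_le (j : ℕ) {f : Rn n → ℝ} {C : ℝ} (h : ∀ᵐ x, |f x| ≤ C) (x : Rn n) :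
    |moll j f x| ≤ C := by
  rw [moll_apply, ← Real.norm_eq_abs]
  have h_int : ∫ y, mollKer j (x - y) * C = C := by
    rw [integral_mul_const, integral_sub_left_eq_self (mollKer j) volume x, integral_mollKer,
      one_mul]
  refine (norm_integral_le_of_norm_le (g := fun y => mollKer j (x - y) * C) ?_ ?_).trans h_int.le
  · exact ((integrable_comp_sub_left (mollKer j) x).2 (integrable_mollKer j)).mul_const C
  · filter_upwards [h] with y hy
    rw [norm_mul, Real.norm_of_nonneg (mollKer_nonneg j _)]
    exact mul_le_mul_of_nonneg_left hy (mollKer_nonneg j _)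

theorem ae_tendsto_moll {f : Rn n → ℝ} (hf : LocallyIntegrable f) :
    ∀ᵐ x, Tendsto (fun j => moll j f x) atTop (𝓝 (f x)) := by
  -- The outer radius of the bump is exactly twice the inner one, so the supports shrink regularly.
  refine ContDiffBump.ae_convolution_tendsto_right_of_locallyIntegrable (K := 2)
    (φ := fun j => mollBump n j) mollBump_rOut_tendsto (Eventually.of_forall fun j => ?_) hf
  simp only [mollBump]
  have : (0 : ℝ) < j + 1 := by positivity
  field_simp
  norm_num

/-- The kernel is a probability density: compare the `L¹` and `L^p` norms under this density at each
point, then integrate in `x` by Tonelli and translation invariance. -/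
theorem eLpNorm_moll_le (j : ℕ) {f : Rn n → ℝ} (hf : AEStronglyMeasurable f) {p : ℝ≥0∞}
    (hp : 1 ≤ p) (hp' : p ≠ ∞) : eLpNorm (moll j f) p volume ≤ eLpNorm f p volume := by
  have hp0 : p ≠ 0 := (zero_lt_one.trans_le hp).ne'
  set r := p.toReal with hr
  have hr1 : 1 ≤ r := by
    rw [hr, ← ENNReal.toReal_one]
    exact ENNReal.toReal_mono hp' hp
  have hr0 : 0 < r := zero_lt_one.trans_le hr1
  set ν : Measure (Rn n) := volume.withDensity fun x => ‖mollKer j x‖ₑ with hν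
  have hkm : Measurable fun x : Rn n => ‖mollKer j x‖ₑ :=
    (contDiff_mollKer j).continuous.measurable.enorm
  have : IsProbabilityMeasure ν := ⟨by
    rw [hν, withDensity_apply _ MeasurableSet.univ, Measure.restrict_univ, lintegral_mollKer]⟩
  have hνac : ν ≪ volume := withDensity_absolutelyContinuous _ _
  have hfx : ∀ x, AEStronglyMeasurable (fun t => f (x - t)) ν := fun x =>
    (hf.comp_quasiMeasurePreserving
      (Measure.measurePreserving_sub_left volume x).quasiMeasurePreserving).mono_ac hνac
  have hpt : ∀ x, ‖moll j f x‖ₑ ^ r ≤ ∫⁻ t, ‖f (x - t)‖ₑ ^ r ∂ν := by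
    intro x
    have h1 : ‖moll j f x‖ₑ ≤ eLpNorm (fun t => f (x - t)) 1 ν := by
      rw [moll_apply', eLpNorm_one_eq_lintegral_enorm, hν,
        lintegral_withDensity_eq_lintegral_mul₀' hkm.aemeasurable]
      · refine (enorm_integral_le_lintegral_enorm _).trans (le_of_eq ?_)
        simp [enorm_mul]
      · exact (hfx x).enorm
    have h2 := h1.trans (eLpNorm_le_eLpNorm_of_exponent_le hp (hfx x))
    rw [eLpNorm_eq_lintegral_rpow_enorm_toReal hp0 hp'] at h2
    calc ‖moll j f x‖ₑ ^ r ≤ ((∫⁻ t, ‖f (x - t)‖ₑ ^ r ∂ν) ^ (1 / r)) ^ r := by gcongr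
      _ = _ := by rw [← ENNReal.rpow_mul, one_div_mul_cancel hr0.ne', ENNReal.rpow_one]
  rw [eLpNorm_eq_lintegral_rpow_enorm_toReal hp0 hp',
    eLpNorm_eq_lintegral_rpow_enorm_toReal hp0 hp']
  refine ENNReal.rpow_le_rpow ?_ (by positivity)
  calc ∫⁻ x, ‖moll j f x‖ₑ ^ r ≤ ∫⁻ x, ∫⁻ t, ‖f (x - t)‖ₑ ^ r ∂ν := lintegral_mono hpt
    _ = ∫⁻ t, ∫⁻ x, ‖f (x - t)‖ₑ ^ r ∂volume ∂ν := by
        refine lintegral_lintegral_swap ?_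
        have hq : Measure.QuasiMeasurePreserving (fun z : Rn n × Rn n => z.1 - z.2)
            (volume.prod ν) volume :=
          (quasiMeasurePreserving_sub_of_right_invariant volume volume).mono_left
            (Measure.AbsolutelyContinuous.rfl.prod hνac)
        exact (hf.comp_quasiMeasurePreserving hq).enorm.pow_const r
    _ = ∫⁻ t, ∫⁻ x, ‖f x‖ₑ ^ r ∂volume ∂ν := by
        refine lintegral_congr fun t => ?_
        exact lintegral_sub_right_eq_self (fun x => ‖f x‖ₑ ^ r) t
    _ = _ := by rw [lintegral_const, measure_univ, mul_one]

theorem tendsto_eLpNorm_moll_sub_of_continuous {g : Rn n → ℝ} (hg : Continuous g)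
    (hgs : HasCompactSupport g) (p : ℝ≥0∞) :
    Tendsto (fun j => eLpNorm (moll j g - g) p volume) atTop (𝓝 0) := by
  -- All mollification radii are at most `1`, so this one compact set contains the supports of `g`
  -- and of every `moll j g`.
  set K := Metric.cthickening 1 (tsupport g) with hK
  have hKc : IsCompact K := IsCompact.cthickening hgs
  have hKm : volume K ≠ ∞ := hKc.measure_lt_top.ne
  have hsupp : ∀ j x, x ∉ K → (moll j g - g) x = 0 := by
    intro j x hx
    have hxt : ∀ y ∈ tsupport g, 1 ≤ ‖x - y‖ := fun y hy => by
      by_contra hlt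
      push Not at hlt
      exact hx (Metric.mem_cthickening_of_dist_le x y 1 _ hy (by rw [dist_eq_norm]; exact hlt.le))
    have hgx : g x = 0 := by
      by_contra hne
      have := hxt x (subset_tsupport g hne)
      simp at this
      linarith
    rw [Pi.sub_apply, hgx, sub_zero, moll_apply]
    refine integral_eq_zero_of_ae (Eventually.of_forall fun y => ?_)
    by_cases hy : y ∈ tsupport g
    · have h1 : 1 / ((j : ℝ) + 1) ≤ ‖x - y‖ := by
        refine le_trans ?_ (hxt y hy)
        rw [div_le_one (by positivity)]
        linarith [(Nat.cast_nonneg j : (0 : ℝ) ≤ j)]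
      simp [mollKer_eq_zero h1]
    · simp [image_eq_zero_of_notMem_tsupport hy]
  have huc := hgs.uniformContinuous_of_continuous hg
  rw [ENNReal.tendsto_atTop_zero]
  intro ε hε
  -- For `p = ∞` the exponent is `0⁻¹ = 0` and `A = 1`, which is the correct factor for the sup
  -- norm.
  set A : ℝ≥0∞ := volume K ^ p.toReal⁻¹ with hA
  have hAtop : A ≠ ∞ := ENNReal.rpow_ne_top_of_nonneg (by positivity) hKm
  obtain ⟨δ, hδ, hδε⟩ : ∃ δ : ℝ, 0 < δ ∧ A * ENNReal.ofReal δ ≤ ε := by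
    by_cases hεt : ε = ∞
    · exact ⟨1, one_pos, by rw [hεt]; exact le_top⟩
    refine ⟨ε.toReal / (A.toReal + 1), by
      have := ENNReal.toReal_pos hε.ne' hεt; positivity, ?_⟩
    rw [← ENNReal.ofReal_toReal hAtop, ← ENNReal.ofReal_mul ENNReal.toReal_nonneg,
      ENNReal.toReal_ofReal ENNReal.toReal_nonneg]
    refine ENNReal.ofReal_le_of_le_toReal ?_
    rw [mul_div_assoc', div_le_iff₀ (by positivity)]
    nlinarith [ENNReal.toReal_nonneg (a := A), ENNReal.toReal_nonneg (a := ε)]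
  obtain ⟨η, hη, hηδ⟩ := Metric.uniformContinuous_iff.1 huc δ hδ
  obtain ⟨J, hJ⟩ := (Metric.tendsto_atTop.1 (mollBump_rOut_tendsto (n := n))) η hη
  refine ⟨J, fun j hj => ?_⟩
  have hr : (mollBump n j).rOut < η := by
    have := hJ j hj
    rwa [Real.dist_0_eq_abs, abs_of_pos (mollBump n j).rOut_pos] at this
  have hbd : ∀ x, ‖(moll j g - g) x‖ ≤ δ := by
    intro x
    rw [Pi.sub_apply, ← dist_eq_norm]
    refine ContDiffBump.dist_normed_convolution_le hg.aestronglyMeasurable fun y hy => ?_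
    exact (hηδ ((Metric.mem_ball.1 hy).trans hr)).le
  have hind : moll j g - g = K.indicator (moll j g - g) := by
    symm
    rw [Set.indicator_eq_self]
    intro x hx
    by_contra hxK
    exact hx (hsupp j x hxK)
  rw [hind, eLpNorm_indicator_eq_eLpNorm_restrict hKc.measurableSet]
  refine (eLpNorm_le_of_ae_bound (Eventually.of_forall hbd)).trans ?_
  simpa [hA] using hδε

theorem tendsto_eLpNorm_moll_sub {f : Rn n → ℝ} {p : ℝ≥0∞} (hf : MemLp f p volume)
    (hp : 1 ≤ p) (hp' : p ≠ ∞) :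
    Tendsto (fun j => eLpNorm (moll j f - f) p volume) atTop (𝓝 0) := by
  rw [ENNReal.tendsto_atTop_zero]
  intro ε hε
  have hε3 : ε / 3 ≠ 0 := by simp [hε.ne']
  obtain ⟨g, hgs, hfg, hgc, hgp⟩ := hf.exists_hasCompactSupport_eLpNorm_sub_le hp' hε3
  obtain ⟨J, hJ⟩ := (ENNReal.tendsto_atTop_zero.1
    (tendsto_eLpNorm_moll_sub_of_continuous hgc hgs p)) (ε / 3) (pos_iff_ne_zero.2 hε3)
  refine ⟨J, fun j hj => ?_⟩
  have hfl := hf.locallyIntegrable hp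
  have hgl := hgp.locallyIntegrable hp
  -- Three-term splitting through the continuous, compactly supported approximation `g`;
  -- mollification does not increase the norm of `f - g`.
  have hdec : moll j f - f = (moll j (f - g) + (moll j g - g)) - (f - g) := by
    rw [moll_sub j hfl hgl]; ring
  have m1 : AEStronglyMeasurable (moll j (f - g)) volume :=
    (contDiff_moll j (hfl.sub hgl)).continuous.aestronglyMeasurable
  have m2 : AEStronglyMeasurable (moll j g - g) volume :=
    ((contDiff_moll j hgl).continuous.sub hgc).aestronglyMeasurable
  have m3 : AEStronglyMeasurable (f - g) volume := hf.1.sub hgp.1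
  rw [hdec]
  calc _ ≤ eLpNorm (moll j (f - g) + (moll j g - g)) p volume + eLpNorm (f - g) p volume :=
        eLpNorm_sub_le (m1.add m2) m3 hp
    _ ≤ (eLpNorm (moll j (f - g)) p volume + eLpNorm (moll j g - g) p volume)
        + eLpNorm (f - g) p volume := by gcongr; exact eLpNorm_add_le m1 m2 hp
    _ ≤ (ε / 3 + ε / 3) + ε / 3 := by
        gcongr
        · exact (eLpNorm_moll_le j m3 hp hp').trans hfg
        · exact hJ j hj
    _ = ε := ENNReal.add_thirds ε

end Mollifier

end

noncomputable section

/-! ### Limits of products in `L^p` -/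

section LpProducts

variable {X : Type*} [MeasurableSpace X] {μ : Measure X}

theorem tendsto_eLpNorm_mul_sub_of_ae {p : ℝ≥0∞} (hp0 : p ≠ 0) (hp' : p ≠ ∞) {f : X → ℝ}
    (hf : MemLp f p μ) {g : ℕ → X → ℝ} {g₀ : X → ℝ} (hg : ∀ j, AEStronglyMeasurable (g j) μ)
    (hg₀ : AEStronglyMeasurable g₀ μ) {C : ℝ} (hgC : ∀ j, ∀ᵐ x ∂μ, |g j x| ≤ C)
    (hg₀C : ∀ᵐ x ∂μ, |g₀ x| ≤ C) (hlim : ∀ᵐ x ∂μ, Tendsto (fun j => g j x) atTop (𝓝 (g₀ x))) :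
    Tendsto (fun j => eLpNorm (fun x => f x * (g j x - g₀ x)) p μ) atTop (𝓝 0) := by
  have hr0 : 0 < p.toReal := ENNReal.toReal_pos hp0 hp'
  simp only [eLpNorm_eq_lintegral_rpow_enorm_toReal hp0 hp']
  have key : Tendsto (fun j => ∫⁻ x, ‖f x * (g j x - g₀ x)‖ₑ ^ p.toReal ∂μ) atTop
      (𝓝 (∫⁻ _, 0 ∂μ)) := by
    refine tendsto_lintegral_of_dominated_convergence'
      (fun x => (ENNReal.ofReal (2 * C) * ‖f x‖ₑ) ^ p.toReal) (fun j => ?_) (fun j => ?_) ?_ ?_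
    · exact ((hf.1.mul ((hg j).sub hg₀)).enorm.pow_const _)
    · filter_upwards [hgC j, hg₀C] with x h1 h2
      refine ENNReal.rpow_le_rpow ?_ hr0.le
      rw [enorm_mul, mul_comm]
      gcongr
      rw [← ofReal_norm]
      refine ENNReal.ofReal_le_ofReal ?_
      rw [Real.norm_eq_abs]
      exact (abs_sub _ _).trans (by linarith)
    · simp only [ENNReal.mul_rpow_of_nonneg _ _ hr0.le]
      rw [lintegral_const_mul' _ _ (ENNReal.rpow_ne_top_of_nonneg hr0.le ENNReal.ofReal_ne_top)]
      refine ENNReal.mul_ne_top (ENNReal.rpow_ne_top_of_nonneg hr0.le ENNReal.ofReal_ne_top) ?_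
      exact (lintegral_rpow_enorm_lt_top_of_eLpNorm_lt_top hp0 hp' hf.2).ne
    · filter_upwards [hlim] with x hx
      have h1 : Tendsto (fun j => f x * (g j x - g₀ x)) atTop (𝓝 0) := by
        simpa using (hx.sub_const (g₀ x)).const_mul (f x)
      have h2 := (ENNReal.continuous_rpow_const (y := p.toReal)).tendsto 0 |>.comp
        (by simpa using h1.enorm)
      simpa [ENNReal.zero_rpow_of_pos hr0, Function.comp_def] using h2
  have h2 := (ENNReal.continuous_rpow_const (y := 1 / p.toReal)).tendsto 0 |>.comp
    (by simpa using key)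
  simpa [ENNReal.zero_rpow_of_pos (inv_pos.2 hr0), Function.comp_def] using h2

theorem eLpNorm_mul_le_of_bound {p : ℝ≥0∞} {f g : X → ℝ} {C : ℝ} (hC : ∀ᵐ x ∂μ, |g x| ≤ C) :
    eLpNorm (fun x => f x * g x) p μ ≤ ENNReal.ofReal C * eLpNorm f p μ := by
  refine eLpNorm_le_mul_eLpNorm_of_ae_le_mul ?_ p
  filter_upwards [hC] with x hx
  rw [norm_mul, mul_comm]
  exact mul_le_mul_of_nonneg_right hx (norm_nonneg _)

/-- Split `f j * g j - f₀ * g₀` as `(f j - f₀) * g j + f₀ * (g j - g₀)`. The first term uses only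
the bound on `g j`, the second uses dominated convergence; so `g j` needs to converge only almost
everywhere. -/
theorem tendsto_eLpNorm_mul_sub {p : ℝ≥0∞} (hp : 1 ≤ p) (hp' : p ≠ ∞) {f : ℕ → X → ℝ} {f₀ : X → ℝ}
    (hf₀ : MemLp f₀ p μ) (hf : ∀ j, AEStronglyMeasurable (f j) μ)
    (hfl : Tendsto (fun j => eLpNorm (fun x => f j x - f₀ x) p μ) atTop (𝓝 0))
    {g : ℕ → X → ℝ} {g₀ : X → ℝ} (hg : ∀ j, AEStronglyMeasurable (g j) μ)
    (hg₀ : AEStronglyMeasurable g₀ μ) {C : ℝ} (hgC : ∀ j, ∀ᵐ x ∂μ, |g j x| ≤ C)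
    (hg₀C : ∀ᵐ x ∂μ, |g₀ x| ≤ C) (hlim : ∀ᵐ x ∂μ, Tendsto (fun j => g j x) atTop (𝓝 (g₀ x))) :
    Tendsto (fun j => eLpNorm (fun x => f j x * g j x - f₀ x * g₀ x) p μ) atTop (𝓝 0) := by
  have hp0 : p ≠ 0 := (zero_lt_one.trans_le hp).ne'
  have h1 := tendsto_eLpNorm_mul_sub_of_ae hp0 hp' hf₀ hg hg₀ hgC hg₀C hlim
  have h2 : Tendsto (fun j => ENNReal.ofReal C * eLpNorm (fun x => f j x - f₀ x) p μ) atTop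
      (𝓝 0) := by
    simpa using ENNReal.Tendsto.const_mul hfl (Or.inr ENNReal.ofReal_ne_top)
  have h3 := h2.add h1
  rw [zero_add] at h3
  refine tendsto_of_tendsto_of_tendsto_of_le_of_le tendsto_const_nhds h3 (fun _ => zero_le)
    fun j => ?_
  have e : (fun x => f j x * g j x - f₀ x * g₀ x)
      = (fun x => (f j x - f₀ x) * g j x) + fun x => f₀ x * (g j x - g₀ x) := by
    ext x; simp only [Pi.add_apply]; ring
  simp only [e]
  refine (eLpNorm_add_le (((hf j).sub hf₀.1).mul (hg j))
    (hf₀.1.mul ((hg j).sub hg₀)) hp).trans ?_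
  exact add_le_add (eLpNorm_mul_le_of_bound (hgC j)) le_rfl

end LpProducts

/-! ### Weak derivatives, and the product and chain rules by mollification -/

section Weak

variable {n : ℕ} {Ω : TopologicalSpace.Opens (Rn n)}

/-- `b` is the `i`-th weak partial derivative of `a` in `Ω`. -/
def WeakPartial (Ω : TopologicalSpace.Opens (Rn n)) (i : Fin n) (a b : Rn n → ℝ) : Prop :=
  ∀ φ : 𝓓(Ω, ℝ), ∫ x, a x * partialD i φ x ∂(volOn Ω) = -∫ x, b x * φ x ∂(volOn Ω)

theorem testFunction_eq_zero (φ : 𝓓(Ω, ℝ)) {x : Rn n} (hx : x ∉ tsupport φ) : φ x = 0 :=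
  image_eq_zero_of_notMem_tsupport hx

theorem partialD_eq_zero_of_notMem {φ : Rn n → ℝ} {x : Rn n} (hx : x ∉ tsupport φ) (i : Fin n) :
    partialD i φ x = 0 := by
  have : x ∉ tsupport (fderiv ℝ φ) := fun h => hx (tsupport_fderiv_subset ℝ h)
  simp [partialD, image_eq_zero_of_notMem_tsupport this]

theorem setIntegral_mul_test {a : Rn n → ℝ} {φ : Rn n → ℝ} {K : Set (Rn n)}
    (hφ : ∀ x ∉ K, φ x = 0) : ∫ x in K, a x * φ x = ∫ x, a x * φ x :=
  setIntegral_eq_integral_of_forall_compl_eq_zero fun x hx => by rw [hφ x hx, mul_zero]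

/-- When the ball lies in `Ω`, the translated kernel `y ↦ mollKer j (x - y)` is a test function. Its
derivative in `y` carries a minus sign, which cancels the one in the definition of the weak
derivative. -/
theorem WeakPartial.partialD_moll {i : Fin n} {a b : Rn n → ℝ} (h : WeakPartial Ω i a b)
    (ha : LocallyIntegrable a) {j : ℕ} {x : Rn n}
    (hx : Metric.closedBall x (1 / ((j : ℝ) + 1)) ⊆ Ω) :
    partialD i (moll j a) x = moll j b x := by
  rw [_root_.partialD_moll j ha, moll_apply]
  have hsm : ContDiff ℝ (⊤ : ℕ∞) fun y => mollKer (n := n) j (x - y) :=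
    (contDiff_mollKer j).comp (contDiff_const.sub contDiff_id)
  have hcs : HasCompactSupport fun y => mollKer (n := n) j (x - y) :=
    (hasCompactSupport_mollKer j).comp_homeomorph (Homeomorph.subLeft x)
  have hts : tsupport (fun y => mollKer (n := n) j (x - y)) ⊆ Ω := by
    refine subset_trans ?_ hx
    refine closure_minimal (fun y hy => ?_) Metric.isClosed_closedBall
    by_contra hyn
    rw [Metric.mem_closedBall, not_le, dist_comm, dist_eq_norm] at hyn
    exact hy (mollKer_eq_zero hyn.le)
  have hpd : ∀ y, partialD i (fun y => mollKer (n := n) j (x - y)) y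
      = -partialD i (mollKer j) (x - y) := by
    intro y
    have h1 : HasFDerivAt (fun y => mollKer (n := n) j (x - y))
        ((fderiv ℝ (mollKer j) (x - y)).comp (-ContinuousLinearMap.id ℝ (Rn n))) y :=
      (((contDiff_mollKer j).differentiable (by simp)) _).hasFDerivAt.comp y
        ((hasFDerivAt_id y).const_sub x)
    rw [partialD, h1.fderiv]
    simp [partialD]
  have hw := h ⟨_, hsm, hcs, hts⟩
  simp only [TestFunction.coe_mk] at hw
  rw [setIntegral_mul_test (fun y hy => partialD_eq_zero_of_notMem (fun h => hy (hts h)) i),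
    setIntegral_mul_test (fun y hy => image_eq_zero_of_notMem_tsupport (fun h => hy (hts h)))] at hw
  simp only [hpd, mul_neg, integral_neg, neg_inj] at hw
  simpa only [mul_comm] using hw

theorem eventually_forall_closedBall_subset {K : Set (Rn n)} (hK : IsCompact K) (hKΩ : K ⊆ Ω) :
    ∀ᶠ j : ℕ in atTop, ∀ x ∈ K, Metric.closedBall x (1 / ((j : ℝ) + 1)) ⊆ Ω := by
  obtain ⟨δ, hδ, hδΩ⟩ := hK.exists_cthickening_subset_open Ω.isOpen hKΩ
  have h := (tendsto_one_div_add_atTop_nhds_zero_nat (𝕜 := ℝ)).eventually (gt_mem_nhds hδ)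
  filter_upwards [h] with j hj x hx
  exact (Metric.closedBall_subset_cthickening hx _).trans
    ((Metric.cthickening_mono hj.le K).trans hδΩ)

/-- Only compact subsets of `Ω` are considered: `b` is the derivative of `a` inside `Ω` only, and
for large `j` the kernels centred in `K` stay inside. -/
theorem WeakPartial.tendsto_partialD_moll {p : ℝ≥0∞} (hp : 1 ≤ p) (hp' : p ≠ ∞) {i : Fin n}
    {a b : Rn n → ℝ} (h : WeakPartial Ω i a b) (ha : LocallyIntegrable a) (hb : MemLp b p volume)
    {K : Set (Rn n)} (hK : IsCompact K) (hKΩ : K ⊆ Ω) :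
    Tendsto (fun j => eLpNorm (fun x => partialD i (moll j a) x - b x) p (volume.restrict K)) atTop
      (𝓝 0) := by
  refine tendsto_of_tendsto_of_tendsto_of_le_of_le' tendsto_const_nhds
    (tendsto_eLpNorm_moll_sub hb hp hp') (Eventually.of_forall fun _ => zero_le) ?_
  filter_upwards [eventually_forall_closedBall_subset hK hKΩ] with j hj
  calc _ = eLpNorm (moll j b - b) p (volume.restrict K) := by
        refine eLpNorm_congr_ae ?_
        filter_upwards [ae_restrict_mem hK.measurableSet] with x hx
        rw [Pi.sub_apply, h.partialD_moll ha (hj x hx)]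
    _ ≤ _ := eLpNorm_mono_measure _ Measure.restrict_le_self

theorem tendsto_integral_mul_of_eLpNorm {ι : Type*} {l : Filter ι} {K : Set (Rn n)}
    (hK : IsCompact K) {p : ℝ≥0∞} (hp : 1 ≤ p)
    {c : ι → Rn n → ℝ} {c₀ : Rn n → ℝ} (hc : ∀ j, LocallyIntegrable (c j))
    (hc₀ : LocallyIntegrable c₀)
    (hlim : Tendsto (fun j => eLpNorm (fun x => c j x - c₀ x) p (volume.restrict K)) l (𝓝 0))
    {g : Rn n → ℝ} (hg : Continuous g) (hgK : ∀ x ∉ K, g x = 0) :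
    Tendsto (fun j => ∫ x, c j x * g x) l (𝓝 (∫ x, c₀ x * g x)) := by
  have hgs : HasCompactSupport g := HasCompactSupport.intro hK hgK
  obtain ⟨C, hC⟩ := hg.bounded_above_of_compact_support hgs
  simp only [← setIntegral_mul_test (a := c _) hgK, ← setIntegral_mul_test (a := c₀) hgK]
  have h_int : ∀ f : Rn n → ℝ, LocallyIntegrable f → Integrable (fun x => f x * g x) :=
    fun f hf => by
    simpa using hf.integrable_smul_right_of_hasCompactSupport hg hgs
  have hVK : volume K ≠ ∞ := hK.measure_lt_top.ne
  refine tendsto_integral_of_L1 _ (h_int c₀ hc₀).1.restrict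
    (Eventually.of_forall fun j => (h_int _ (hc j)).restrict) ?_
  have h1 : Tendsto (fun j => ENNReal.ofReal C * (eLpNorm (fun x => c j x - c₀ x) p
      (volume.restrict K) * (volume.restrict K) Set.univ ^ (1 / (1 : ℝ≥0∞).toReal - 1 / p.toReal))) l
      (𝓝 0) := by
    have hexp : 0 ≤ 1 / (1 : ℝ≥0∞).toReal - 1 / p.toReal := by
      by_cases hpt : p = ∞
      · simp [hpt]
      · have : 1 ≤ p.toReal := by
          rw [← ENNReal.toReal_one]; exact ENNReal.toReal_mono hpt hp
        simp only [ENNReal.toReal_one, div_one, sub_nonneg]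
        rw [div_le_one (by linarith)]; exact this
    have ht : (volume.restrict K) Set.univ ^ (1 / (1 : ℝ≥0∞).toReal - 1 / p.toReal) ≠ ∞ :=
      ENNReal.rpow_ne_top_of_nonneg hexp (by simpa using hVK)
    have := ENNReal.Tendsto.const_mul (a := ENNReal.ofReal C)
      (ENNReal.Tendsto.mul_const hlim (Or.inr ht)) (Or.inr ENNReal.ofReal_ne_top)
    simpa using this
  refine tendsto_of_tendsto_of_tendsto_of_le_of_le tendsto_const_nhds h1 (fun _ => zero_le)
    fun j => ?_
  have hm : AEStronglyMeasurable (fun x => c j x - c₀ x) (volume.restrict K) :=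
    ((hc j).aestronglyMeasurable.sub hc₀.aestronglyMeasurable).restrict
  calc ∫⁻ x in K, ‖c j x * g x - c₀ x * g x‖ₑ
      = eLpNorm (fun x => (c j x - c₀ x) * g x) 1 (volume.restrict K) := by
        rw [eLpNorm_one_eq_lintegral_enorm]; simp only [sub_mul]
    _ ≤ ENNReal.ofReal C * eLpNorm (fun x => c j x - c₀ x) 1 (volume.restrict K) :=
        eLpNorm_mul_le_of_bound (Eventually.of_forall hC)
    _ ≤ _ := by
        gcongr
        exact eLpNorm_le_eLpNorm_mul_rpow_measure_univ hp hm

/-- Weak derivatives pass to local `L^p` limits of smooth functions. -/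
theorem weakPartial_of_tendsto {p : ℝ≥0∞} (hp : 1 ≤ p) {i : Fin n}
    {c : ℕ → Rn n → ℝ} {c₀ d : Rn n → ℝ} (hc : ∀ j, ContDiff ℝ 1 (c j))
    (hc₀ : LocallyIntegrable c₀) (hd : LocallyIntegrable d)
    (h1 : ∀ K : Set (Rn n), IsCompact K → K ⊆ Ω →
      Tendsto (fun j => eLpNorm (fun x => c j x - c₀ x) p (volume.restrict K)) atTop (𝓝 0))
    (h2 : ∀ K : Set (Rn n), IsCompact K → K ⊆ Ω →
      Tendsto (fun j => eLpNorm (fun x => partialD i (c j) x - d x) p (volume.restrict K)) atTop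
        (𝓝 0)) : WeakPartial Ω i c₀ d := by
  intro φ
  have hφ1 : ContDiff ℝ 1 φ := φ.contDiff.of_le (by norm_num)
  have hout : ∀ x ∉ (Ω : Set (Rn n)), φ x = 0 := fun x hx =>
    testFunction_eq_zero φ fun h => hx (φ.tsupport_subset h)
  have hout' : ∀ x ∉ (Ω : Set (Rn n)), partialD i φ x = 0 := fun x hx =>
    partialD_eq_zero_of_notMem (fun h => hx (φ.tsupport_subset h)) i
  rw [setIntegral_mul_test hout, setIntegral_mul_test hout']
  have hpc : Continuous (partialD i φ) := continuous_partialD φ i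
  have hpcs : HasCompactSupport (partialD i φ) := hasCompactSupport_partialD φ i
  have l1 := tendsto_integral_mul_of_eLpNorm φ.hasCompactSupport hp
    (fun j => (hc j).continuous.locallyIntegrable) hc₀
    (h1 _ φ.hasCompactSupport φ.tsupport_subset) hpc
    (fun x hx => partialD_eq_zero_of_notMem hx i)
  have l2 := tendsto_integral_mul_of_eLpNorm φ.hasCompactSupport hp
    (fun j => (continuous_partialD_of_contDiff (hc j) i).locallyIntegrable) hd
    (h2 _ φ.hasCompactSupport φ.tsupport_subset) φ.continuous
    (fun x hx => testFunction_eq_zero φ hx)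
  refine tendsto_nhds_unique l1 (l2.neg.congr fun j => ?_)
  symm
  refine integral_mul_fderiv_eq_neg_fderiv_mul_of_integrable ?_ ?_ ?_ ?_ ?_
  · exact ((continuous_partialD_of_contDiff (hc j) i).mul φ.continuous).integrable_of_hasCompactSupport
      φ.hasCompactSupport.mul_left
  · exact ((hc j).continuous.mul hpc).integrable_of_hasCompactSupport hpcs.mul_left
  · exact ((hc j).continuous.mul φ.continuous).integrable_of_hasCompactSupport
      φ.hasCompactSupport.mul_left
  · exact fun x _ => (hc j).differentiable one_ne_zero x
  · exact fun x _ => hφ1.differentiable one_ne_zero x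

/-- `a` belongs to `W^{1,n}(Ω)` with weak partial derivatives `b i`; all functions are
`n`-integrable on the whole space. -/
structure SobOn (Ω : TopologicalSpace.Opens (Rn n)) (a : Rn n → ℝ) (b : Fin n → Rn n → ℝ) :
    Prop where
  memLp : MemLp a n volume
  memLp_grad : ∀ i, MemLp (b i) n volume
  weak : ∀ i, WeakPartial Ω i a (b i)

theorem one_le_dim [n.AtLeastTwo] : (1 : ℝ≥0∞) ≤ (n : ℝ≥0∞) := factOneLeDim.out

theorem partialD_mul {f g : Rn n → ℝ} (hf : ContDiff ℝ 1 f) (hg : ContDiff ℝ 1 g) (i : Fin n)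
    (x : Rn n) :
    partialD i (fun y => f y * g y) x = partialD i f x * g x + partialD i g x * f x := by
  have h := (hf.differentiable one_ne_zero x).hasFDerivAt.mul
    (hg.differentiable one_ne_zero x).hasFDerivAt
  have h' : HasFDerivAt (fun y => f y * g y) (f x • fderiv ℝ g x + g x • fderiv ℝ f x) x := h
  rw [partialD, h'.fderiv]
  simp [partialD]
  ring

theorem partialD_comp {H : ℝ → ℝ} (hH : ContDiff ℝ 1 H) {f : Rn n → ℝ} (hf : ContDiff ℝ 1 f)
    (i : Fin n) (x : Rn n) :
    partialD i (fun y => H (f y)) x = partialD i f x * deriv H (f x) := by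
  have h : HasFDerivAt (fun y => H (f y)) (deriv H (f x) • fderiv ℝ f x) x :=
    (hH.differentiable one_ne_zero (f x)).hasDerivAt.comp_hasFDerivAt x
      (hf.differentiable one_ne_zero x).hasFDerivAt
  rw [partialD, h.fderiv]
  simp [partialD, mul_comm]

theorem partialD_sub {f g : Rn n → ℝ} (hf : ContDiff ℝ 1 f) (hg : ContDiff ℝ 1 g) (i : Fin n)
    (x : Rn n) :
    partialD i (fun y => f y - g y) x = partialD i f x - partialD i g x := by
  have h := (hf.differentiable one_ne_zero x).hasFDerivAt.sub
    (hg.differentiable one_ne_zero x).hasFDerivAt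
  have h' : HasFDerivAt (fun y => f y - g y) (fderiv ℝ f x - fderiv ℝ g x) x := h
  rw [partialD, h'.fderiv]
  simp [partialD]

theorem memLp_mul_of_bound {f g : Rn n → ℝ} {C : ℝ} (hf : MemLp f n volume)
    (hg : AEStronglyMeasurable g volume) (hC : ∀ᵐ x, |g x| ≤ C) :
    MemLp (fun x => f x * g x) n volume := by
  refine hf.of_le_mul (c := C) (hf.1.mul hg) ?_
  filter_upwards [hC] with x hx
  rw [norm_mul, mul_comm]
  exact mul_le_mul_of_nonneg_right hx (norm_nonneg _)

namespace SobOn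

variable [n.AtLeastTwo] {a a' : Rn n → ℝ} {b b' : Fin n → Rn n → ℝ}

theorem locallyIntegrable (h : SobOn Ω a b) : LocallyIntegrable a :=
  h.memLp.locallyIntegrable one_le_dim

theorem contDiff_moll (h : SobOn Ω a b) (j : ℕ) : ContDiff ℝ 1 (moll j a) :=
  (_root_.contDiff_moll j h.locallyIntegrable).of_le (by norm_num)

theorem tendsto_moll (h : SobOn Ω a b) (K : Set (Rn n)) :
    Tendsto (fun j => eLpNorm (fun x => moll j a x - a x) n (volume.restrict K)) atTop (𝓝 0) :=
  tendsto_of_tendsto_of_tendsto_of_le_of_le tendsto_const_nhds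
    (tendsto_eLpNorm_moll_sub h.memLp one_le_dim (by simp)) (fun _ => zero_le)
    fun _ => eLpNorm_mono_measure _ Measure.restrict_le_self

theorem tendsto_partialD (h : SobOn Ω a b) (i : Fin n) {K : Set (Rn n)} (hK : IsCompact K)
    (hKΩ : K ⊆ Ω) :
    Tendsto (fun j => eLpNorm (fun x => partialD i (moll j a) x - b i x) n (volume.restrict K))
      atTop (𝓝 0) :=
  (h.weak i).tendsto_partialD_moll one_le_dim (by simp) h.locallyIntegrable (h.memLp_grad i) hK hKΩ

theorem aestronglyMeasurable_partialD (h : SobOn Ω a b) (i : Fin n) (j : ℕ) (μ : Measure (Rn n)) :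
    AEStronglyMeasurable (partialD i (moll j a)) μ :=
  (continuous_partialD_of_contDiff (h.contDiff_moll j) i).aestronglyMeasurable

theorem tendsto_moll_mul {C : ℝ} (h : SobOn Ω a b) (h' : SobOn Ω a' b')
    (hC' : ∀ᵐ x, |a' x| ≤ C) (K : Set (Rn n)) :
    Tendsto (fun j => eLpNorm (fun x => moll j a x * moll j a' x - a x * a' x) n
      (volume.restrict K)) atTop (𝓝 0) :=
  tendsto_eLpNorm_mul_sub one_le_dim (by simp) (h.memLp.restrict K)
    (fun j => (h.contDiff_moll j).continuous.aestronglyMeasurable) (h.tendsto_moll K)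
    (fun j => (h'.contDiff_moll j).continuous.aestronglyMeasurable) h'.memLp.1.restrict
    (fun j => Eventually.of_forall fun x => abs_moll_le j hC' x) (ae_restrict_of_ae hC')
    (ae_restrict_of_ae (ae_tendsto_moll h'.locallyIntegrable))

theorem tendsto_partialD_moll_mul {C : ℝ} (h : SobOn Ω a b) (h' : SobOn Ω a' b')
    (hC : ∀ᵐ x, |a x| ≤ C) (hC' : ∀ᵐ x, |a' x| ≤ C) (i : Fin n) {K : Set (Rn n)} (hK : IsCompact K)
    (hKΩ : K ⊆ Ω) :
    Tendsto (fun j => eLpNorm (fun x => partialD i (fun y => moll j a y * moll j a' y) x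
      - (b i x * a' x + b' i x * a x)) n (volume.restrict K)) atTop (𝓝 0) := by
  have h1 := tendsto_eLpNorm_mul_sub one_le_dim (by simp) ((h.memLp_grad i).restrict K)
    (fun j => h.aestronglyMeasurable_partialD i j (volume.restrict K)) (h.tendsto_partialD i hK hKΩ)
    (fun j => (h'.contDiff_moll j).continuous.aestronglyMeasurable) h'.memLp.1.restrict
    (fun j => Eventually.of_forall fun x => abs_moll_le j hC' x) (ae_restrict_of_ae hC')
    (ae_restrict_of_ae (ae_tendsto_moll h'.locallyIntegrable))
  have h2 := tendsto_eLpNorm_mul_sub one_le_dim (by simp) ((h'.memLp_grad i).restrict K)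
    (fun j => h'.aestronglyMeasurable_partialD i j (volume.restrict K))
    (h'.tendsto_partialD i hK hKΩ)
    (fun j => (h.contDiff_moll j).continuous.aestronglyMeasurable) h.memLp.1.restrict
    (fun j => Eventually.of_forall fun x => abs_moll_le j hC x) (ae_restrict_of_ae hC)
    (ae_restrict_of_ae (ae_tendsto_moll h.locallyIntegrable))
  have h3 := h1.add h2
  rw [zero_add] at h3
  refine tendsto_of_tendsto_of_tendsto_of_le_of_le tendsto_const_nhds h3 (fun _ => zero_le)
    fun j => ?_
  refine le_trans (le_of_eq (congrArg (fun f => eLpNorm f n (volume.restrict K)) ?_))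
    (eLpNorm_add_le ?_ ?_ one_le_dim)
  · ext x
    rw [partialD_mul (h.contDiff_moll j) (h'.contDiff_moll j)]
    simp only [Pi.add_apply]; ring
  · exact ((h.aestronglyMeasurable_partialD i j _).mul
      (h'.contDiff_moll j).continuous.aestronglyMeasurable).sub
      ((h.memLp_grad i).1.mul h'.memLp.1).restrict
  · exact ((h'.aestronglyMeasurable_partialD i j _).mul
      (h.contDiff_moll j).continuous.aestronglyMeasurable).sub
      ((h'.memLp_grad i).1.mul h.memLp.1).restrict

/-- Product rule for bounded Sobolev functions. -/
theorem mul {C : ℝ} (h : SobOn Ω a b) (h' : SobOn Ω a' b') (hC : ∀ᵐ x, |a x| ≤ C)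
    (hC' : ∀ᵐ x, |a' x| ≤ C) :
    SobOn Ω (fun x => a x * a' x) (fun i x => b i x * a' x + b' i x * a x) where
  memLp := memLp_mul_of_bound h.memLp h'.memLp.1 hC'
  memLp_grad i := (memLp_mul_of_bound (h.memLp_grad i) h'.memLp.1 hC').add
    (memLp_mul_of_bound (h'.memLp_grad i) h.memLp.1 hC)
  weak i := weakPartial_of_tendsto (one_le_dim (n := n))
    (fun j => (h.contDiff_moll j).mul (h'.contDiff_moll j))
    ((memLp_mul_of_bound h.memLp h'.memLp.1 hC').locallyIntegrable one_le_dim)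
    (((memLp_mul_of_bound (h.memLp_grad i) h'.memLp.1 hC').add
      (memLp_mul_of_bound (h'.memLp_grad i) h.memLp.1 hC)).locallyIntegrable one_le_dim)
    (fun K _ _ => h.tendsto_moll_mul h' hC' K)
    (fun _ hK hKΩ => h.tendsto_partialD_moll_mul h' hC hC' i hK hKΩ)

/-- Chain rule for a `C¹` function with bounded derivative. -/
theorem comp (h : SobOn Ω a b) {H : ℝ → ℝ} (hH : ContDiff ℝ 1 H) (hH0 : H 0 = 0) {L : ℝ≥0}
    (hL : ∀ t, |deriv H t| ≤ L) :
    SobOn Ω (fun x => H (a x)) (fun i x => b i x * deriv H (a x)) := by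
  have hlip : LipschitzWith L H := lipschitzWith_of_nnnorm_deriv_le
    (hH.differentiable one_ne_zero) fun t => by exact_mod_cast hL t
  have hdc : Continuous (deriv H) := hH.continuous_deriv (by simp)
  have hm : MemLp (fun x => H (a x)) n volume := by
    refine h.memLp.of_le_mul (c := L) (hH.continuous.comp_aestronglyMeasurable h.memLp.1)
      (Eventually.of_forall fun x => ?_)
    simpa [hH0] using hlip.dist_le_mul (a x) 0
  have hmg : ∀ i, MemLp (fun x => b i x * deriv H (a x)) n volume := fun i =>
    memLp_mul_of_bound (h.memLp_grad i) (hdc.comp_aestronglyMeasurable h.memLp.1)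
      (Eventually.of_forall fun x => hL _)
  refine ⟨hm, hmg, fun i => ?_⟩
  refine weakPartial_of_tendsto (one_le_dim (n := n)) (c := fun j x => H (moll j a x))
    (fun j => hH.comp (h.contDiff_moll j)) (hm.locallyIntegrable one_le_dim)
    ((hmg i).locallyIntegrable one_le_dim) (fun K _ _ => ?_) (fun K hK hKΩ => ?_)
  · have h1 : Tendsto (fun j => (L : ℝ≥0∞) * eLpNorm (fun x => moll j a x - a x) n
        (volume.restrict K)) atTop (𝓝 0) := by
      simpa using ENNReal.Tendsto.const_mul (h.tendsto_moll K) (Or.inr ENNReal.coe_ne_top)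
    refine tendsto_of_tendsto_of_tendsto_of_le_of_le tendsto_const_nhds h1 (fun _ => zero_le)
      fun j => ?_
    refine eLpNorm_le_nnreal_smul_eLpNorm_of_ae_le_mul (Eventually.of_forall fun x => ?_) _
    have := hlip.dist_le_mul (moll j a x) (a x)
    rw [dist_eq_norm, dist_eq_norm] at this
    exact_mod_cast this
  · have h1 := tendsto_eLpNorm_mul_sub one_le_dim (by simp) ((h.memLp_grad i).restrict K)
      (fun j => h.aestronglyMeasurable_partialD i j (volume.restrict K))
      (h.tendsto_partialD i hK hKΩ) (g := fun j x => deriv H (moll j a x))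
      (g₀ := fun x => deriv H (a x))
      (fun j => (hdc.comp (h.contDiff_moll j).continuous).aestronglyMeasurable)
      (hdc.comp_aestronglyMeasurable h.memLp.1).restrict
      (fun j => Eventually.of_forall fun x => hL _) (Eventually.of_forall fun x => hL _)
      (ae_restrict_of_ae ((ae_tendsto_moll h.locallyIntegrable).mono fun x hx =>
        (hdc.tendsto _).comp hx))
    refine h1.congr fun j => ?_
    congr 1
    ext x
    rw [partialD_comp hH (h.contDiff_moll j)]

end SobOn

end Weak

end

noncomputable section

/-! ### The conjugate exponent `n / (n - 1)`, Hölder's inequality and cutoffs -/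

section Exponents

/-- The conjugate exponent `n / (n - 1)`. -/
def conjExp (n : ℕ) : ℝ := Real.conjExponent n

theorem holderConjugate_conjExp (n : ℕ) [h : n.AtLeastTwo] :
    Real.HolderConjugate n (conjExp n) :=
  Real.HolderConjugate.conjExponent (by exact_mod_cast h.prop)

instance holderTriple_conjExp (n : ℕ) [n.AtLeastTwo] :
    ENNReal.HolderTriple (ENNReal.ofReal (conjExp n)) (n : ℝ≥0∞) 1 := by
  have h := (holderConjugate_conjExp n).symm.ennrealOfReal
  rwa [ENNReal.ofReal_natCast] at h

instance neZero_dim (n : ℕ) [h : n.AtLeastTwo] : NeZero n :=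
  ⟨by have := h.prop; omega⟩

theorem conjExp_pos (n : ℕ) [n.AtLeastTwo] : 0 < conjExp n := (holderConjugate_conjExp n).symm.pos

variable {X : Type*} [MeasurableSpace X] {μ : Measure X} {n : ℕ} [n.AtLeastTwo]

theorem lintegral_enorm_mul_le_conjExp {g f : X → ℝ} (hg : AEStronglyMeasurable g μ)
    (hf : AEStronglyMeasurable f μ) :
    ∫⁻ x, ‖g x * f x‖ₑ ∂μ ≤ eLpNorm g (ENNReal.ofReal (conjExp n)) μ * eLpNorm f n μ := by
  have := eLpNorm_smul_le_mul_eLpNorm (p := ENNReal.ofReal (conjExp n)) (q := n) (r := 1) hf hg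
  rwa [eLpNorm_one_eq_lintegral_enorm] at this

theorem tendsto_integral_mul_zero {ι : Type*} {l : Filter ι} {g : X → ℝ} {f : ι → X → ℝ}
    (hg : MemLp g (ENNReal.ofReal (conjExp n)) μ) (hf : ∀ k, AEStronglyMeasurable (f k) μ)
    (hlim : Tendsto (fun k => eLpNorm (f k) n μ) l (𝓝 0)) :
    Tendsto (fun k => ∫ x, g x * f k x ∂μ) l (𝓝 0) := by
  rw [tendsto_zero_iff_enorm_tendsto_zero]
  have h1 : Tendsto (fun k => eLpNorm g (ENNReal.ofReal (conjExp n)) μ * eLpNorm (f k) n μ) l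
      (𝓝 0) := by
    simpa using ENNReal.Tendsto.const_mul hlim (Or.inr hg.2.ne)
  refine tendsto_of_tendsto_of_tendsto_of_le_of_le tendsto_const_nhds h1 (fun _ => zero_le)
    fun k => ?_
  exact (enorm_integral_le_lintegral_enorm _).trans (lintegral_enorm_mul_le_conjExp hg.1 (hf k))

end Exponents

section Cutoff

variable {n : ℕ}

theorem exists_testFunction_one {Ω : TopologicalSpace.Opens (Rn n)} {K O : Set (Rn n)}
    (hK : IsCompact K) (hO : IsOpen O) (hKO : K ⊆ O) (hOΩ : O ⊆ Ω) :
    ∃ χ : 𝓓(Ω, ℝ), (∀ x ∈ K, χ x = 1) ∧ (∀ x, 0 ≤ χ x ∧ χ x ≤ 1) ∧ tsupport χ ⊆ O := by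
  obtain ⟨T, hT, hKT, hTO⟩ := exists_compact_between hK hO hKO
  obtain ⟨f, hf1, hf0, hf⟩ := exists_contMDiffMap_one_nhds_of_subset_interior
    (n := (⊤ : ℕ∞)) (modelWithCornersSelf ℝ (Rn n)) hK.isClosed hKT
  have hts : tsupport f ⊆ T := closure_minimal (fun x hx => by
    by_contra h; exact hx (hf0 x h)) hT.isClosed
  refine ⟨⟨f, f.contMDiff.contDiff, HasCompactSupport.intro hT hf0,
    hts.trans (hTO.trans hOΩ)⟩, fun x hx => hf1.self_of_nhdsSet x hx, fun x => hf x,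
    hts.trans hTO⟩

end Cutoff

/-! ### Local Sobolev inequality when the symmetrised gradient is a measure -/

section SymGrad

variable {n : ℕ} {Ω : TopologicalSpace.Opens (Rn n)}

/-- The distributional symmetrised gradient of `u` in `Ω` has the entries `P i j - N i j`, which are
differences of finite measures. -/
structure SymGradData (Ω : TopologicalSpace.Opens (Rn n)) (u : Rn n → Rn n)
    (P N : Fin n → Fin n → Measure (Rn n)) : Prop where
  measurable : StronglyMeasurable u
  integrable : Integrable u (volOn Ω)
  finite_pos : ∀ i j, IsFiniteMeasure (P i j)
  finite_neg : ∀ i j, IsFiniteMeasure (N i j)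
  eq : ∀ (φ : 𝓓(Ω, ℝ)) (i j : Fin n), ∫ x, φ x ∂(P i j) - ∫ x, φ x ∂(N i j)
    = -∫ x, (u x i * partialD j φ x + u x j * partialD i φ x) / 2 ∂(volOn Ω)

/-- The sum of all the measures `P i j` and `N i j`. -/
def totalMeas (P N : Fin n → Fin n → Measure (Rn n)) : Measure (Rn n) :=
  ∑ i, ∑ j, (P i j + N i j)

theorem lintegral_totalMeas (P N : Fin n → Fin n → Measure (Rn n)) (f : Rn n → ℝ≥0∞) :
    ∫⁻ x, f x ∂(totalMeas P N) = ∑ i, ∑ j, (∫⁻ x, f x ∂(P i j) + ∫⁻ x, f x ∂(N i j)) := by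
  simp [totalMeas, lintegral_finsetSum_measure, lintegral_add_measure]

theorem pos_le_totalMeas (P N : Fin n → Fin n → Measure (Rn n)) (i j : Fin n) :
    P i j ≤ totalMeas P N := by
  refine Measure.le_iff.2 fun s hs => ?_
  simp only [totalMeas, Measure.finsetSum_apply, Measure.add_apply]
  refine le_trans le_self_add ((Finset.single_le_sum (f := fun j => P i j s + N i j s)
    (fun _ _ => zero_le) (Finset.mem_univ j)).trans ?_)
  exact Finset.single_le_sum (f := fun i => ∑ j, (P i j s + N i j s))
    (fun _ _ => zero_le) (Finset.mem_univ i)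

theorem neg_le_totalMeas (P N : Fin n → Fin n → Measure (Rn n)) (i j : Fin n) :
    N i j ≤ totalMeas P N := by
  refine Measure.le_iff.2 fun s hs => ?_
  simp only [totalMeas, Measure.finsetSum_apply, Measure.add_apply]
  refine le_trans le_add_self ((Finset.single_le_sum (f := fun j => P i j s + N i j s)
    (fun _ _ => zero_le) (Finset.mem_univ j)).trans ?_)
  exact Finset.single_le_sum (f := fun i => ∑ j, (P i j s + N i j s))
    (fun _ _ => zero_le) (Finset.mem_univ i)

/-- The lower order term `∑ i k, ∫ |∂ₖ ψ| |uᵢ|` in the Sobolev inequality. -/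
def gradTerm (u : Rn n → Rn n) (ψ : Rn n → ℝ) : ℝ≥0∞ :=
  ∑ i, ∑ k, ∫⁻ x, ‖partialD k ψ x‖ₑ * ‖u x i‖ₑ

theorem lintegral_lintegral_mollKer (j : ℕ) (ν : Measure (Rn n)) [SFinite ν] {g : Rn n → ℝ≥0∞}
    (hg : Measurable g) :
    ∫⁻ x, ∫⁻ y, ‖mollKer (n := n) j (x - y)‖ₑ * g y ∂ν = ∫⁻ y, g y ∂ν := by
  rw [lintegral_lintegral_swap]
  · refine lintegral_congr fun y => ?_
    rw [lintegral_mul_const'' (f := fun x => ‖mollKer (n := n) j (x - y)‖ₑ) _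
      ((contDiff_mollKer j).continuous.comp
        (continuous_id.sub continuous_const)).measurable.enorm.aemeasurable]
    rw [lintegral_sub_right_eq_self (fun x => ‖mollKer (n := n) j x‖ₑ) y, lintegral_mollKer,
      one_mul]
  · refine AEMeasurable.mul ?_ (hg.comp measurable_snd).aemeasurable
    exact ((contDiff_mollKer j).continuous.comp
      (continuous_fst.sub continuous_snd)).measurable.enorm.aemeasurable

theorem contDiff_one_test (ψ : 𝓓(Ω, ℝ)) : ContDiff ℝ 1 ψ := ψ.contDiff.of_le (by norm_num)

namespace SymGradData

variable {u : Rn n → Rn n} {P N : Fin n → Fin n → Measure (Rn n)}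

theorem measurable_apply (h : SymGradData Ω u P N) (i : Fin n) : Measurable fun x => u x i :=
  ((EuclideanSpace.proj i : Rn n →L[ℝ] ℝ).continuous.comp_stronglyMeasurable
    h.measurable).measurable

theorem integrable_apply (h : SymGradData Ω u P N) (i : Fin n) :
    Integrable (fun x => u x i) (volOn Ω) :=
  (EuclideanSpace.proj i : Rn n →L[ℝ] ℝ).integrable_comp h.integrable

theorem integrable_mul (h : SymGradData Ω u P N) (i : Fin n) {f : Rn n → ℝ} (hf : Continuous f)
    (hfs : HasCompactSupport f) (hfΩ : ∀ x ∉ (Ω : Set (Rn n)), f x = 0) :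
    Integrable fun x => f x * u x i := by
  obtain ⟨C, hC⟩ := hf.bounded_above_of_compact_support hfs
  have h1 : IntegrableOn (fun x => f x * u x i) Ω :=
    (h.integrable_apply i).bdd_mul (c := C) hf.aestronglyMeasurable.restrict
      (Eventually.of_forall hC)
  rw [← integrableOn_univ]
  exact h1.of_forall_sdiff_eq_zero MeasurableSet.univ fun x hx => by simp [hfΩ x hx.2]

/-- This is `E(ψ u) = ψ Eu + ∇ψ ⊙ u`, mollified. The defining identity of `Eu` is tested with `y ↦ ψ
y * mollKer j (x - y)`; the derivative of the kernel gives the left-hand side, the derivative of `ψ`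
the lower order terms. -/
theorem symPart_moll (h : SymGradData Ω u P N) (ψ : 𝓓(Ω, ℝ)) (j : ℕ) (i k : Fin n) (x : Rn n) :
    symPart (fun i => moll j fun y => ψ y * u y i) i k x
      = (∫ y, ψ y * mollKer j (x - y) ∂(P i k) - ∫ y, ψ y * mollKer j (x - y) ∂(N i k))
        + ((∫ y, mollKer j (x - y) * (partialD k ψ y * u y i))
          + (∫ y, mollKer j (x - y) * (partialD i ψ y * u y k))) / 2 := by
  have hout : ∀ x ∉ (Ω : Set (Rn n)), ψ x = 0 := fun x hx =>
    testFunction_eq_zero ψ fun h => hx (ψ.tsupport_subset h)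
  have hli : ∀ i, LocallyIntegrable fun y => ψ y * u y i := fun i =>
    (h.integrable_mul i ψ.continuous ψ.hasCompactSupport hout).locallyIntegrable
  have hker : ContDiff ℝ (⊤ : ℕ∞) fun y => mollKer (n := n) j (x - y) :=
    (contDiff_mollKer j).comp (contDiff_const.sub contDiff_id)
  have hpk : ∀ (i : Fin n) (y : Rn n), partialD i (fun y => mollKer (n := n) j (x - y)) y
      = -partialD i (mollKer j) (x - y) := by
    intro i y
    have h1 : HasFDerivAt (fun y => mollKer (n := n) j (x - y))
        ((fderiv ℝ (mollKer j) (x - y)).comp (-ContinuousLinearMap.id ℝ (Rn n))) y :=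
      (((contDiff_mollKer j).differentiable (by simp)) _).hasFDerivAt.comp y
        ((hasFDerivAt_id y).const_sub x)
    rw [partialD, h1.fderiv]
    simp [partialD]
  set φ : 𝓓(Ω, ℝ) := ⟨fun y => ψ y * mollKer j (x - y), ψ.contDiff.mul hker,
    ψ.hasCompactSupport.mul_right, (tsupport_mul_subset_left).trans ψ.tsupport_subset⟩ with hφ
  have hφa : ∀ y, φ y = ψ y * mollKer j (x - y) := fun y => rfl
  have hpφ : ∀ (i : Fin n) (y : Rn n), partialD i φ y
      = partialD i ψ y * mollKer j (x - y) - partialD i (mollKer j) (x - y) * ψ y := by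
    intro i y
    have := partialD_mul (contDiff_one_test ψ) (hker.of_le (by norm_num)) i y
    rw [hpk] at this
    refine Eq.trans this ?_
    ring
  have he := h.eq φ i k
  simp only [hφa] at he
  rw [he]
  have houtφ : ∀ (i : Fin n), ∀ x ∉ (Ω : Set (Rn n)), partialD i φ x = 0 := fun i x hx =>
    partialD_eq_zero_of_notMem (fun h => hx (φ.tsupport_subset h)) i
  have houtψ : ∀ (i : Fin n), ∀ x ∉ (Ω : Set (Rn n)), partialD i ψ x = 0 := fun i x hx =>
    partialD_eq_zero_of_notMem (fun h => hx (ψ.tsupport_subset h)) i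
  rw [setIntegral_eq_integral_of_forall_compl_eq_zero (fun y hy => by
    rw [houtφ k y hy, houtφ i y hy]; simp)]
  rw [symPart, partialD_moll j (hli i), partialD_moll j (hli k), integral_div, integral_add]
  rotate_left
  · simpa only [mul_comm] using h.integrable_mul i (continuous_partialD φ k)
      (hasCompactSupport_partialD φ k) (houtφ k)
  · simpa only [mul_comm] using h.integrable_mul k (continuous_partialD φ i)
      (hasCompactSupport_partialD φ i) (houtφ i)
  have hsplit : ∀ i k : Fin n, ∫ y, partialD k (mollKer j) (x - y) * (ψ y * u y i)
      = (∫ y, mollKer j (x - y) * (partialD k ψ y * u y i)) - ∫ y, u y i * partialD k φ y := by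
    intro i k
    rw [← integral_sub]
    · refine integral_congr_ae (Eventually.of_forall fun y => ?_)
      simp only [hpφ]; ring
    · have := h.integrable_mul i (f := fun y => mollKer j (x - y) * partialD k ψ y)
        (hker.continuous.mul (continuous_partialD ψ k)) (hasCompactSupport_partialD ψ k).mul_left
        (fun y hy => by rw [houtψ k y hy, mul_zero])
      simpa only [mul_assoc] using this
    · simpa only [mul_comm] using h.integrable_mul i (continuous_partialD φ k)
        (hasCompactSupport_partialD φ k) (houtφ k)
  rw [hsplit i k, hsplit k i]
  ring

/-- By Tonelli a kernel of mass one preserves the mass of each measure. The two halves of `∇ψ ⊙ u`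
have the same sum over all entries, whence `2 * gradTerm u ψ`; the factor one half is dropped. -/
theorem lintegral_symPartNorm_moll_le (h : SymGradData Ω u P N) (ψ : 𝓓(Ω, ℝ)) (j : ℕ) :
    ∫⁻ x, symPartNorm (fun i => moll j fun y => ψ y * u y i) x
      ≤ ∫⁻ x, ‖ψ x‖ₑ ∂(totalMeas P N) + 2 * gradTerm u ψ := by
  have hfp := h.finite_pos
  have hfn := h.finite_neg
  have hum := h.measurable_apply
  have hψm : Measurable fun y => ‖ψ y‖ₑ := ψ.continuous.measurable.enorm
  have hgm : ∀ i k : Fin n, Measurable fun y => ‖partialD k ψ y‖ₑ * ‖u y i‖ₑ := fun i k =>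
    (continuous_partialD ψ k).measurable.enorm.mul (hum i).enorm
  set A : Fin n → Fin n → Rn n → ℝ≥0∞ := fun i k x =>
    (∫⁻ y, ‖mollKer (n := n) j (x - y)‖ₑ * ‖ψ y‖ₑ ∂(P i k)
      + ∫⁻ y, ‖mollKer (n := n) j (x - y)‖ₑ * ‖ψ y‖ₑ ∂(N i k))
    + ((∫⁻ y, ‖mollKer (n := n) j (x - y)‖ₑ * (‖partialD k ψ y‖ₑ * ‖u y i‖ₑ))
      + ∫⁻ y, ‖mollKer (n := n) j (x - y)‖ₑ * (‖partialD i ψ y‖ₑ * ‖u y k‖ₑ)) with hA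
  have hpt : ∀ x i k, ‖symPart (fun i => moll j fun y => ψ y * u y i) i k x‖ₑ ≤ A i k x := by
    intro x i k
    rw [h.symPart_moll ψ j i k x]
    refine (enorm_add_le _ _).trans (add_le_add (enorm_sub_le.trans (add_le_add ?_ ?_)) ?_)
    · refine (enorm_integral_le_lintegral_enorm _).trans (le_of_eq ?_)
      simp only [enorm_mul, mul_comm]
    · refine (enorm_integral_le_lintegral_enorm _).trans (le_of_eq ?_)
      simp only [enorm_mul, mul_comm]
    · refine le_trans ?_ ((enorm_add_le _ _).trans (add_le_add
        ((enorm_integral_le_lintegral_enorm (μ := volume) (fun y => mollKer j (x - y) *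
          (partialD k ψ y * u y i))).trans (le_of_eq ?_))
        ((enorm_integral_le_lintegral_enorm (μ := volume) (fun y => mollKer j (x - y) *
          (partialD i ψ y * u y k))).trans (le_of_eq ?_))))
      · rw [← ofReal_norm, ← ofReal_norm]
        refine ENNReal.ofReal_le_ofReal ?_
        rw [norm_div, Real.norm_ofNat]
        exact half_le_self (norm_nonneg _)
      · simp only [enorm_mul]
      · simp only [enorm_mul]
  have hker : ∀ (ν : Measure (Rn n)) [SFinite ν] (g : Rn n → ℝ≥0∞), Measurable g →
      Measurable fun x => ∫⁻ y, ‖mollKer (n := n) j (x - y)‖ₑ * g y ∂ν := by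
    intro ν _ g hg
    refine Measurable.lintegral_prod_right' (f := fun z : Rn n × Rn n =>
      ‖mollKer (n := n) j (z.1 - z.2)‖ₑ * g z.2) ?_
    exact ((contDiff_mollKer j).continuous.comp
      (continuous_fst.sub continuous_snd)).measurable.enorm.mul (hg.comp measurable_snd)
  have hmA : ∀ i k, Measurable (A i k) := fun i k =>
    ((hker _ _ hψm).add (hker _ _ hψm)).add ((hker _ _ (hgm i k)).add (hker _ _ (hgm k i)))
  have hintA : ∀ i k, ∫⁻ x, A i k x = (∫⁻ x, ‖ψ x‖ₑ ∂(P i k) + ∫⁻ x, ‖ψ x‖ₑ ∂(N i k))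
      + ((∫⁻ x, ‖partialD k ψ x‖ₑ * ‖u x i‖ₑ) + ∫⁻ x, ‖partialD i ψ x‖ₑ * ‖u x k‖ₑ) := by
    intro i k
    have h4 : ∀ f₁ f₂ f₃ f₄ : Rn n → ℝ≥0∞, Measurable f₁ → Measurable f₂ → Measurable f₃ →
        ∫⁻ x, (f₁ x + f₂ x) + (f₃ x + f₄ x)
          = ((∫⁻ x, f₁ x) + ∫⁻ x, f₂ x) + ((∫⁻ x, f₃ x) + ∫⁻ x, f₄ x) := by
      intro f₁ f₂ f₃ f₄ h₁ h₂ h₃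
      have h₁₂ : Measurable fun x => f₁ x + f₂ x := h₁.add h₂
      rw [lintegral_add_left h₁₂, lintegral_add_left h₁, lintegral_add_left h₃]
    refine (h4 _ _ _ _ (hker (P i k) _ hψm) (hker (N i k) _ hψm)
      (hker volume _ (hgm i k))).trans ?_
    rw [lintegral_lintegral_mollKer j _ hψm,
      lintegral_lintegral_mollKer j _ hψm, lintegral_lintegral_mollKer j _ (hgm i k),
      lintegral_lintegral_mollKer j _ (hgm k i)]
  calc ∫⁻ x, symPartNorm (fun i => moll j fun y => ψ y * u y i) x
      ≤ ∫⁻ x, ∑ i, ∑ k, A i k x := by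
        refine lintegral_mono fun x => ?_
        exact Finset.sum_le_sum fun i _ => Finset.sum_le_sum fun k _ => hpt x i k
    _ = ∑ i, ∑ k, ∫⁻ x, A i k x := by
        rw [lintegral_finsetSum _ fun i _ => Finset.measurable_sum _ fun k _ => hmA i k]
        refine Finset.sum_congr rfl fun i _ => ?_
        rw [lintegral_finsetSum _ fun k _ => hmA i k]
    _ = _ := by
        simp only [hintA, Finset.sum_add_distrib]
        rw [lintegral_totalMeas]
        simp only [Finset.sum_add_distrib, gradTerm]
        rw [Finset.sum_comm (f := fun i k => ∫⁻ x, ‖partialD i ψ x‖ₑ * ‖u x k‖ₑ), two_mul]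

/-- Sobolev inequality for fields whose symmetrised gradient is a measure, localised by a test
function. -/
theorem exists_sobolev (n : ℕ) [n.AtLeastTwo] :
    ∃ C : ℝ≥0, ∀ (Ω : TopologicalSpace.Opens (Rn n)) (u : Rn n → Rn n)
      (P N : Fin n → Fin n → Measure (Rn n)), SymGradData Ω u P N → ∀ ψ : 𝓓(Ω, ℝ),
      ∫⁻ x, ‖(fun i => ψ x * u x i : Fin n → ℝ)‖ₑ ^ conjExp n
        ≤ C * (∫⁻ x, ‖ψ x‖ₑ ∂(totalMeas P N) + 2 * gradTerm u ψ) ^ conjExp n := by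
  obtain ⟨C, hC⟩ := lintegral_rpow_le_symPartNorm (holderConjugate_conjExp n)
  refine ⟨C, fun Ω u P N h ψ => ?_⟩
  have hout : ∀ x ∉ (Ω : Set (Rn n)), ψ x = 0 := fun x hx =>
    testFunction_eq_zero ψ fun h => hx (ψ.tsupport_subset h)
  have hli : ∀ i, LocallyIntegrable fun y => ψ y * u y i := fun i =>
    (h.integrable_mul i ψ.continuous ψ.hasCompactSupport hout).locallyIntegrable
  have hcs : ∀ i, HasCompactSupport fun y => ψ y * u y i := fun i => ψ.hasCompactSupport.mul_right
  have hsm : ∀ j i, ContDiff ℝ 1 (moll j fun y => ψ y * u y i) := fun j i =>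
    (contDiff_moll j (hli i)).of_le (by norm_num)
  have hbd : ∀ j, ∫⁻ x, ‖(fun i => moll j (fun y => ψ y * u y i) x : Fin n → ℝ)‖ₑ ^ conjExp n
      ≤ C * (∫⁻ x, ‖ψ x‖ₑ ∂(totalMeas P N) + 2 * gradTerm u ψ) ^ conjExp n := by
    intro j
    refine (hC (fun i => moll j fun y => ψ y * u y i) (hsm j)
      (fun i => hasCompactSupport_moll j (hcs i))).trans ?_
    gcongr
    · exact (conjExp_pos n).le
    · exact h.lintegral_symPartNorm_moll_le ψ j
  have hae : ∀ᵐ x, Tendsto (fun j => ‖(fun i => moll j (fun y => ψ y * u y i) x : Fin n → ℝ)‖ₑ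
      ^ conjExp n) atTop (𝓝 (‖(fun i => ψ x * u x i : Fin n → ℝ)‖ₑ ^ conjExp n)) := by
    have : ∀ᵐ x, ∀ i, Tendsto (fun j => moll j (fun y => ψ y * u y i) x) atTop
        (𝓝 (ψ x * u x i)) := ae_all_iff.2 fun i => ae_tendsto_moll (hli i)
    filter_upwards [this] with x hx
    exact (ENNReal.continuous_rpow_const.tendsto _).comp (tendsto_pi_nhds.2 hx).enorm
  -- The bound for the mollified fields does not depend on `j` and passes to `ψ u` by Fatou's lemma.
  calc ∫⁻ x, ‖(fun i => ψ x * u x i : Fin n → ℝ)‖ₑ ^ conjExp n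
      = ∫⁻ x, liminf (fun j => ‖(fun i => moll j (fun y => ψ y * u y i) x : Fin n → ℝ)‖ₑ
      ^ conjExp n) atTop := lintegral_congr_ae (hae.mono fun x hx => hx.liminf_eq.symm)
    _ ≤ liminf (fun j => ∫⁻ x, ‖(fun i => moll j (fun y => ψ y * u y i) x : Fin n → ℝ)‖ₑ
      ^ conjExp n) atTop := by
        refine lintegral_liminf_le fun j => ?_
        have : Continuous fun x => (fun i => moll j (fun y => ψ y * u y i) x : Fin n → ℝ) :=
          continuous_pi fun i => (hsm j i).continuous
        exact this.measurable.enorm.pow_const _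
    _ ≤ _ := by
        refine (liminf_le_liminf (Eventually.of_forall hbd)).trans ?_
        simp

end SymGradData

end SymGrad

end

noncomputable section

theorem memLp_restrict_of_isCompact {n : ℕ} {f : Rn n → ℝ} (hf : Continuous f) {K : Set (Rn n)}
    (hK : IsCompact K) (p : ℝ≥0∞) : MemLp f p (volume.restrict K) := by
  have : IsFiniteMeasure (volume.restrict K) :=
    ⟨by rw [Measure.restrict_apply_univ]; exact hK.measure_lt_top⟩
  obtain ⟨C, hC⟩ := hK.exists_bound_of_continuousOn hf.continuousOn
  exact MemLp.of_bound hf.aestronglyMeasurable C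
    ((ae_restrict_iff' hK.measurableSet).2 (Eventually.of_forall hC))

/-! ### Separating mutually singular measures by cutoffs -/

section Singular

variable {n : ℕ} {Ω : TopologicalSpace.Opens (Rn n)}

/-- By regularity, `P` restricted to `K` is carried up to mass `δ` by a compact set `K'` that is
null for `N`, and `K'` has an open neighbourhood of `N`-mass below `δ`. A cutoff `χ` between the two
makes the hypothesis on the difference one on `P` alone, up to an error `2 C δ`. The sign and the
uniform bound of `w k` control this error for all `k` at once. -/
theorem tendsto_integral_of_mutuallySingular {P N : Measure (Rn n)} [IsFiniteMeasure P]
    [IsFiniteMeasure N] (hPN : P ⟂ₘ N) {ι : Type*} {l : Filter ι} {w : ι → Rn n → ℝ} {C : ℝ}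
    (hw : ∀ k, Continuous (w k)) (hw0 : ∀ k x, 0 ≤ w k x) (hwC : ∀ k x, w k x ≤ C)
    {K : Set (Rn n)} (hK : IsCompact K) (hKΩ : K ⊆ Ω) (hwK : ∀ k, ∀ x ∉ K, w k x = 0)
    (hlim : ∀ χ : 𝓓(Ω, ℝ), Tendsto (fun k => ∫ x, χ x * w k x ∂P - ∫ x, χ x * w k x ∂N) l (𝓝 0)) :
    Tendsto (fun k => ∫ x, w k x ∂P) l (𝓝 0) := by
  rcases isEmpty_or_nonempty ι with hι | ⟨⟨k₀⟩⟩
  · simp [filter_eq_bot_of_isEmpty l]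
  have hC : 0 ≤ C := (hw0 k₀ 0).trans (hwC k₀ 0)
  obtain ⟨s, hs, hPs, hNs⟩ := hPN
  rw [Metric.tendsto_nhds]
  intro ε hε
  -- One error `C δ` comes from the part of `P` missed by `K'`, the other from `N` on the
  -- neighbourhood `O`.
  obtain ⟨δ, hδ, hδε⟩ : ∃ δ : ℝ, 0 < δ ∧ C * δ + C * δ < ε / 2 := by
    refine ⟨ε / (4 * C + 4), by positivity, ?_⟩
    rw [← mul_add, ← two_mul, ← mul_assoc, mul_div_assoc',
      div_lt_div_iff₀ (by positivity) (by norm_num)]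
    nlinarith
  set A := sᶜ ∩ K with hA
  have hAm : MeasurableSet A := hs.compl.inter hK.measurableSet
  have hNA : N A = 0 := measure_mono_null Set.inter_subset_left hNs
  obtain ⟨K', hK'A, hK', hPK'⟩ := hAm.exists_isCompact_sdiff_lt (μ := P) (measure_ne_top P A)
    (ENNReal.ofReal_pos.2 hδ).ne'
  obtain ⟨O, hK'O, hO, hNO⟩ := K'.exists_isOpen_lt_of_lt (μ := N) (ENNReal.ofReal δ) (by
    rw [measure_mono_null hK'A hNA]; exact ENNReal.ofReal_pos.2 hδ)
  obtain ⟨χ, hχ1, hχ01, hχO⟩ := exists_testFunction_one (Ω := Ω) hK' (hO.inter Ω.isOpen)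
    (Set.subset_inter hK'O (hK'A.trans (Set.inter_subset_right.trans hKΩ))) Set.inter_subset_right
  have h_int : ∀ (μ : Measure (Rn n)) [IsFiniteMeasure μ] k, Integrable (w k) μ := fun μ _ k =>
    Integrable.of_bound (hw k).aestronglyMeasurable C (Eventually.of_forall fun x => by
      rw [Real.norm_of_nonneg (hw0 k x)]; exact hwC k x)
  have h_intχ : ∀ (μ : Measure (Rn n)) [IsFiniteMeasure μ] k, Integrable (fun x => χ x * w k x) μ :=
    fun μ _ k => Integrable.of_bound (χ.continuous.mul (hw k)).aestronglyMeasurable C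
      (Eventually.of_forall fun x => by
        rw [Real.norm_of_nonneg (mul_nonneg (hχ01 x).1 (hw0 k x))]
        exact (mul_le_of_le_one_left (hw0 k x) (hχ01 x).2).trans (hwC k x))
  have hreal : ∀ (μ : Measure (Rn n)) [IsFiniteMeasure μ] (B : Set (Rn n)),
      μ B < ENNReal.ofReal δ → μ.real B ≤ δ := fun μ _ B hB =>
    ENNReal.toReal_le_of_le_ofReal hδ.le hB.le
  have key : ∀ k, ∫ x, w k x ∂P ≤ (∫ x, χ x * w k x ∂P - ∫ x, χ x * w k x ∂N)
      + (C * δ + C * δ) := by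
    intro k
    have h1 : ∫ x, w k x ∂P ≤ ∫ x, χ x * w k x ∂P + C * δ := by
      have hind : Integrable ((A \ K').indicator fun _ => C) P :=
        (integrable_const C).indicator (hAm.diff hK'.measurableSet)
      calc ∫ x, w k x ∂P ≤ ∫ x, (χ x * w k x + (A \ K').indicator (fun _ => C) x) ∂P := by
            refine integral_mono_ae (h_int P k) ((h_intχ P k).add hind) ?_
            have : ∀ᵐ x ∂P, x ∉ s := measure_eq_zero_iff_ae_notMem.1 hPs
            filter_upwards [this] with x hx
            by_cases hxK : x ∈ K
            · by_cases hxK' : x ∈ K'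
              · simp [hχ1 x hxK', hxK']
              · rw [Set.indicator_of_mem (show x ∈ A \ K' from ⟨⟨hx, hxK⟩, hxK'⟩)]
                have := mul_nonneg (hχ01 x).1 (hw0 k x)
                have := hwC k x
                linarith
            · rw [hwK k x hxK, mul_zero, zero_add]
              exact Set.indicator_nonneg (fun _ _ => hC) x
        _ = ∫ x, χ x * w k x ∂P + C * P.real (A \ K') := by
            rw [integral_add (h_intχ P k) hind,
              integral_indicator_const _ (hAm.diff hK'.measurableSet), smul_eq_mul, mul_comm C]
        _ ≤ _ := by
            gcongr
            exact hreal P _ hPK'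
    have h2 : ∫ x, χ x * w k x ∂N ≤ C * δ := by
      have hind : Integrable (O.indicator fun _ => C) N :=
        (integrable_const C).indicator hO.measurableSet
      calc ∫ x, χ x * w k x ∂N ≤ ∫ x, O.indicator (fun _ => C) x ∂N := by
            refine integral_mono (h_intχ N k) hind fun x => ?_
            by_cases hx : x ∈ O
            · rw [Set.indicator_of_mem hx]
              exact (mul_le_of_le_one_left (hw0 k x) (hχ01 x).2).trans (hwC k x)
            · rw [Set.indicator_of_notMem hx,
                testFunction_eq_zero χ fun h => hx (hχO h).1, zero_mul]
        _ = C * N.real O := by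
            rw [integral_indicator_const _ hO.measurableSet, smul_eq_mul, mul_comm C]
        _ ≤ _ := by
            gcongr
            exact hreal N _ hNO
    linarith
  filter_upwards [(Metric.tendsto_nhds.1 (hlim χ)) (ε / 2) (half_pos hε)] with k hk
  rw [Real.dist_eq, sub_zero] at hk ⊢
  rw [abs_of_nonneg (integral_nonneg (hw0 k))]
  have := key k
  have := le_abs_self (∫ x, χ x * w k x ∂P - ∫ x, χ x * w k x ∂N)
  linarith

end Singular

/-! ### Pairing with Sobolev functions, and negligibility of small energies for `|Eu|` -/

namespace SymGradData

variable {n : ℕ} {Ω : TopologicalSpace.Opens (Rn n)} {u : Rn n → Rn n}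
  {P N : Fin n → Fin n → Measure (Rn n)}

theorem gradTerm_lt_top (h : SymGradData Ω u P N) (ψ : 𝓓(Ω, ℝ)) : gradTerm u ψ < ∞ := by
  refine ENNReal.sum_lt_top.2 fun i _ => ENNReal.sum_lt_top.2 fun k _ => ?_
  have h1 := (h.integrable_mul i (continuous_partialD ψ k) (hasCompactSupport_partialD ψ k)
    fun x hx => partialD_eq_zero_of_notMem (fun h => hx (ψ.tsupport_subset h)) k).2
  rw [hasFiniteIntegral_iff_enorm] at h1
  simpa only [enorm_mul] using h1

theorem memLp [n.AtLeastTwo] (h : SymGradData Ω u P N) {K : Set (Rn n)} (hK : IsCompact K)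
    (hKΩ : K ⊆ Ω) (i : Fin n) :
    MemLp (fun x => u x i) (ENNReal.ofReal (conjExp n)) (volume.restrict K) := by
  have hq := conjExp_pos n
  have hfp := h.finite_pos
  have hfn := h.finite_neg
  obtain ⟨C, hC⟩ := exists_sobolev n
  obtain ⟨ψ, hψ1, hψ01, -⟩ := exists_testFunction_one hK Ω.isOpen hKΩ subset_rfl
  refine ⟨(h.measurable_apply i).aestronglyMeasurable, ?_⟩
  rw [eLpNorm_lt_top_iff_lintegral_rpow_enorm_lt_top (ENNReal.ofReal_pos.2 hq).ne'
    ENNReal.ofReal_ne_top, ENNReal.toReal_ofReal hq.le]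
  calc ∫⁻ x in K, ‖u x i‖ₑ ^ conjExp n
      ≤ ∫⁻ x in K, ‖(fun i => ψ x * u x i : Fin n → ℝ)‖ₑ ^ conjExp n := by
        refine setLIntegral_mono' hK.measurableSet fun x hx => ?_
        refine ENNReal.rpow_le_rpow ?_ hq.le
        have : ‖ψ x * u x i‖ₑ ≤ ‖(fun i => ψ x * u x i : Fin n → ℝ)‖ₑ := by
          rw [← ofReal_norm, ← ofReal_norm]
          exact ENNReal.ofReal_le_ofReal (norm_le_pi_norm (fun i => ψ x * u x i) i)
        simpa [hψ1 x hx] using this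
    _ ≤ ∫⁻ x, ‖(fun i => ψ x * u x i : Fin n → ℝ)‖ₑ ^ conjExp n := setLIntegral_le_lintegral _ _
    _ ≤ _ := hC Ω u P N h ψ
    _ < ∞ := by
        refine ENNReal.mul_lt_top ENNReal.coe_lt_top (ENNReal.rpow_lt_top_of_nonneg hq.le ?_)
        refine (ENNReal.add_lt_top.2 ⟨?_, ENNReal.mul_lt_top (by simp) (h.gradTerm_lt_top ψ)⟩).ne
        have h1 : ∀ (μ : Measure (Rn n)) [IsFiniteMeasure μ], ∫⁻ x, ‖ψ x‖ₑ ∂μ < ∞ := fun μ _ =>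
          (ψ.continuous.integrable_of_hasCompactSupport ψ.hasCompactSupport).2
        rw [lintegral_totalMeas]
        exact ENNReal.sum_lt_top.2 fun i _ => ENNReal.sum_lt_top.2 fun k _ =>
          ENNReal.add_lt_top.2 ⟨h1 _, h1 _⟩

/-- Exchanges the roles of the two parts, so that a statement about `P i j` also gives the one about
`N i j`. -/
theorem symm (h : SymGradData Ω u P N) : SymGradData Ω (-u) N P where
  measurable := h.measurable.neg
  integrable := h.integrable.neg
  finite_pos := h.finite_neg
  finite_neg := h.finite_pos
  eq := fun φ i j => by
    have := h.eq φ i j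
    have h2 : ∫ x, ((-u) x i * partialD j φ x + (-u) x j * partialD i φ x) / 2 ∂(volOn Ω)
      = -∫ x, (u x i * partialD j φ x + u x j * partialD i φ x) / 2 ∂(volOn Ω) := by
      rw [← integral_neg]
      refine integral_congr_ae (Eventually.of_forall fun x => ?_)
      simp only [Pi.neg_apply, PiLp.neg_apply]; ring
    rw [h2, ← this]; ring

/-- The `i`-th partial derivative of `χ a`, where `b` is the gradient of `a`. -/
def mulDeriv (χ a : Rn n → ℝ) (b : Fin n → Rn n → ℝ) (i : Fin n) (x : Rn n) : ℝ :=
  partialD i χ x * a x + χ x * b i x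

/-- The pairing of the distributional symmetrised gradient of `u` with `χ a`. -/
def productTerm (u : Rn n → Rn n) (χ a : Rn n → ℝ) (b : Fin n → Rn n → ℝ) (i j : Fin n) : ℝ :=
  -((∫ x in tsupport χ, u x i * mulDeriv χ a b j x) + ∫ x in tsupport χ, u x j * mulDeriv χ a b i x)
    / 2

theorem integral_test_mul (h : SymGradData Ω u P N) {z : Rn n → ℝ} (hz : ContDiff ℝ (⊤ : ℕ∞) z)
    (χ : 𝓓(Ω, ℝ)) (i j : Fin n) :
    ∫ x, χ x * z x ∂(P i j) - ∫ x, χ x * z x ∂(N i j)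
      = productTerm u χ z (fun i => partialD i z) i j := by
  set φ : 𝓓(Ω, ℝ) := ⟨fun y => χ y * z y, χ.contDiff.mul hz,
    χ.hasCompactSupport.mul_right, (tsupport_mul_subset_left).trans χ.tsupport_subset⟩ with hφ
  have hpφ : ∀ (i : Fin n) (y : Rn n), partialD i φ y
      = mulDeriv χ z (fun i => partialD i z) i y := by
    intro i y
    refine (partialD_mul (contDiff_one_test χ) (hz.of_le (by norm_num)) i y).trans ?_
    rw [mulDeriv]; ring
  have houtφ : ∀ (i : Fin n), ∀ x ∉ (Ω : Set (Rn n)), partialD i φ x = 0 := fun i x hx =>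
    partialD_eq_zero_of_notMem (fun h => hx (φ.tsupport_subset h)) i
  have houtχ : ∀ (i : Fin n), ∀ x ∉ tsupport χ, partialD i φ x = 0 := fun i x hx =>
    partialD_eq_zero_of_notMem (fun h => hx (tsupport_mul_subset_left h)) i
  refine (h.eq φ i j).trans ?_
  rw [setIntegral_eq_integral_of_forall_compl_eq_zero (fun y hy => by
    rw [houtφ j y hy, houtφ i y hy]; simp), integral_div, integral_add]
  rotate_left
  · simpa only [mul_comm] using h.integrable_mul i (continuous_partialD φ j)
      (hasCompactSupport_partialD φ j) (houtφ j)
  · simpa only [mul_comm] using h.integrable_mul j (continuous_partialD φ i)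
      (hasCompactSupport_partialD φ i) (houtφ i)
  rw [productTerm, neg_div]
  congr 3
  · rw [setIntegral_eq_integral_of_forall_compl_eq_zero (fun y hy => by
      rw [← hpφ, houtχ j y hy, mul_zero])]
    simp only [hpφ]
  · rw [setIntegral_eq_integral_of_forall_compl_eq_zero (fun y hy => by
      rw [← hpφ, houtχ i y hy, mul_zero])]
    simp only [hpφ]

theorem tendsto_mulDeriv [n.AtLeastTwo] {ι : Type*} {l : Filter ι} {z : ι → Rn n → ℝ}
    (hz : ∀ k, ContDiff ℝ (⊤ : ℕ∞) (z k)) {a : Rn n → ℝ} {b : Fin n → Rn n → ℝ} (χ : 𝓓(Ω, ℝ))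
    (ha : MemLp a n (volume.restrict (tsupport χ)))
    (hb : ∀ i, MemLp (b i) n (volume.restrict (tsupport χ)))
    (h0 : Tendsto (fun k => eLpNorm (z k - a) n (volume.restrict (tsupport χ))) l (𝓝 0))
    (h1 : ∀ i, Tendsto (fun k => eLpNorm (partialD i (z k) - b i) n
      (volume.restrict (tsupport χ))) l (𝓝 0)) (i : Fin n) :
    Tendsto (fun k => eLpNorm (mulDeriv χ (z k) (fun i => partialD i (z k)) i - mulDeriv χ a b i) n
      (volume.restrict (tsupport χ))) l (𝓝 0) := by
  obtain ⟨C, hC⟩ := χ.continuous.bounded_above_of_compact_support χ.hasCompactSupport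
  obtain ⟨D, hD⟩ := (continuous_partialD χ i).bounded_above_of_compact_support
    (hasCompactSupport_partialD χ i)
  have hsum : Tendsto (fun k => ENNReal.ofReal D * eLpNorm (z k - a) n
      (volume.restrict (tsupport χ)) + ENNReal.ofReal C * eLpNorm (partialD i (z k) - b i) n
      (volume.restrict (tsupport χ))) l (𝓝 0) := by
    simpa using (ENNReal.Tendsto.const_mul h0 (Or.inr ENNReal.ofReal_ne_top)).add
      (ENNReal.Tendsto.const_mul (h1 i) (Or.inr ENNReal.ofReal_ne_top))
  refine tendsto_of_tendsto_of_tendsto_of_le_of_le tendsto_const_nhds hsum (fun _ => zero_le)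
    fun k => ?_
  have heq : mulDeriv χ (z k) (fun i => partialD i (z k)) i - mulDeriv χ a b i
      = (fun x => (z k - a) x * partialD i χ x) + fun x => (partialD i (z k) - b i) x * χ x := by
    funext x; simp only [mulDeriv, Pi.sub_apply, Pi.add_apply]; ring
  have hm1 : AEStronglyMeasurable (z k - a) (volume.restrict (tsupport χ)) :=
    (hz k).continuous.aestronglyMeasurable.sub ha.1
  have hm2 : AEStronglyMeasurable (partialD i (z k) - b i) (volume.restrict (tsupport χ)) :=
    (continuous_partialD_of_contDiff ((hz k).of_le (by norm_num)) i).aestronglyMeasurable.sub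
      (hb i).1
  simp only [heq]
  refine (eLpNorm_add_le (hm1.mul (continuous_partialD χ i).aestronglyMeasurable)
    (hm2.mul χ.continuous.aestronglyMeasurable) one_le_dim).trans (add_le_add ?_ ?_)
  · exact eLpNorm_mul_le_of_bound (Eventually.of_forall hD)
  · exact eLpNorm_mul_le_of_bound (Eventually.of_forall hC)

theorem memLp_mulDeriv {a : Rn n → ℝ} {b : Fin n → Rn n → ℝ} (χ : 𝓓(Ω, ℝ))
    (ha : MemLp a n (volume.restrict (tsupport χ)))
    (hb : ∀ i, MemLp (b i) n (volume.restrict (tsupport χ))) (i : Fin n) :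
    MemLp (mulDeriv χ a b i) n (volume.restrict (tsupport χ)) := by
  obtain ⟨C, hC⟩ := χ.continuous.bounded_above_of_compact_support χ.hasCompactSupport
  obtain ⟨D, hD⟩ := (continuous_partialD χ i).bounded_above_of_compact_support
    (hasCompactSupport_partialD χ i)
  refine MemLp.add (f := fun x => partialD i χ x * a x) (g := fun x => χ x * b i x) ?_ ?_
  · exact ha.of_le_mul (c := D) ((continuous_partialD χ i).aestronglyMeasurable.mul ha.1)
      (Eventually.of_forall fun x => by rw [norm_mul]; gcongr; exact hD x)
  · exact (hb i).of_le_mul (c := C) (χ.continuous.aestronglyMeasurable.mul (hb i).1)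
      (Eventually.of_forall fun x => by rw [norm_mul]; gcongr; exact hC x)

/-- On the support of `χ` the field `u` is in `L^{n/(n-1)}`, so the pairing, written by parts, is
continuous for `L^n` convergence of `z k` and of its derivatives there. -/
theorem tendsto_integral_test_mul [n.AtLeastTwo] (h : SymGradData Ω u P N) {ι : Type*}
    {l : Filter ι} {z : ι → Rn n → ℝ}
    (hz : ∀ k, ContDiff ℝ (⊤ : ℕ∞) (z k)) {a : Rn n → ℝ} {b : Fin n → Rn n → ℝ} (χ : 𝓓(Ω, ℝ))
    (ha : MemLp a n (volume.restrict (tsupport χ)))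
    (hb : ∀ i, MemLp (b i) n (volume.restrict (tsupport χ)))
    (h0 : Tendsto (fun k => eLpNorm (z k - a) n (volume.restrict (tsupport χ))) l (𝓝 0))
    (h1 : ∀ i, Tendsto (fun k => eLpNorm (partialD i (z k) - b i) n
      (volume.restrict (tsupport χ))) l (𝓝 0)) (i j : Fin n) :
    Tendsto (fun k => ∫ x, χ x * z k x ∂(P i j) - ∫ x, χ x * z k x ∂(N i j)) l
      (𝓝 (productTerm u χ a b i j)) := by
  simp only [fun k => h.integral_test_mul (hz k) χ i j]
  have hKc : IsCompact (tsupport χ) := χ.hasCompactSupport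
  have hm := memLp_mulDeriv χ ha hb
  have hzm : ∀ k i, MemLp (mulDeriv χ (z k) (fun i => partialD i (z k)) i) n
      (volume.restrict (tsupport χ)) := fun k i =>
    memLp_mulDeriv χ (memLp_restrict_of_isCompact (hz k).continuous hKc _)
      (fun i => memLp_restrict_of_isCompact
        (continuous_partialD_of_contDiff ((hz k).of_le (by norm_num)) i) hKc _) i
  have hstep : ∀ i j, Tendsto (fun k => ∫ x in tsupport χ, u x i *
      mulDeriv χ (z k) (fun i => partialD i (z k)) j x) l
      (𝓝 (∫ x in tsupport χ, u x i * mulDeriv χ a b j x)) := by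
    intro i j
    have hu := h.memLp hKc χ.tsupport_subset i
    rw [← tendsto_sub_nhds_zero_iff]
    have := tendsto_integral_mul_zero hu (fun k => ((hzm k j).sub (hm j)).1)
      (tendsto_mulDeriv hz χ ha hb h0 h1 j)
    refine this.congr fun k => ?_
    rw [← integral_sub]
    · refine integral_congr_ae (Eventually.of_forall fun x => ?_)
      simp only [Pi.sub_apply]; ring
    · exact (MemLp.integrable_mul hu (hzm k j))
    · exact (MemLp.integrable_mul hu (hm j))
  exact (((hstep i j).add (hstep j i)).neg).div_const 2

theorem productTerm_zero (u : Rn n → Rn n) (χ : Rn n → ℝ) (i j : Fin n) :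
    productTerm u χ 0 0 i j = 0 := by
  simp [productTerm, mulDeriv]

/-- Squares stay smooth and are nonnegative, and `∇(z²) = 2 z ∇z` is small in `L^n` since `z` is
bounded. So the difference of the integrals against `P i j` and `N i j` vanishes for every cutoff,
and mutual singularity removes `N i j`. -/
theorem tendsto_lintegral_sq_pos [n.AtLeastTwo] (h : SymGradData Ω u P N) {i j : Fin n}
    (hPN : P i j ⟂ₘ N i j) {ι : Type*} {l : Filter ι} {z : ι → Rn n → ℝ}
    (hz : ∀ k, ContDiff ℝ (⊤ : ℕ∞) (z k)) {C : ℝ} (hC : ∀ k x, |z k x| ≤ C)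
    (h0 : ∀ K, IsCompact K → K ⊆ Ω → Tendsto (fun k => eLpNorm (z k) n (volume.restrict K)) l (𝓝 0))
    (h1 : ∀ K, IsCompact K → K ⊆ Ω → ∀ i,
      Tendsto (fun k => eLpNorm (partialD i (z k)) n (volume.restrict K)) l (𝓝 0))
    {K : Set (Rn n)} (hK : IsCompact K) (hKΩ : K ⊆ Ω) :
    Tendsto (fun k => ∫⁻ x in K, ‖z k x‖ₑ ^ 2 ∂(P i j)) l (𝓝 0) := by
  have hfp := h.finite_pos i j
  have hfn := h.finite_neg i j
  obtain ⟨ψ, hψ1, hψ01, -⟩ := exists_testFunction_one hK Ω.isOpen hKΩ subset_rfl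
  have hz2 : ∀ k, ContDiff ℝ (⊤ : ℕ∞) fun x => z k x * z k x := fun k => (hz k).mul (hz k)
  have hC2 : ∀ k x, z k x * z k x ≤ C * C := fun k x =>
    (abs_mul_abs_self (z k x)).symm.le.trans
      (mul_self_le_mul_self (abs_nonneg _) (hC k x))
  have hlim : Tendsto (fun k => ∫ x, ψ x * (z k x * z k x) ∂(P i j)) l (𝓝 0) := by
    refine tendsto_integral_of_mutuallySingular (Ω := Ω) hPN (C := C * C)
      (K := tsupport ψ) (fun k => ψ.continuous.mul (hz2 k).continuous)
      (fun k x => mul_nonneg (hψ01 x).1 (mul_self_nonneg _))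
      (fun k x => (mul_le_of_le_one_left (mul_self_nonneg _) (hψ01 x).2).trans (hC2 k x))
      ψ.hasCompactSupport ψ.tsupport_subset
      (fun k x hx => by rw [testFunction_eq_zero ψ hx, zero_mul]) fun χ => ?_
    -- The function to be integrated is `ψ z²`, with `ψ = 1` on `K` to give compact support; against
    -- a cutoff `χ` the test function is `χ ψ`.
    set φ : 𝓓(Ω, ℝ) := ⟨fun y => χ y * ψ y, χ.contDiff.mul ψ.contDiff,
      χ.hasCompactSupport.mul_right, (tsupport_mul_subset_left).trans χ.tsupport_subset⟩ with hφ
    have hφc : IsCompact (tsupport φ) := φ.hasCompactSupport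
    have e1 : ∀ f : Rn n → ℝ, eLpNorm (f - 0) n (volume.restrict (tsupport φ))
      = eLpNorm f n (volume.restrict (tsupport φ)) := fun f => by rw [sub_zero]
    have := h.tendsto_integral_test_mul (a := 0) (b := 0) (l := l) hz2 φ (MemLp.zero' ..)
      (fun i => MemLp.zero' ..) ?_ ?_ i j
    · rw [productTerm_zero] at this
      refine this.congr fun k => ?_
      simp only [← mul_assoc]; rfl
    · refine tendsto_of_tendsto_of_tendsto_of_le_of_le tendsto_const_nhds
        (g := fun _ => 0) (h := fun k => ENNReal.ofReal C * eLpNorm (z k) n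
          (volume.restrict (tsupport φ))) ?_ (fun _ => zero_le) fun k => ?_
      · simpa using ENNReal.Tendsto.const_mul (h0 _ hφc φ.tsupport_subset)
          (Or.inr ENNReal.ofReal_ne_top)
      · simp only [e1]
        exact eLpNorm_mul_le_of_bound (Eventually.of_forall (hC k))
    · intro i
      refine tendsto_of_tendsto_of_tendsto_of_le_of_le tendsto_const_nhds
        (g := fun _ => 0) (h := fun k => ENNReal.ofReal (2 * C) * eLpNorm (partialD i (z k)) n
          (volume.restrict (tsupport φ))) ?_ (fun _ => zero_le) fun k => ?_
      · have := ENNReal.Tendsto.const_mul (h1 _ hφc φ.tsupport_subset i)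
          (Or.inr (ENNReal.ofReal_ne_top (r := 2 * C)))
        rwa [mul_zero] at this
      · simp only [Pi.zero_apply, e1]
        have : partialD i (fun x => z k x * z k x) = fun x => partialD i (z k) x * (2 * z k x) := by
          funext x
          have hz1 : ContDiff ℝ 1 (z k) := (hz k).of_le (by norm_num)
          rw [partialD_mul hz1 hz1]; ring
        rw [this]
        refine eLpNorm_mul_le_of_bound (Eventually.of_forall fun x => ?_)
        rw [abs_mul, abs_two]
        exact mul_le_mul_of_nonneg_left (hC k x) zero_le_two
  have h3 := ENNReal.tendsto_ofReal hlim
  rw [ENNReal.ofReal_zero] at h3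
  refine tendsto_of_tendsto_of_tendsto_of_le_of_le tendsto_const_nhds h3 (fun _ => zero_le)
    fun k => ?_
  have hnn : ∀ x, 0 ≤ ψ x * (z k x * z k x) := fun x => mul_nonneg (hψ01 x).1 (mul_self_nonneg _)
  have h_int : Integrable (fun x => ψ x * (z k x * z k x)) (P i j) := Integrable.of_bound
    (ψ.continuous.mul (hz2 k).continuous).aestronglyMeasurable (C * C)
    (Eventually.of_forall fun x => by
      rw [Real.norm_of_nonneg (hnn x)]
      exact (mul_le_of_le_one_left (mul_self_nonneg _) (hψ01 x).2).trans (hC2 k x))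
  simp only
  rw [ofReal_integral_eq_lintegral_ofReal h_int (Eventually.of_forall hnn)]
  refine le_trans (setLIntegral_mono' hK.measurableSet fun x hx => ?_)
    (setLIntegral_le_lintegral _ _)
  rw [hψ1 x hx, one_mul, pow_two, ← enorm_mul, Real.enorm_of_nonneg (mul_self_nonneg _)]

theorem tendsto_lintegral_sq [n.AtLeastTwo] (h : SymGradData Ω u P N)
    (hPN : ∀ i j, P i j ⟂ₘ N i j) {ι : Type*} {l : Filter ι} {z : ι → Rn n → ℝ}
    (hz : ∀ k, ContDiff ℝ (⊤ : ℕ∞) (z k)) {C : ℝ} (hC : ∀ k x, |z k x| ≤ C)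
    (h0 : ∀ K, IsCompact K → K ⊆ Ω → Tendsto (fun k => eLpNorm (z k) n (volume.restrict K)) l (𝓝 0))
    (h1 : ∀ K, IsCompact K → K ⊆ Ω → ∀ i,
      Tendsto (fun k => eLpNorm (partialD i (z k)) n (volume.restrict K)) l (𝓝 0))
    {K : Set (Rn n)} (hK : IsCompact K) (hKΩ : K ⊆ Ω) :
    Tendsto (fun k => ∫⁻ x in K, ‖z k x‖ₑ ^ 2 ∂(totalMeas P N)) l (𝓝 0) := by
  have heq : ∀ k, ∫⁻ x in K, ‖z k x‖ₑ ^ 2 ∂(totalMeas P N)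
      = ∑ i, ∑ j, (∫⁻ x in K, ‖z k x‖ₑ ^ 2 ∂(P i j) + ∫⁻ x in K, ‖z k x‖ₑ ^ 2 ∂(N i j)) := by
    intro k
    simp only [← lintegral_indicator hK.measurableSet]
    exact lintegral_totalMeas P N _
  simp only [heq]
  have h0' : (0 : ℝ≥0∞) = ∑ _i : Fin n, ∑ _j : Fin n, (0 + 0) := by simp
  rw [h0']
  exact tendsto_finsetSum _ fun i _ => tendsto_finsetSum _ fun j _ =>
    (h.tendsto_lintegral_sq_pos (hPN i j) hz hC h0 h1 hK hKΩ).add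
      (h.symm.tendsto_lintegral_sq_pos (hPN i j).symm hz hC h0 h1 hK hKΩ)

end SymGradData

end

noncomputable section

/-! ### Cauchy sequences in `L²` -/

section LpAux

variable {X : Type*} [MeasurableSpace X] {μ : Measure X}

theorem tendsto_eLpNorm_sub_zero {ι : Type*} {l : Filter ι} {p : ℝ≥0∞} (hp : 1 ≤ p)
    {f g : ι → X → ℝ} {a : X → ℝ} (hf : ∀ k, AEStronglyMeasurable (f k) μ)
    (hg : ∀ k, AEStronglyMeasurable (g k) μ) (ha : AEStronglyMeasurable a μ)
    (hfa : Tendsto (fun k => eLpNorm (fun x => f k x - a x) p μ) l (𝓝 0))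
    (hga : Tendsto (fun k => eLpNorm (fun x => g k x - a x) p μ) l (𝓝 0)) :
    Tendsto (fun k => eLpNorm (fun x => f k x - g k x) p μ) l (𝓝 0) := by
  have h := hfa.add hga
  rw [zero_add] at h
  refine tendsto_of_tendsto_of_tendsto_of_le_of_le tendsto_const_nhds h (fun _ => zero_le)
    fun k => ?_
  refine le_trans (le_of_eq (congrArg (fun f => eLpNorm f p μ) ?_))
    (eLpNorm_sub_le ((hf k).sub ha) ((hg k).sub ha) hp)
  funext x; simp

theorem eLpNorm_two_eq (f : X → ℝ) :
    eLpNorm f 2 μ = (∫⁻ x, ‖f x‖ₑ ^ 2 ∂μ) ^ (1 / 2 : ℝ) := by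
  rw [eLpNorm_eq_lintegral_rpow_enorm_toReal (by simp) (by simp)]
  simp

theorem tendsto_eLpNorm_two {ι : Type*} {l : Filter ι} {f : ι → X → ℝ}
    (h : Tendsto (fun k => ∫⁻ x, ‖f k x‖ₑ ^ 2 ∂μ) l (𝓝 0)) :
    Tendsto (fun k => eLpNorm (f k) 2 μ) l (𝓝 0) := by
  simp only [eLpNorm_two_eq]
  have := ((ENNReal.continuous_rpow_const (y := 1 / 2)).tendsto 0).comp h
  simpa [Function.comp_def] using this

theorem exists_tendsto_eLpNorm_of_cauchy {f : ℕ → X → ℝ} (hf : ∀ j, MemLp (f j) 2 μ)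
    (h : Tendsto (fun p : ℕ × ℕ => eLpNorm (fun x => f p.1 x - f p.2 x) 2 μ) (atTop ×ˢ atTop)
      (𝓝 0)) :
    ∃ g, MemLp g 2 μ ∧ Tendsto (fun j => eLpNorm (f j - g) 2 μ) atTop (𝓝 0) := by
  have hc : CauchySeq fun j => (hf j).toLp (f j) := by
    rw [cauchySeq_iff_tendsto_dist_atTop_0, ← prod_atTop_atTop_eq]
    have h2 := (ENNReal.tendsto_toReal ENNReal.zero_ne_top).comp h
    rw [ENNReal.toReal_zero] at h2
    refine h2.congr fun p => ?_
    rw [dist_eq_norm, ← MemLp.toLp_sub, Lp.norm_toLp]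
    rfl
  obtain ⟨g, hg⟩ := cauchySeq_tendsto_of_complete hc
  refine ⟨g, Lp.memLp g, ?_⟩
  rw [Lp.tendsto_Lp_iff_tendsto_eLpNorm'] at hg
  refine hg.congr fun j => eLpNorm_congr_ae ?_
  filter_upwards [(hf j).coeFn_toLp] with x hx
  simp [hx]

end LpAux

/-! ### Quasicontinuous representatives as `L²(|Eu|)` limits of mollifications -/

section Representative

variable {n : ℕ} {Ω : TopologicalSpace.Opens (Rn n)}

/-- `f` is approximately continuous on `Ω` off sets `U k`, with potentials `z k` that vanish in
`W^{1,n}`. -/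
structure HasPotentials (Ω : TopologicalSpace.Opens (Rn n)) (f : Rn n → ℝ) (z : ℕ → Rn n → ℝ)
    (c : ℕ → Fin n → Rn n → ℝ) (U : ℕ → Set (Rn n)) : Prop where
  sob : ∀ k, SobOn Ω (z k) (c k)
  nonneg : ∀ k x, 0 ≤ z k x
  le_one : ∀ k x, z k x ≤ 1
  isOpen : ∀ k, IsOpen (U k)
  eq_one : ∀ k, ∀ᵐ x, x ∈ U k → z k x = 1
  continuousOn : ∀ k, ContinuousOn f ((Ω : Set (Rn n)) \ U k)
  tendsto : Tendsto (fun k => eLpNorm (z k) n volume) atTop (𝓝 0)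
  tendsto_grad : ∀ i, Tendsto (fun k => eLpNorm (c k i) n volume) atTop (𝓝 0)

/-- The expression is the mollification at `x` of `(1 - z) (a - f x)`. If `x ∈ U` then `z = 1` near
`x`. Otherwise, off `U` the function `a` agrees almost everywhere with `f`, which is continuous at
`x` relative to the complement of `U`, while on `U` the factor `1 - z` vanishes. The limit thus
holds at every point of `Ω`, as needed for measures that may charge Lebesgue null sets. -/
theorem tendsto_moll_sub_mul {a z f : Rn n → ℝ} {U : Set (Rn n)} (ha : LocallyIntegrable a)
    (hz : LocallyIntegrable z) (hza : LocallyIntegrable fun x => z x * a x)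
    (hz0 : ∀ x, 0 ≤ z x) (hz1 : ∀ x, z x ≤ 1) (hU : IsOpen U) (hzU : ∀ᵐ x, x ∈ U → z x = 1)
    (hf : ContinuousOn f ((Ω : Set (Rn n)) \ U)) (hfa : ∀ᵐ x, x ∈ Ω → f x = a x) {x : Rn n}
    (hx : x ∈ Ω) :
    Tendsto (fun j => moll j a x - moll j (fun y => z y * a y) x - f x * (1 - moll j z x)) atTop
      (𝓝 0) := by
  have hform : ∀ j, moll j a x - moll j (fun y => z y * a y) x - f x * (1 - moll j z x)
      = ∫ y, mollKer j (x - y) * ((1 - z y) * (a y - f x)) := by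
    intro j
    have i1 := integrable_mollKer_mul j ha x
    have i2 := integrable_mollKer_mul j hza x
    have i3 := integrable_mollKer_mul j hz x
    have i0 : Integrable fun y => mollKer (n := n) j (x - y) := by
      simpa using integrable_mollKer_mul j (f := fun _ => (1 : ℝ)) (locallyIntegrable_const _) x
    have h1 : (1 : ℝ) = ∫ y, mollKer (n := n) j (x - y) := by
      rw [integral_sub_left_eq_self (mollKer j) volume x, integral_mollKer]
    rw [moll_apply, moll_apply, moll_apply, ← integral_sub i1 i2]
    nth_rewrite 1 [h1]
    rw [← integral_sub i0 i3, ← integral_const_mul]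
    refine (integral_sub (i1.sub i2) ((i0.sub i3).const_mul (f x))).symm.trans ?_
    refine integral_congr_ae (Eventually.of_forall fun y => ?_)
    simp only [Pi.sub_apply]
    ring
  rw [Metric.tendsto_nhds]
  intro ε hε
  have hε2 : 0 < ε / 2 := half_pos hε
  obtain ⟨r, hr, hball⟩ : ∃ r > 0, ∀ᵐ y, ‖x - y‖ < r → |(1 - z y) * (a y - f x)| ≤ ε / 2 := by
    by_cases hxU : x ∈ U
    · obtain ⟨r, hr, hrU⟩ := Metric.isOpen_iff.1 hU x hxU
      refine ⟨r, hr, ?_⟩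
      filter_upwards [hzU] with y hy hxy
      rw [hy (hrU (by rwa [Metric.mem_ball, dist_comm, dist_eq_norm]))]
      simpa using hε2.le
    · have hc := hf x ⟨hx, hxU⟩
      rw [Metric.continuousWithinAt_iff] at hc
      obtain ⟨r₁, hr₁, h₁⟩ := hc (ε / 2) hε2
      obtain ⟨r₂, hr₂, h₂⟩ := Metric.isOpen_iff.1 Ω.isOpen x hx
      refine ⟨min r₁ r₂, lt_min hr₁ hr₂, ?_⟩
      filter_upwards [hzU, hfa] with y hy hya hxy
      have hd : dist y x < min r₁ r₂ := by rwa [dist_comm, dist_eq_norm]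
      by_cases hyU : y ∈ U
      · rw [hy hyU]; simpa using hε2.le
      · have hyΩ : y ∈ Ω := h₂ (hd.trans_le (min_le_right _ _))
        have h3 := h₁ ⟨hyΩ, hyU⟩ (hd.trans_le (min_le_left _ _))
        rw [Real.dist_eq, hya hyΩ] at h3
        rw [abs_mul]
        refine (mul_le_of_le_one_left (abs_nonneg _) ?_).trans h3.le
        rw [abs_of_nonneg (by linarith [hz1 y])]
        linarith [hz0 y]
  have hev : ∀ᶠ j : ℕ in atTop, 1 / ((j : ℝ) + 1) < r :=
    (tendsto_order.1 tendsto_one_div_add_atTop_nhds_zero_nat).2 r hr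
  filter_upwards [hev] with j hj
  rw [Real.dist_eq, sub_zero, hform, ← Real.norm_eq_abs]
  refine lt_of_le_of_lt ?_ (half_lt_self hε)
  have h_int : ∫ y, mollKer j (x - y) * (ε / 2) = ε / 2 := by
    rw [integral_mul_const, integral_sub_left_eq_self (mollKer j) volume x, integral_mollKer,
      one_mul]
  refine (norm_integral_le_of_norm_le (g := fun y => mollKer j (x - y) * (ε / 2))
    ?_ ?_).trans h_int.le
  · simpa using integrable_mollKer_mul j (f := fun _ => ε / 2) (locallyIntegrable_const _) x
  · filter_upwards [hball] with y hy
    rw [norm_mul, Real.norm_of_nonneg (mollKer_nonneg j _)]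
    by_cases h : ‖x - y‖ < r
    · exact mul_le_mul_of_nonneg_left (hy h) (mollKer_nonneg j _)
    · rw [mollKer_eq_zero (hj.le.trans (not_lt.1 h))]; simp

namespace SymGradData

variable {u : Rn n → Rn n} {P N : Fin n → Fin n → Measure (Rn n)} {a : Rn n → ℝ}
  {b : Fin n → Rn n → ℝ}

theorem isFiniteMeasure_totalMeas (h : SymGradData Ω u P N) : IsFiniteMeasure (totalMeas P N) := by
  have hfp := h.finite_pos
  have hfn := h.finite_neg
  refine ⟨?_⟩
  simp only [totalMeas, Measure.finsetSum_apply, Measure.add_apply]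
  exact ENNReal.sum_lt_top.2 fun i _ => ENNReal.sum_lt_top.2 fun k _ =>
    ENNReal.add_lt_top.2 ⟨measure_lt_top _ _, measure_lt_top _ _⟩

theorem tendsto_lintegral_moll_sub_moll [n.AtLeastTwo] (h : SymGradData Ω u P N)
    (hPN : ∀ i j, P i j ⟂ₘ N i j)
    (ha : SobOn Ω a b) {C : ℝ} (hC : ∀ᵐ x, |a x| ≤ C) {K : Set (Rn n)} (hK : IsCompact K)
    (hKΩ : K ⊆ Ω) :
    Tendsto (fun p : ℕ × ℕ => ∫⁻ x in K, ‖moll p.1 a x - moll p.2 a x‖ₑ ^ 2 ∂(totalMeas P N))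
      (atTop ×ˢ atTop) (𝓝 0) := by
  refine h.tendsto_lintegral_sq hPN (z := fun p : ℕ × ℕ => fun x => moll p.1 a x - moll p.2 a x)
    (C := C + C) (fun p => (contDiff_moll _ ha.locallyIntegrable).sub
      (contDiff_moll _ ha.locallyIntegrable)) (fun p x => ?_) (fun K hK hKΩ => ?_)
    (fun K hK hKΩ i => ?_) hK hKΩ
  · exact (abs_sub _ _).trans (add_le_add (abs_moll_le _ hC x) (abs_moll_le _ hC x))
  · exact tendsto_eLpNorm_sub_zero one_le_dim
      (fun p => (ha.contDiff_moll p.1).continuous.aestronglyMeasurable)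
      (fun p => (ha.contDiff_moll p.2).continuous.aestronglyMeasurable) ha.memLp.1.restrict
      ((ha.tendsto_moll K).comp tendsto_fst) ((ha.tendsto_moll K).comp tendsto_snd)
  · have := tendsto_eLpNorm_sub_zero one_le_dim
      (fun p : ℕ × ℕ => ha.aestronglyMeasurable_partialD i p.1 (volume.restrict K))
      (fun p => ha.aestronglyMeasurable_partialD i p.2 _) (ha.memLp_grad i).1.restrict
      ((ha.tendsto_partialD i hK hKΩ).comp tendsto_fst)
      ((ha.tendsto_partialD i hK hKΩ).comp tendsto_snd)
    refine this.congr fun p => ?_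
    congr 1
    funext x
    rw [partialD_sub (ha.contDiff_moll _) (ha.contDiff_moll _)]

/-- Both `moll j z * moll j a` and `moll j (z * a)` tend to `z * a` in `W^{1,n}_loc` and are
bounded, so their difference falls under `tendsto_lintegral_sq`. -/
theorem tendsto_lintegral_moll_mul_sub [n.AtLeastTwo] (h : SymGradData Ω u P N)
    (hPN : ∀ i j, P i j ⟂ₘ N i j)
    (ha : SobOn Ω a b) {C : ℝ} (hC : ∀ᵐ x, |a x| ≤ C) {z : Rn n → ℝ} {c : Fin n → Rn n → ℝ}
    (hz : SobOn Ω z c) (hzC : ∀ᵐ x, |z x| ≤ C) {K : Set (Rn n)} (hK : IsCompact K)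
    (hKΩ : K ⊆ Ω) :
    Tendsto (fun j => ∫⁻ x in K, ‖moll j z x * moll j a x - moll j (fun y => z y * a y) x‖ₑ ^ 2
      ∂(totalMeas P N)) atTop (𝓝 0) := by
  have hza := hz.mul ha hzC hC
  have hzaC : ∀ᵐ x, |z x * a x| ≤ C * C := by
    filter_upwards [hC, hzC] with x h1 h2
    rw [abs_mul]
    exact mul_le_mul h2 h1 (abs_nonneg _) ((abs_nonneg _).trans h2)
  refine h.tendsto_lintegral_sq hPN
    (z := fun j x => moll j z x * moll j a x - moll j (fun y => z y * a y) x) (C := C * C + C * C)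
    (fun p => ((contDiff_moll _ hz.locallyIntegrable).mul
      (contDiff_moll _ ha.locallyIntegrable)).sub (contDiff_moll _ hza.locallyIntegrable))
    (fun p x => ?_) (fun K hK hKΩ => ?_) (fun K hK hKΩ i => ?_) hK hKΩ
  · refine (abs_sub _ _).trans (add_le_add ?_ (abs_moll_le _ hzaC x))
    rw [abs_mul]
    exact mul_le_mul (abs_moll_le _ hzC x) (abs_moll_le _ hC x) (abs_nonneg _)
      ((abs_nonneg _).trans (abs_moll_le p hzC x))
  · exact tendsto_eLpNorm_sub_zero one_le_dim
      (fun p => ((hz.contDiff_moll p).mul (ha.contDiff_moll p)).continuous.aestronglyMeasurable)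
      (fun p => (hza.contDiff_moll p).continuous.aestronglyMeasurable) hza.memLp.1.restrict
      (hz.tendsto_moll_mul ha hC K) (hza.tendsto_moll K)
  · have := tendsto_eLpNorm_sub_zero one_le_dim
      (fun p => (continuous_partialD_of_contDiff ((hz.contDiff_moll p).mul (ha.contDiff_moll p))
        i).aestronglyMeasurable) (fun p => hza.aestronglyMeasurable_partialD i p _)
      (hza.memLp_grad i).1.restrict (hz.tendsto_partialD_moll_mul ha hzC hC i hK hKΩ)
      (hza.tendsto_partialD i hK hKΩ)
    refine this.congr fun p => ?_
    congr 1
    funext x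
    rw [partialD_sub ((hz.contDiff_moll p).mul (ha.contDiff_moll p)) (hza.contDiff_moll p)]

/-- The limits are iterated, first in `j` and then in `k`: the gradient of `moll j (z k)` approaches
`c k` on `K` only for `j` large depending on `k`. The curried filter lets `tendsto_lintegral_sq` be
used as it stands. -/
theorem eventually_lintegral_moll_potential [n.AtLeastTwo] (h : SymGradData Ω u P N)
    (hPN : ∀ i j, P i j ⟂ₘ N i j) {f : Rn n → ℝ} {z : ℕ → Rn n → ℝ} {c : ℕ → Fin n → Rn n → ℝ}
    {U : ℕ → Set (Rn n)} (hz : HasPotentials Ω f z c U) {K : Set (Rn n)} (hK : IsCompact K)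
    (hKΩ : K ⊆ Ω) {ε : ℝ≥0∞} (hε : 0 < ε) :
    ∀ᶠ k in atTop, ∀ᶠ j in atTop, ∫⁻ x in K, ‖moll j (z k) x‖ₑ ^ 2 ∂(totalMeas P N) < ε := by
  have hz1 : ∀ k x, |z k x| ≤ 1 := fun k x => by
    rw [abs_of_nonneg (hz.nonneg k x)]; exact hz.le_one k x
  have key := h.tendsto_lintegral_sq hPN (l := (atTop : Filter ℕ).curry (atTop : Filter ℕ))
    (z := fun p : ℕ × ℕ => moll p.2 (z p.1)) (C := 1)
    (fun p => contDiff_moll _ (hz.sob p.1).locallyIntegrable)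
    (fun p x => abs_moll_le _ (Eventually.of_forall (hz1 p.1)) x) (fun K hK hKΩ => ?_)
    (fun K hK hKΩ i => ?_) hK hKΩ
  · exact eventually_curry_iff.1 ((tendsto_order.1 key).2 ε hε)
  · rw [ENNReal.tendsto_nhds_zero]
    intro δ hδ
    rw [eventually_curry_iff]
    filter_upwards [ENNReal.tendsto_nhds_zero.1 hz.tendsto δ hδ] with k hk
    refine Eventually.of_forall fun j => ?_
    exact (eLpNorm_mono_measure _ Measure.restrict_le_self).trans
      ((eLpNorm_moll_le j (hz.sob k).memLp.1 one_le_dim (by simp)).trans hk)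
  · rw [ENNReal.tendsto_nhds_zero]
    intro δ hδ
    rw [eventually_curry_iff]
    have hδ2 : 0 < δ / 2 := ENNReal.half_pos hδ.ne'
    filter_upwards [ENNReal.tendsto_nhds_zero.1 (hz.tendsto_grad i) _ hδ2] with k hk
    filter_upwards [ENNReal.tendsto_nhds_zero.1 ((hz.sob k).tendsto_partialD i hK hKΩ) _ hδ2]
      with j hj
    have hadd : partialD i (moll j (z k))
      = (fun x => partialD i (moll j (z k)) x - c k i x) + c k i := by funext x; simp
    rw [← ENNReal.add_halves δ, hadd]
    refine (eLpNorm_add_le (((hz.sob k).aestronglyMeasurable_partialD i j _).sub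
      ((hz.sob k).memLp_grad i).1.restrict) ((hz.sob k).memLp_grad i).1.restrict one_le_dim).trans
      (add_le_add hj ((eLpNorm_mono_measure _ Measure.restrict_le_self).trans hk))

/-- The mollifications of a bounded Sobolev function converge to its precise representative in
`L²` of the total variation of the symmetrised gradient. -/
theorem tendsto_moll_rep [n.AtLeastTwo] (h : SymGradData Ω u P N) (hPN : ∀ i j, P i j ⟂ₘ N i j)
    (ha : SobOn Ω a b) {C : ℝ} (hC1 : 1 ≤ C) (hC : ∀ᵐ x, |a x| ≤ C) {f : Rn n → ℝ}
    {z : ℕ → Rn n → ℝ} {c : ℕ → Fin n → Rn n → ℝ} {U : ℕ → Set (Rn n)}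
    (hz : HasPotentials Ω f z c U) (hfa : ∀ᵐ x, x ∈ Ω → f x = a x) {K : Set (Rn n)}
    (hK : IsCompact K) (hKΩ : K ⊆ Ω) :
    AEStronglyMeasurable f ((totalMeas P N).restrict K) ∧
      Tendsto (fun j => eLpNorm (moll j a - f) 2 ((totalMeas P N).restrict K)) atTop (𝓝 0) := by
  have hfin := h.isFiniteMeasure_totalMeas
  set ν := (totalMeas P N).restrict K with hν
  have hz1 : ∀ k x, |z k x| ≤ 1 := fun k x => by
    rw [abs_of_nonneg (hz.nonneg k x)]; exact hz.le_one k x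
  have hac : ∀ j, Continuous (moll j a) := fun j => (ha.contDiff_moll j).continuous
  -- The limit `g` exists by completeness; what remains is to identify it with the given
  -- representative `f`.
  obtain ⟨g, hg, hag⟩ := exists_tendsto_eLpNorm_of_cauchy (μ := ν) (f := fun j => moll j a)
    (fun j => MemLp.of_bound (hac j).aestronglyMeasurable C
      (Eventually.of_forall fun x => abs_moll_le j hC x))
    (tendsto_eLpNorm_two (h.tendsto_lintegral_moll_sub_moll hPN ha hC hK hKΩ))
  suffices hgf : ∀ᵐ x ∂ν, g x = f x by
    refine ⟨hg.1.congr hgf, hag.congr fun j => eLpNorm_congr_ae ?_⟩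
    filter_upwards [hgf] with x hx
    simp [hx]
  -- Along a subsequence `(g - f) (1 - moll j (z k))` tends to zero almost everywhere: combine `moll
  -- j a → g`, the near multiplicativity of mollification and `tendsto_moll_sub_mul`. Where `g ≠ f`
  -- this forces `moll j (z k) → 1`.
  have hae : ∀ k, ∃ s : ℕ → ℕ, StrictMono s ∧
      ∀ᵐ x ∂ν, g x ≠ f x → Tendsto (fun j => moll (s j) (z k) x) atTop (𝓝 1) := by
    intro k
    have hzk := hz.sob k
    have hza := hzk.mul ha ((Eventually.of_forall (hz1 k)).mono fun x hx => hx.trans hC1) hC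
    have hw := tendsto_eLpNorm_two (h.tendsto_lintegral_moll_mul_sub hPN ha hC hzk
      ((Eventually.of_forall (hz1 k)).mono fun x hx => hx.trans hC1) hK hKΩ)
    have hm1 := tendstoInMeasure_of_tendsto_eLpNorm (μ := ν) (g := g) two_ne_zero
      (fun j => (hac j).aestronglyMeasurable) hg.1 hag
    obtain ⟨s₁, hs₁, hs₁ae⟩ := hm1.exists_seq_tendsto_ae
    have hm2 := tendstoInMeasure_of_tendsto_eLpNorm (μ := ν) (g := 0) two_ne_zero
      (fun j => (((hzk.contDiff_moll j).mul (ha.contDiff_moll j)).sub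
        (hza.contDiff_moll j)).continuous.aestronglyMeasurable)
      aestronglyMeasurable_zero (hw.congr fun j => by rw [sub_zero])
    obtain ⟨s₂, hs₂, hs₂ae⟩ := (hm2.comp hs₁.tendsto_atTop).exists_seq_tendsto_ae
    refine ⟨s₁ ∘ s₂, hs₁.comp hs₂, ?_⟩
    have hΩ : ∀ᵐ x ∂ν, x ∈ Ω := (ae_restrict_mem hK.measurableSet).mono fun x hx => hKΩ hx
    filter_upwards [hs₁ae, hs₂ae, hΩ] with x h1 h2 hx hne
    have h1' := h1.comp hs₂.tendsto_atTop
    have h3 := (tendsto_moll_sub_mul ha.locallyIntegrable hzk.locallyIntegrable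
      hza.locallyIntegrable (hz.nonneg k) (hz.le_one k) (hz.isOpen k) (hz.eq_one k)
      (hz.continuousOn k) hfa hx).comp (hs₁.comp hs₂).tendsto_atTop
    have h4 : Tendsto (fun j => (moll ((s₁ ∘ s₂) j) a x - g x) * (1 - moll ((s₁ ∘ s₂) j) (z k) x))
        atTop (𝓝 0) := by
      refine Tendsto.zero_mul_isBoundedUnder_le ?_ ?_
      · have := h1'.sub_const (g x)
        rw [sub_self] at this
        exact this
      · refine isBoundedUnder_of ⟨2, fun j => ?_⟩
        have := abs_moll_le ((s₁ ∘ s₂) j) (Eventually.of_forall (hz1 k)) x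
        simp only [Function.comp_apply, Real.norm_eq_abs] at this ⊢
        rw [abs_le] at this ⊢
        constructor <;> linarith [this.1, this.2]
    have h5 : Tendsto (fun j => (g x - f x) * (1 - moll ((s₁ ∘ s₂) j) (z k) x)) atTop (𝓝 0) := by
      have := (h3.sub h2).sub h4
      simp only [Pi.zero_apply, sub_zero] at this
      refine this.congr fun j => ?_
      simp only [Function.comp_apply]
      ring
    have h6 := h5.const_mul (g x - f x)⁻¹
    rw [mul_zero] at h6
    have h7 := h6.const_sub 1
    rw [sub_zero] at h7
    refine h7.congr fun j => ?_
    have hne' : g x - f x ≠ 0 := sub_ne_zero.2 hne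
    rw [inv_mul_cancel_left₀ hne']
    simp
  rw [ae_iff]
  refine le_antisymm (le_of_forall_pos_le_add fun ε hε => ?_) zero_le
  rw [zero_add]
  obtain ⟨k, hk⟩ := (h.eventually_lintegral_moll_potential hPN hz hK hKΩ hε).exists
  obtain ⟨s, hs, hsae⟩ := hae k
  have hmeas : ∀ j, Measurable fun x => ‖moll (s j) (z k) x‖ₑ ^ 2 := fun j =>
    ((hz.sob k).contDiff_moll (s j)).continuous.measurable.enorm.pow_const 2
  -- Chebyshev's inequality for the liminf, then Fatou: the potentials are near one on the set where
  -- `g ≠ f` but have small energy, so this set is null.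
  calc ν {x | ¬g x = f x}
      ≤ ν {x | 1 ≤ liminf (fun j => ‖moll (s j) (z k) x‖ₑ ^ 2) atTop} := by
        refine measure_mono_ae ?_
        filter_upwards [hsae] with x hx hne
        have h1 := (ENNReal.continuous_pow 2).tendsto _ |>.comp (hx hne).enorm
        have h2 := h1.liminf_eq
        simp only [Function.comp_def, enorm_one, one_pow] at h2
        exact h2.ge
    _ ≤ ∫⁻ x, liminf (fun j => ‖moll (s j) (z k) x‖ₑ ^ 2) atTop ∂ν := by
        have := mul_meas_ge_le_lintegral (μ := ν) (.liminf hmeas) 1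
        rwa [one_mul] at this
    _ ≤ liminf (fun j => ∫⁻ x, ‖moll (s j) (z k) x‖ₑ ^ 2 ∂ν) atTop := lintegral_liminf_le hmeas
    _ ≤ ε := by
        refine (liminf_le_liminf (v := fun _ => ε)
          ((hs.tendsto_atTop.eventually hk).mono fun j hj => hj.le)).trans ?_
        simp

theorem ae_abs_rep_le [n.AtLeastTwo] (h : SymGradData Ω u P N) (hPN : ∀ i j, P i j ⟂ₘ N i j)
    (ha : SobOn Ω a b) {C : ℝ} (hC1 : 1 ≤ C) (hC : ∀ᵐ x, |a x| ≤ C) {f : Rn n → ℝ}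
    {z : ℕ → Rn n → ℝ} {c : ℕ → Fin n → Rn n → ℝ} {U : ℕ → Set (Rn n)}
    (hz : HasPotentials Ω f z c U) (hfa : ∀ᵐ x, x ∈ Ω → f x = a x) {K : Set (Rn n)}
    (hK : IsCompact K) (hKΩ : K ⊆ Ω) :
    ∀ᵐ x ∂((totalMeas P N).restrict K), |f x| ≤ C := by
  obtain ⟨hfm, hlim⟩ := h.tendsto_moll_rep hPN ha hC1 hC hz hfa hK hKΩ
  obtain ⟨s, -, hs⟩ := (tendstoInMeasure_of_tendsto_eLpNorm two_ne_zero
    (fun j => (ha.contDiff_moll j).continuous.aestronglyMeasurable) hfm hlim).exists_seq_tendsto_ae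
  filter_upwards [hs] with x hx
  exact le_of_tendsto hx.abs (Eventually.of_forall fun j => abs_moll_le _ hC x)

theorem tendsto_integral_mul_of_eLpNorm_two {μ : Measure (Rn n)} [IsFiniteMeasure μ]
    {g f : Rn n → ℝ} {w : ℕ → Rn n → ℝ} {B C : ℝ} (hg : Continuous g) (hgB : ∀ x, ‖g x‖ ≤ B)
    (hw : ∀ j, Continuous (w j)) (hwC : ∀ j x, |w j x| ≤ C) (hf : AEStronglyMeasurable f μ)
    (hfC : ∀ᵐ x ∂μ, |f x| ≤ C) (hlim : Tendsto (fun j => eLpNorm (w j - f) 2 μ) atTop (𝓝 0)) :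
    Tendsto (fun j => ∫ x, g x * w j x ∂μ) atTop (𝓝 (∫ x, g x * f x ∂μ)) := by
  have hfi : Integrable f μ := Integrable.of_bound hf C hfC
  have hwi : ∀ j, Integrable (w j) μ := fun j =>
    Integrable.of_bound (hw j).aestronglyMeasurable C (Eventually.of_forall (hwC j))
  have hgi : ∀ f, Integrable f μ → Integrable (fun x => g x * f x) μ := fun f hf =>
    hf.bdd_mul (c := B) hg.aestronglyMeasurable (Eventually.of_forall hgB)
  refine tendsto_integral_of_L1' _ (hgi f hfi).1 (Eventually.of_forall fun j => hgi _ (hwi j)) ?_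
  have hfinal : Tendsto (fun j => ENNReal.ofReal B * (eLpNorm (w j - f) 2 μ
      * μ Set.univ ^ (1 / (1 : ℝ≥0∞).toReal - 1 / (2 : ℝ≥0∞).toReal))) atTop (𝓝 0) := by
    have h1 : μ Set.univ ^ (1 / (1 : ℝ≥0∞).toReal - 1 / (2 : ℝ≥0∞).toReal) ≠ ∞ := by
      refine (ENNReal.rpow_lt_top_of_nonneg ?_ (measure_ne_top _ _)).ne
      norm_num
    simpa using ENNReal.Tendsto.const_mul (ENNReal.Tendsto.mul_const hlim (Or.inr h1))
      (Or.inr (ENNReal.ofReal_ne_top (r := B)))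
  refine tendsto_of_tendsto_of_tendsto_of_le_of_le tendsto_const_nhds hfinal (fun _ => zero_le)
    fun j => ?_
  have heq : (fun x => g x * w j x) - (fun x => g x * f x) = fun x => (w j - f) x * g x := by
    funext x; simp only [Pi.sub_apply]; ring
  rw [heq]
  refine (eLpNorm_mul_le_of_bound (Eventually.of_forall hgB)).trans ?_
  gcongr
  exact eLpNorm_le_eLpNorm_mul_rpow_measure_univ (by norm_num)
    ((hw j).aestronglyMeasurable.sub hf)

/-- The symmetrised gradient of `u`, paired with the product of a test function and the precise
representative of a bounded Sobolev function. -/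
theorem integral_test_mul_rep [n.AtLeastTwo] (h : SymGradData Ω u P N) (hPN : ∀ i j, P i j ⟂ₘ N i j)
    (ha : SobOn Ω a b) {C : ℝ} (hC1 : 1 ≤ C) (hC : ∀ᵐ x, |a x| ≤ C) {f : Rn n → ℝ}
    {z : ℕ → Rn n → ℝ} {c : ℕ → Fin n → Rn n → ℝ} {U : ℕ → Set (Rn n)}
    (hz : HasPotentials Ω f z c U) (hfa : ∀ᵐ x, x ∈ Ω → f x = a x) (φ : 𝓓(Ω, ℝ)) (i j : Fin n) :
    ∫ x, φ x * f x ∂(P i j) - ∫ x, φ x * f x ∂(N i j) = productTerm u φ a b i j := by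
  have hfp := h.finite_pos i j
  have hfn := h.finite_neg i j
  have hKc : IsCompact (tsupport φ) := φ.hasCompactSupport
  obtain ⟨hfm, hlim⟩ := h.tendsto_moll_rep hPN ha hC1 hC hz hfa hKc φ.tsupport_subset
  have hfC := h.ae_abs_rep_le hPN ha hC1 hC hz hfa hKc φ.tsupport_subset
  obtain ⟨B, hB⟩ := φ.continuous.bounded_above_of_compact_support φ.hasCompactSupport
  have key : ∀ μ : Measure (Rn n), μ ≤ totalMeas P N → IsFiniteMeasure μ →
      Tendsto (fun k => ∫ x, φ x * moll k a x ∂μ) atTop (𝓝 (∫ x, φ x * f x ∂μ)) := by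
    intro μ hμ _
    have hle : μ.restrict (tsupport φ) ≤ (totalMeas P N).restrict (tsupport φ) :=
      Measure.restrict_mono subset_rfl hμ
    have h1 := tendsto_integral_mul_of_eLpNorm_two (μ := μ.restrict (tsupport φ)) φ.continuous hB
      (fun k => (ha.contDiff_moll k).continuous) (fun k x => abs_moll_le k hC x)
      (hfm.mono_measure hle) (ae_mono hle hfC)
      (tendsto_of_tendsto_of_tendsto_of_le_of_le tendsto_const_nhds hlim (fun _ => zero_le)
        fun k => eLpNorm_mono_measure _ hle)
    have h2 : ∀ g : Rn n → ℝ, ∫ x in tsupport φ, φ x * g x ∂μ = ∫ x, φ x * g x ∂μ := fun g =>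
      setIntegral_eq_integral_of_forall_compl_eq_zero fun x hx => by
        rw [testFunction_eq_zero φ hx, zero_mul]
    simpa only [h2] using h1
  -- The integrals of `φ * moll k a` converge to the representative by the `L²` limit and to
  -- `productTerm` by parts; the two limits agree.
  refine tendsto_nhds_unique ((key _ (pos_le_totalMeas P N i j) hfp).sub
    (key _ (neg_le_totalMeas P N i j) hfn)) ?_
  exact h.tendsto_integral_test_mul (fun k => contDiff_moll k ha.locallyIntegrable) φ
    (ha.memLp.restrict _) (fun i => (ha.memLp_grad i).restrict _) (ha.tendsto_moll _)
    (fun i => ha.tendsto_partialD i hKc φ.tsupport_subset) i j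

theorem exists_compact_exhaustion (hΩ : Bornology.IsBounded (Ω : Set (Rn n))) :
    ∃ F : ℕ → Set (Rn n), (∀ k, IsCompact (F k)) ∧ (∀ k, F k ⊆ Ω) ∧ ⋃ k, F k = Ω := by
  obtain ⟨F, hF, hFΩ, hFU, -⟩ := Ω.isOpen.exists_iUnion_isClosed
  exact ⟨F, fun k => Metric.isCompact_of_isClosed_isBounded (hF k) (hΩ.subset (hFΩ k)), hFΩ, hFU⟩

theorem rep_spec [n.AtLeastTwo] (h : SymGradData Ω u P N)
    (hΩ : Bornology.IsBounded (Ω : Set (Rn n)))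
    (h0 : totalMeas P N (Ω : Set (Rn n))ᶜ = 0) (hPN : ∀ i j, P i j ⟂ₘ N i j)
    (ha : SobOn Ω a b) {C : ℝ} (hC1 : 1 ≤ C) (hC : ∀ᵐ x, |a x| ≤ C) {f : Rn n → ℝ}
    {z : ℕ → Rn n → ℝ} {c : ℕ → Fin n → Rn n → ℝ} {U : ℕ → Set (Rn n)}
    (hz : HasPotentials Ω f z c U) (hfa : ∀ᵐ x, x ∈ Ω → f x = a x) :
    AEStronglyMeasurable f (totalMeas P N) ∧ ∀ᵐ x ∂(totalMeas P N), |f x| ≤ C := by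
  obtain ⟨F, hF, hFΩ, hFU⟩ := exists_compact_exhaustion hΩ
  have hr : (totalMeas P N).restrict (⋃ k, F k) = totalMeas P N := by
    rw [hFU]
    exact Measure.restrict_eq_self_of_ae_mem
      ((measure_eq_zero_iff_ae_notMem.1 h0).mono fun x hx => not_not.1 hx)
  rw [← hr]
  refine ⟨AEStronglyMeasurable.iUnion fun k =>
    (h.tendsto_moll_rep hPN ha hC1 hC hz hfa (hF k) (hFΩ k)).1, ?_⟩
  rw [ae_restrict_iUnion_iff]
  exact fun k => h.ae_abs_rep_le hPN ha hC1 hC hz hfa (hF k) (hFΩ k)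

end SymGradData

end Representative

end

noncomputable section

/-! ### Poincaré's inequality and capacitary potentials -/

section Sobolev

variable {n : ℕ} {Ω : TopologicalSpace.Opens (Rn n)}

theorem WeakPartial.unique {i : Fin n} {a b b' : Rn n → ℝ} (h : WeakPartial Ω i a b)
    (h' : WeakPartial Ω i a b') (hb : LocallyIntegrable b) (hb' : LocallyIntegrable b') :
    ∀ᵐ x, x ∈ (Ω : Set (Rn n)) → b x = b' x := by
  have key := Ω.isOpen.ae_eq_zero_of_integral_contDiff_smul_eq_zero (μ := volume)
    (f := fun x => b x - b' x) ((hb.sub hb').locallyIntegrableOn _) fun g hg hgs hgΩ => ?_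
  · exact key.mono fun x hx hxΩ => sub_eq_zero.1 (hx hxΩ)
  · let φ : 𝓓(Ω, ℝ) := ⟨g, hg, hgs, hgΩ⟩
    have h1 : ∫ x, b x * φ x ∂(volOn Ω) = ∫ x, b' x * φ x ∂(volOn Ω) :=
      neg_injective ((h φ).symm.trans (h' φ))
    have hout : ∀ x ∉ (Ω : Set (Rn n)), φ x = 0 := fun x hx =>
      testFunction_eq_zero φ fun h => hx (φ.tsupport_subset h)
    rw [setIntegral_mul_test hout, setIntegral_mul_test hout] at h1
    have h_int : ∀ f : Rn n → ℝ, LocallyIntegrable f → Integrable (fun x => f x * φ x) :=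
      fun f hf => by
        simpa using hf.integrable_smul_right_of_hasCompactSupport φ.continuous φ.hasCompactSupport
    rw [← sub_eq_zero, ← integral_sub (h_int b hb) (h_int b' hb')] at h1
    rw [← h1]
    refine integral_congr_ae (Eventually.of_forall fun x => ?_)
    change g x * (b x - b' x) = b x * g x - b' x * g x
    ring

theorem weakPartial_of_contDiff {φ : Rn n → ℝ} (hφ : ContDiff ℝ 1 φ) (i : Fin n) :
    WeakPartial Ω i φ (partialD i φ) :=
  weakPartial_of_tendsto (p := 1) le_rfl (c := fun _ => φ) (fun _ => hφ)
    hφ.continuous.locallyIntegrable (continuous_partialD_of_contDiff hφ i).locallyIntegrable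
    (fun K _ _ => by simp) (fun K _ _ => by simp)

theorem norm_gradient_eq (φ : Rn n → ℝ) (x : Rn n) : ‖gradient φ x‖ = ‖fderiv ℝ φ x‖ := by
  rw [← toDual_gradient, LinearIsometryEquiv.norm_map]

theorem gradient_apply (φ : Rn n → ℝ) (x : Rn n) (i : Fin n) : gradient φ x i = partialD i φ x := by
  rw [partialD, ← toDual_gradient, InnerProductSpace.toDual_apply_apply,
    EuclideanSpace.inner_single_right]
  simp

variable [n.AtLeastTwo]

/-- The extension by zero of a Sobolev function. -/
def W1p.ext (w : W1p Ω (n : ℝ≥0∞)) : Rn n → ℝ := (Ω : Set (Rn n)).indicator (W1p.fn w)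

/-- The extension by zero of the weak partial derivatives of a Sobolev function. -/
def W1p.extGrad (w : W1p Ω (n : ℝ≥0∞)) (i : Fin n) : Rn n → ℝ :=
  (Ω : Set (Rn n)).indicator fun x => W1p.grad w x i

theorem W1p.memLp_grad_apply (w : W1p Ω (n : ℝ≥0∞)) (i : Fin n) :
    MemLp (fun x => W1p.grad w x i) n (volOn Ω) :=
  (EuclideanSpace.proj i : Rn n →L[ℝ] ℝ).comp_memLp' (Lp.memLp w.1.2)

theorem W1p.sobOn (w : W1p Ω (n : ℝ≥0∞)) : SobOn Ω (W1p.ext w) (W1p.extGrad w) where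
  memLp := (memLp_indicator_iff_restrict Ω.isOpen.measurableSet).2 (Lp.memLp w.1.1)
  memLp_grad i := (memLp_indicator_iff_restrict Ω.isOpen.measurableSet).2 (W1p.memLp_grad_apply w i)
  weak i := fun φ => by
    have h1 := w.2 φ i
    have e1 : ∫ x, W1p.ext w x * partialD i φ x ∂(volOn Ω)
        = ∫ x, W1p.fn w x * partialD i φ x ∂(volOn Ω) :=
      setIntegral_congr_fun Ω.isOpen.measurableSet fun x hx => by
        simp [W1p.ext, Set.indicator_of_mem hx]
    have e2 : ∫ x, W1p.extGrad w i x * φ x ∂(volOn Ω)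
        = ∫ x, W1p.grad w x i * φ x ∂(volOn Ω) :=
      setIntegral_congr_fun Ω.isOpen.measurableSet fun x hx => by
        simp [W1p.extGrad, Set.indicator_of_mem hx]
    rw [e1, e2]
    exact h1

theorem W1p.eLpNorm_extGrad_le (w : W1p Ω (n : ℝ≥0∞)) (i : Fin n) :
    eLpNorm (W1p.extGrad w i) n volume ≤ eLpNorm (W1p.grad w) n (volOn Ω) := by
  rw [W1p.extGrad, eLpNorm_indicator_eq_eLpNorm_restrict Ω.isOpen.measurableSet]
  refine eLpNorm_mono fun x => ?_
  exact PiLp.norm_apply_le (W1p.grad w x) i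

/-- The generators of `W10p` are described by their function alone; uniqueness of weak derivatives
recovers the gradient. -/
theorem W1p.grad_ae_eq_gradient (w : W1p Ω (n : ℝ≥0∞)) (φ : 𝓓(Ω, ℝ))
    (h : W1p.fn w =ᵐ[volOn Ω] φ) : W1p.grad w =ᵐ[volOn Ω] gradient φ := by
  have hs := W1p.sobOn w
  have hi : ∀ i, ∀ᵐ x ∂(volOn Ω), W1p.grad w x i = gradient φ x i := by
    intro i
    have hw : WeakPartial Ω i (W1p.ext w) (partialD i φ) := fun ψ => by
      rw [← weakPartial_of_contDiff (contDiff_one_test φ) i ψ]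
      refine integral_congr_ae ?_
      filter_upwards [h, ae_restrict_mem Ω.isOpen.measurableSet] with x hx hxΩ
      simp [W1p.ext, Set.indicator_of_mem hxΩ, hx]
    have h1 := (hs.weak i).unique hw ((hs.memLp_grad i).locallyIntegrable one_le_dim)
      (continuous_partialD φ i).locallyIntegrable
    rw [ae_restrict_iff' Ω.isOpen.measurableSet]
    filter_upwards [h1] with x hx hxΩ
    rw [gradient_apply, ← hx hxΩ, W1p.extGrad, Set.indicator_of_mem hxΩ]
  filter_upwards [ae_all_iff.2 hi] with x hx
  ext i
  exact hx i

theorem exists_poincare_test (hΩ : Bornology.IsBounded (Ω : Set (Rn n))) :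
    ∃ C : ℝ≥0, ∀ φ : 𝓓(Ω, ℝ), eLpNorm φ n (volOn Ω) ≤ C * eLpNorm (gradient φ) n (volOn Ω) := by
  have hn : 2 ≤ n := Nat.AtLeastTwo.prop
  have hfin : IsFiniteMeasure (volOn Ω) :=
    ⟨by rw [Measure.restrict_apply_univ]; exact hΩ.measure_lt_top⟩
  -- The exponent `n` is critical, so the Sobolev inequality is applied from `L^{n-1}` to `L^n`. It
  -- is admissible because `1 / (n - 1) ≤ 2 / n`, that is `n ≥ 2`. The gradient then passes from
  -- `L^{n-1}` to `L^n` by Hölder on the bounded set `Ω`.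
  set p : ℝ≥0 := ((n - 1 : ℕ) : ℝ≥0) with hp
  set t : ℝ≥0∞ := volOn Ω Set.univ ^ (1 / (p : ℝ≥0∞).toReal - 1 / (n : ℝ≥0∞).toReal) with ht
  have hpn : p ≤ n := by rw [hp]; exact_mod_cast Nat.sub_le n 1
  have hp1 : 1 ≤ p := by rw [hp]; exact_mod_cast (by omega : 1 ≤ n - 1)
  have htop : t ≠ ∞ := by
    refine (ENNReal.rpow_lt_top_of_nonneg ?_ (measure_ne_top _ _)).ne
    rw [sub_nonneg, ENNReal.coe_toReal, ENNReal.toReal_natCast]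
    have h1 : (0 : ℝ) < p := by exact_mod_cast zero_lt_one.trans_le hp1
    exact one_div_le_one_div_of_le h1 (by exact_mod_cast hpn)
  refine ⟨eLpNormLESNormFDerivOfLeConst ℝ (volume : Measure (Rn n)) Ω p n * t.toNNReal,
    fun φ => ?_⟩
  have hsupp : Function.support φ ⊆ Ω := (subset_tsupport _).trans φ.tsupport_subset
  have hsuppg : Function.support (gradient φ) ⊆ Ω := fun x hx => by
    by_contra hxΩ
    refine hx ?_
    have : ‖gradient φ x‖ = 0 := by
      rw [norm_gradient_eq, norm_eq_zero]
      exact image_eq_zero_of_notMem_tsupport fun h =>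
        hxΩ (φ.tsupport_subset (tsupport_fderiv_subset ℝ h))
    exact norm_eq_zero.1 this
  have h1 := eLpNorm_le_eLpNorm_fderiv_of_le (volume : Measure (Rn n)) (contDiff_one_test φ) hsupp
    (p := p) (q := n) hp1 (by
      rw [finrank_euclideanSpace_fin, hp]; exact_mod_cast (by omega : n - 1 < n)) (by
      rw [finrank_euclideanSpace_fin, hp]
      have h2 : ((n - 1 : ℕ) : ℝ) = (n : ℝ) - 1 := by rw [Nat.cast_sub (by omega)]; simp
      have h3 : (2 : ℝ) ≤ n := by exact_mod_cast hn
      rw [NNReal.coe_inv, NNReal.coe_natCast, NNReal.coe_natCast, h2, sub_le_iff_le_add,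
        inv_eq_one_div, inv_eq_one_div, ← add_div, div_le_div_iff₀
        (by linarith) (by linarith)]
      linarith) hΩ
  have hg : eLpNorm (fderiv ℝ φ) p volume = eLpNorm (gradient φ) p (volOn Ω) := by
    rw [eLpNorm_restrict_eq_of_support_subset hsuppg]
    exact eLpNorm_congr_norm_ae (Eventually.of_forall fun x => (norm_gradient_eq φ x).symm)
  have hgm : AEStronglyMeasurable (gradient φ) (volOn Ω) := by
    refine Continuous.aestronglyMeasurable ?_
    exact (InnerProductSpace.toDual ℝ (Rn n)).symm.continuous.comp
      ((contDiff_one_test φ).continuous_fderiv (by simp))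
  rw [eLpNorm_restrict_eq_of_support_subset hsupp, ENNReal.coe_mul, mul_assoc]
  rw [hg] at h1
  refine (le_of_eq (by norm_cast)).trans (h1.trans ?_)
  gcongr
  rw [mul_comm, ENNReal.coe_toNNReal htop]
  exact eLpNorm_le_eLpNorm_mul_rpow_measure_univ (by exact_mod_cast hpn) hgm

theorem exists_poincare (hΩ : Bornology.IsBounded (Ω : Set (Rn n))) :
    ∃ C : ℝ≥0, ∀ w ∈ W10p Ω (n : ℝ≥0∞),
      eLpNorm (W1p.fn w) n (volOn Ω) ≤ C * eLpNorm (W1p.grad w) n (volOn Ω) := by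
  obtain ⟨C, hC⟩ := exists_poincare_test hΩ
  refine ⟨C, fun w hw => ?_⟩
  -- In terms of the norms of the two components the inequality is a closed condition on `W^{1,n}`,
  -- so it extends from test functions to their closure.
  have hcl : IsClosed {w : W1p Ω (n : ℝ≥0∞) | ‖w.1.1‖ ≤ C * ‖w.1.2‖} :=
    isClosed_le (continuous_fst.comp continuous_subtype_val).norm
      (continuous_const.mul (continuous_snd.comp continuous_subtype_val).norm)
  have hmem : w ∈ {w : W1p Ω (n : ℝ≥0∞) | ‖w.1.1‖ ≤ C * ‖w.1.2‖} := by
    refine closure_minimal ?_ hcl hw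
    rintro v ⟨φ, hφ⟩
    have h1 := hC φ
    rw [← eLpNorm_congr_ae hφ, ← eLpNorm_congr_ae (W1p.grad_ae_eq_gradient v φ hφ)] at h1
    simp only [Set.mem_ofPred_eq, Lp.norm_def]
    rw [← ENNReal.coe_toReal, ← ENNReal.toReal_mul]
    exact ENNReal.toReal_mono (ENNReal.mul_ne_top ENNReal.coe_ne_top (Lp.eLpNorm_ne_top v.1.2)) h1
  simp only [Set.mem_ofPred_eq, Lp.norm_def] at hmem
  rw [← ENNReal.coe_toReal, ← ENNReal.toReal_mul] at hmem
  exact (ENNReal.toReal_le_toReal (Lp.eLpNorm_ne_top w.1.1)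
    (ENNReal.mul_ne_top ENNReal.coe_ne_top (Lp.eLpNorm_ne_top w.1.2))).1 hmem

theorem exists_abs_deriv_smoothTransition_le :
    ∃ L : ℝ≥0, ∀ t, |deriv Real.smoothTransition t| ≤ L := by
  have hd : Continuous (deriv Real.smoothTransition) :=
    (Real.smoothTransition.contDiff (n := 1)).continuous_deriv (by simp)
  have hcs : HasCompactSupport (deriv Real.smoothTransition) := by
    refine HasCompactSupport.intro (isCompact_Icc (a := (0 : ℝ)) (b := 1)) fun t ht => ?_
    rw [Set.mem_Icc, not_and_or, not_le, not_le] at ht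
    rcases ht with ht | ht
    · have : Real.smoothTransition =ᶠ[𝓝 t] fun _ => (0 : ℝ) := by
        filter_upwards [Iio_mem_nhds ht] with s hs
        exact Real.smoothTransition.zero_of_nonpos (le_of_lt hs)
      rw [this.deriv_eq]; simp
    · have : Real.smoothTransition =ᶠ[𝓝 t] fun _ => (1 : ℝ) := by
        filter_upwards [Ioi_mem_nhds ht] with s hs
        exact Real.smoothTransition.one_of_one_le (le_of_lt hs)
      rw [this.deriv_eq]; simp
  obtain ⟨C, hC⟩ := hd.bounded_above_of_compact_support hcs
  exact ⟨C.toNNReal, fun t => (hC t).trans (Real.le_coe_toNNReal C)⟩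

/-- Take competitors `v k` of small energy in the definition of the capacity and compose them with
`Real.smoothTransition`, a smooth truncation to `[0, 1]` that equals `1` where `v k ≥ 1`. The chain
rule keeps the gradients small, and Poincaré's inequality makes the functions themselves small in
`L^n`. -/
theorem IsQuasicontinuous.exists_hasPotentials (hΩ : Bornology.IsBounded (Ω : Set (Rn n)))
    {f : Rn n → ℝ} (hf : IsQuasicontinuous Ω (n : ℝ≥0∞) f) :
    ∃ z c U, HasPotentials Ω f z c U := by
  obtain ⟨L, hL⟩ := exists_abs_deriv_smoothTransition_le
  obtain ⟨C, hC⟩ := exists_poincare hΩ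
  have hn0 : (0 : ℝ) < n := by exact_mod_cast NeZero.pos n
  have hstep : ∀ k : ℕ, ∃ (v : W1p Ω (n : ℝ≥0∞)) (U : Set (Rn n)), v ∈ W10p Ω (n : ℝ≥0∞) ∧
      IsOpen U ∧ U ⊆ Ω ∧ (∀ᵐ x ∂(volume.restrict U), 1 ≤ W1p.fn v x) ∧
      ContinuousOn f ((Ω : Set (Rn n)) \ U) ∧
      eLpNorm (W1p.grad v) n (volOn Ω) ≤ ((k : ℝ≥0∞) + 1)⁻¹ := by
    intro k
    -- The capacity is an `n`-th power of a norm, so the threshold is chosen to make the norm of the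
    -- gradient at most `1 / (k + 1)`.
    have hpos : 0 < (((k : ℝ≥0∞) + 1)⁻¹) ^ (n : ℝ) :=
      ENNReal.rpow_pos (by simp) (by simp)
    obtain ⟨A, hA, hcap, hcont⟩ := hf _ hpos
    simp only [capacity, iInf_lt_iff] at hcap
    obtain ⟨v, ⟨hv, U, hU, hAU, hUΩ, hvU⟩, hlt⟩ := hcap
    refine ⟨v, U, hv, hU, hUΩ, hvU, hcont.mono (Set.sdiff_subset_sdiff_right hAU), ?_⟩
    rw [eLpNorm_eq_lintegral_rpow_enorm_toReal (by simpa using hn0.ne') (by simp)]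
    simp only [ENNReal.toReal_natCast] at hlt ⊢
    rw [one_div, ENNReal.rpow_inv_le_iff hn0]
    exact hlt.le
  choose v U hv hU hUΩ hvU hcont hsmall using hstep
  have hlim0 : Tendsto (fun k : ℕ => ((k : ℝ≥0∞) + 1)⁻¹) atTop (𝓝 0) := by
    have := ENNReal.tendsto_inv_nat_nhds_zero.comp (tendsto_add_atTop_nat 1)
    simpa [Function.comp_def] using this
  have hlip : LipschitzWith L Real.smoothTransition := lipschitzWith_of_nnnorm_deriv_le
    ((Real.smoothTransition.contDiff (n := 1)).differentiable one_ne_zero) fun t => by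
      exact_mod_cast hL t
  refine ⟨fun k x => Real.smoothTransition (W1p.ext (v k) x),
    fun k i x => W1p.extGrad (v k) i x * deriv Real.smoothTransition (W1p.ext (v k) x), U,
    fun k => (W1p.sobOn (v k)).comp (Real.smoothTransition.contDiff (n := 1))
      Real.smoothTransition.zero hL, fun k x => Real.smoothTransition.nonneg _,
    fun k x => Real.smoothTransition.le_one _, hU, fun k => ?_, hcont, ?_, fun i => ?_⟩
  · have := hvU k
    rw [ae_restrict_iff' (hU k).measurableSet] at this
    filter_upwards [this] with x hx hxU
    rw [W1p.ext, Set.indicator_of_mem (hUΩ k hxU)]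
    exact Real.smoothTransition.one_of_one_le (hx hxU)
  · have h1 : Tendsto (fun k : ℕ => (L : ℝ≥0∞) * (C * ((k : ℝ≥0∞) + 1)⁻¹)) atTop (𝓝 0) := by
      have := ENNReal.Tendsto.const_mul (ENNReal.Tendsto.const_mul hlim0
        (Or.inr (ENNReal.coe_ne_top (r := C)))) (Or.inr (ENNReal.coe_ne_top (r := L)))
      simpa using this
    refine tendsto_of_tendsto_of_tendsto_of_le_of_le tendsto_const_nhds h1 (fun _ => zero_le)
      fun k => ?_
    refine (eLpNorm_le_nnreal_smul_eLpNorm_of_ae_le_mul (g := W1p.ext (v k)) (c := L)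
      (Eventually.of_forall fun x => ?_) _).trans ?_
    · have := hlip.dist_le_mul (W1p.ext (v k) x) 0
      rw [Real.smoothTransition.zero, dist_zero_right, dist_zero_right] at this
      exact_mod_cast this
    · rw [ENNReal.smul_def, smul_eq_mul, W1p.ext,
        eLpNorm_indicator_eq_eLpNorm_restrict Ω.isOpen.measurableSet]
      gcongr
      exact (hC _ (hv k)).trans (by gcongr; exact hsmall k)
  · have h1 : Tendsto (fun k : ℕ => (L : ℝ≥0∞) * ((k : ℝ≥0∞) + 1)⁻¹) atTop (𝓝 0) := by
      have := ENNReal.Tendsto.const_mul hlim0 (Or.inr (ENNReal.coe_ne_top (r := L)))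
      simpa using this
    refine tendsto_of_tendsto_of_tendsto_of_le_of_le tendsto_const_nhds h1 (fun _ => zero_le)
      fun k => ?_
    refine (eLpNorm_mul_le_of_bound (Eventually.of_forall fun x => hL _)).trans ?_
    rw [ENNReal.ofReal_coe_nnreal]
    gcongr
    exact (W1p.eLpNorm_extGrad_le (v k) i).trans (hsmall k)

end Sobolev

end

noncomputable section

/-! ### Vector-measure integrals in terms of scalar measures -/

section GeneralIntegral

variable {X E F : Type*} [MeasurableSpace X] [NormedAddCommGroup E] [NormedSpace ℝ E]
  [NormedAddCommGroup F] [NormedSpace ℝ F]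

theorem continuous_integral_comp_clm {ν Q : Measure X} (hQ : Q ≤ ν) (ℓ : E →L[ℝ] ℝ) :
    Continuous fun f : X →₁[ν] E => ∫ x, ℓ (f x) ∂Q := by
  refine (LipschitzWith.of_dist_le_mul (K := ‖ℓ‖₊) fun f g => ?_).continuous
  have hf := (L1.integrable_coeFn f).mono_measure hQ
  have hg := (L1.integrable_coeFn g).mono_measure hQ
  rw [dist_eq_norm, ← integral_sub (ℓ.integrable_comp hf) (ℓ.integrable_comp hg), dist_eq_norm,
    L1.norm_eq_integral_norm, ← integral_const_mul]
  refine (norm_integral_le_integral_norm _).trans ?_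
  have hfg : Integrable (fun x => ‖ℓ‖ * ‖f x - g x‖) ν :=
    ((L1.integrable_coeFn f).sub (L1.integrable_coeFn g)).norm.const_mul _
  refine (integral_mono (hf := ((ℓ.integrable_comp hf).sub (ℓ.integrable_comp hg)).norm)
    (hg := hfg.mono_measure hQ) fun x => ?_).trans ?_
  · change ‖ℓ (f x) - ℓ (g x)‖ ≤ _
    rw [← map_sub]
    exact ℓ.le_opNorm _
  · refine (integral_mono_measure hQ (Eventually.of_forall fun x => by positivity) hfg).trans
      (le_of_eq (integral_congr_ae ?_))
    filter_upwards [Lp.coeFn_sub f g] with x hx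
    rw [hx, Pi.sub_apply, coe_nnnorm]

theorem continuous_vectorIntegral {ν : Measure X} (μ : VectorMeasure X F) (hμ : μ.variation ≤ ν)
    (B : E →L[ℝ] F →L[ℝ] ℝ) :
    Continuous fun f : X →₁[ν] E => μ.integral f B := by
  refine (LipschitzWith.of_dist_le_mul (K := ‖B‖₊) fun f g => ?_).continuous
  have hf := (L1.integrable_coeFn f).mono_measure hμ
  have hg := (L1.integrable_coeFn g).mono_measure hμ
  rw [dist_eq_norm, ← VectorMeasure.integral_sub hf hg, dist_eq_norm, L1.norm_eq_integral_norm]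
  refine VectorMeasure.norm_integral_le_integral_norm.trans ?_
  rw [coe_nnnorm]
  gcongr
  have hfg : Integrable (fun x => ‖f x - g x‖) ν :=
    ((L1.integrable_coeFn f).sub (L1.integrable_coeFn g)).norm
  refine (integral_mono_measure hμ (Eventually.of_forall fun x => norm_nonneg _) hfg).trans
      (le_of_eq (integral_congr_ae ?_))
  filter_upwards [Lp.coeFn_sub f g] with x hx
  rw [hx, Pi.sub_apply]

/-- A vector integral whose set function is a combination of finite measures. -/
theorem vectorIntegral_eq_sum {ι : Type*} [Fintype ι] (μ : VectorMeasure X F)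
    (B : E →L[ℝ] F →L[ℝ] ℝ) (P N : ι → Measure X) (ℓ : ι → E →L[ℝ] ℝ) {ν : Measure X}
    [IsFiniteMeasure ν] (hμ : μ.variation ≤ ν) (hP : ∀ a, P a ≤ ν) (hN : ∀ a, N a ≤ ν)
    (h : ∀ s, MeasurableSet s → ∀ e, B e (μ s) = ∑ a, ((P a).real s - (N a).real s) * ℓ a e)
    {f : X → E} (hf : Integrable f ν) :
    μ.integral f B = ∑ a, (∫ x, ℓ a (f x) ∂(P a) - ∫ x, ℓ a (f x) ∂(N a)) := by
  have hμf : IsFiniteMeasure μ.variation := isFiniteMeasure_of_le ν hμ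
  have hPf : ∀ a, IsFiniteMeasure (P a) := fun a => isFiniteMeasure_of_le ν (hP a)
  have hNf : ∀ a, IsFiniteMeasure (N a) := fun a => isFiniteMeasure_of_le ν (hN a)
  -- Both sides are additive and continuous for `L¹(ν)` convergence, so it is enough to treat
  -- indicators, where the identity is `h`.
  refine hf.induction
    (P := fun f => μ.integral f B = ∑ a, (∫ x, ℓ a (f x) ∂(P a) - ∫ x, ℓ a (f x) ∂(N a)))
    ?_ ?_ ?_ ?_
  · intro c s hs _
    have hind : ∀ a (Q : Measure X) [IsFiniteMeasure Q],
        ∫ x, ℓ a (s.indicator (fun _ => c) x) ∂Q = Q.real s * ℓ a c := by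
      intro a Q _
      have : ∀ x, ℓ a (s.indicator (fun _ => c) x) = s.indicator (fun _ => ℓ a c) x := fun x => by
        by_cases hx : x ∈ s <;> simp [hx]
      simp only [this]
      rw [integral_indicator_const _ hs, smul_eq_mul]
    have h1 := VectorMeasure.integral_indicator_const (μ := μ) (B := B) c hs
    refine h1.trans ?_
    rw [h s hs c]
    refine Finset.sum_congr rfl fun a _ => ?_
    rw [hind a (P a), hind a (N a)]; ring
  · intro f g _ hf hg h1 h2
    rw [VectorMeasure.integral_add (hf.mono_measure hμ) (hg.mono_measure hμ), h1, h2,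
      ← Finset.sum_add_distrib]
    refine Finset.sum_congr rfl fun a _ => ?_
    have hadd : ∀ Q : Measure X, Q ≤ ν → ∫ x, ℓ a ((f + g) x) ∂Q
        = ∫ x, ℓ a (f x) ∂Q + ∫ x, ℓ a (g x) ∂Q := fun Q hQ => by
      rw [← integral_add ((ℓ a).integrable_comp (hf.mono_measure hQ))
        ((ℓ a).integrable_comp (hg.mono_measure hQ))]
      simp
    rw [hadd _ (hP a), hadd _ (hN a)]; ring
  · exact isClosed_eq (continuous_vectorIntegral μ hμ B) (continuous_finsetSum _ fun a _ =>
      (continuous_integral_comp_clm (hP a) (ℓ a)).sub (continuous_integral_comp_clm (hN a) (ℓ a)))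
  · intro f g hfg _ h1
    rw [← VectorMeasure.integral_congr_ae (hfg.filter_mono (ae_mono hμ)), h1]
    refine Finset.sum_congr rfl fun a _ => ?_
    congr 1
    · refine integral_congr_ae ?_
      filter_upwards [hfg.filter_mono (ae_mono (hP a))] with x hx
      rw [hx]
    · refine integral_congr_ae ?_
      filter_upwards [hfg.filter_mono (ae_mono (hN a))] with x hx
      rw [hx]

end GeneralIntegral

/-! ### Matrix-valued measures described by pairs of scalar measures -/

section Represents

variable {n : ℕ} {Ω : TopologicalSpace.Opens (Rn n)}

/-- The entries of the matrix-valued measure `μ` on `Ω` are the differences `P i j - N i j` of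
finite measures which vanish outside `Ω`. -/
structure Represents (μ : MatMeasure Ω) (P N : Fin n → Fin n → Measure (Rn n)) : Prop where
  finite_pos : ∀ i j, IsFiniteMeasure (P i j)
  finite_neg : ∀ i j, IsFiniteMeasure (N i j)
  pos_compl : ∀ i j, P i j (Ω : Set (Rn n))ᶜ = 0
  neg_compl : ∀ i j, N i j (Ω : Set (Rn n))ᶜ = 0
  apply : ∀ s : Set Ω, MeasurableSet s → ∀ i j,
    (μ s).1 (i, j) = (P i j).real (Subtype.val '' s) - (N i j).real (Subtype.val '' s)

/-- The linear functional which reads the entry `(i, j)` of a symmetric matrix. -/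
def symEntry (i j : Fin n) : SymMat n →L[ℝ] ℝ :=
  (EuclideanSpace.proj (i, j) : EuclideanSpace ℝ (Fin n × Fin n) →L[ℝ] ℝ).comp (SymMat n).subtypeL

@[simp] theorem symEntry_apply (i j : Fin n) (A : SymMat n) : symEntry i j A = A.1 (i, j) := rfl

theorem inner_symMat (A B : SymMat n) : inner ℝ A B = ∑ i, ∑ j, A.1 (i, j) * B.1 (i, j) := by
  rw [Submodule.coe_inner, PiLp.inner_apply, Fintype.sum_prod_type]
  simp [mul_comm]

theorem enorm_symMat_le (A : SymMat n) : ‖A‖ₑ ≤ ∑ i, ∑ j, ‖A.1 (i, j)‖ₑ := by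
  have h1 : ‖A‖ ≤ ∑ i, ∑ j, ‖A.1 (i, j)‖ := by
    have hA : A.1 = ∑ a : Fin n × Fin n, EuclideanSpace.single a (A.1 a) := by
      ext b
      simp [Finset.sum_apply]
    rw [Submodule.coe_norm, hA]
    refine (norm_sum_le _ _).trans (le_of_eq ?_)
    rw [Fintype.sum_prod_type, ← hA]
    simp
  rw [← ofReal_norm]
  refine (ENNReal.ofReal_le_ofReal h1).trans (le_of_eq ?_)
  rw [ENNReal.ofReal_sum_of_nonneg fun i _ => Finset.sum_nonneg fun j _ => norm_nonneg _]
  refine Finset.sum_congr rfl fun i _ => ?_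
  rw [ENNReal.ofReal_sum_of_nonneg fun j _ => norm_nonneg _]
  simp only [ofReal_norm]

/-- The restriction to `Ω`, as a measure on `Ω`, of a measure on the whole space. -/
def onOpen (Ω : TopologicalSpace.Opens (Rn n)) (Q : Measure (Rn n)) : Measure Ω :=
  Q.comap Subtype.val

theorem measurableEmbedding_coe (Ω : TopologicalSpace.Opens (Rn n)) :
    MeasurableEmbedding (Subtype.val : Ω → Rn n) :=
  MeasurableEmbedding.subtype_coe Ω.isOpen.measurableSet

theorem onOpen_apply (Q : Measure (Rn n)) (s : Set Ω) : onOpen Ω Q s = Q (Subtype.val '' s) :=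
  (measurableEmbedding_coe Ω).comap_apply _ _

theorem onOpen_real (Q : Measure (Rn n)) (s : Set Ω) :
    (onOpen Ω Q).real s = Q.real (Subtype.val '' s) := by
  rw [Measure.real, onOpen_apply, Measure.real]

theorem onOpen_mono {Q Q' : Measure (Rn n)} (h : Q ≤ Q') : onOpen Ω Q ≤ onOpen Ω Q' :=
  Measure.le_iff.2 fun s _ => by rw [onOpen_apply, onOpen_apply]; exact h _

theorem integral_onOpen {Q : Measure (Rn n)} (hQ : Q (Ω : Set (Rn n))ᶜ = 0) (f : Rn n → ℝ) :
    ∫ x : Ω, f x ∂(onOpen Ω Q) = ∫ x, f x ∂Q := by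
  rw [onOpen]
  refine (integral_subtype_comap Ω.isOpen.measurableSet f).trans ?_
  rw [Measure.restrict_eq_self_of_ae_mem
    ((measure_eq_zero_iff_ae_notMem.1 hQ).mono fun x hx => not_not.1 hx)]

theorem map_onOpen {Q : Measure (Rn n)} (hQ : Q (Ω : Set (Rn n))ᶜ = 0) :
    (onOpen Ω Q).map Subtype.val = Q := by
  rw [onOpen, (measurableEmbedding_coe Ω).map_comap,
    Subtype.range_coe]
  exact Measure.restrict_eq_self_of_ae_mem
    ((measure_eq_zero_iff_ae_notMem.1 hQ).mono fun x hx => not_not.1 hx)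

namespace Represents

variable {μ : MatMeasure Ω} {P N : Fin n → Fin n → Measure (Rn n)}

theorem finite_total (h : Represents μ P N) : IsFiniteMeasure (totalMeas P N) := by
  have hfp := h.finite_pos
  have hfn := h.finite_neg
  refine ⟨?_⟩
  simp only [totalMeas, Measure.finsetSum_apply, Measure.add_apply]
  exact ENNReal.sum_lt_top.2 fun i _ => ENNReal.sum_lt_top.2 fun k _ =>
    ENNReal.add_lt_top.2 ⟨measure_lt_top _ _, measure_lt_top _ _⟩

theorem finite_onOpen (h : Represents μ P N) : IsFiniteMeasure (onOpen Ω (totalMeas P N)) := by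
  have := h.finite_total
  exact ⟨by rw [onOpen_apply]; exact measure_lt_top _ _⟩

theorem total_compl (h : Represents μ P N) : totalMeas P N (Ω : Set (Rn n))ᶜ = 0 := by
  simp [totalMeas, Measure.finsetSum_apply, h.pos_compl, h.neg_compl]

theorem variation_le (h : Represents μ P N) : μ.variation ≤ onOpen Ω (totalMeas P N) := by
  have hfp := h.finite_pos
  have hfn := h.finite_neg
  refine VectorMeasure.variation_le_of_forall_enorm_le fun s hs => ?_
  refine (enorm_symMat_le _).trans ?_
  rw [onOpen_apply]
  simp only [totalMeas, Measure.finsetSum_apply, Measure.add_apply]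
  refine Finset.sum_le_sum fun i _ => Finset.sum_le_sum fun j _ => ?_
  rw [h.apply s hs]
  refine enorm_sub_le.trans (add_le_add ?_ ?_)
  · rw [Real.enorm_of_nonneg measureReal_nonneg, ofReal_measureReal]
  · rw [Real.enorm_of_nonneg measureReal_nonneg, ofReal_measureReal]

theorem integrable_onOpen (h : Represents μ P N) {f : Rn n → ℝ}
    (hf : Integrable f (totalMeas P N)) :
    Integrable (fun x : Ω => f x) (onOpen Ω (totalMeas P N)) := by
  rw [← map_onOpen h.total_compl] at hf
  exact hf.comp_measurable measurable_subtype_coe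

theorem integrable (h : Represents μ P N) {f : Rn n → ℝ}
    (hf : Integrable f (totalMeas P N)) : μ.Integrable fun x : Ω => f x :=
  (h.integrable_onOpen hf).mono_measure h.variation_le

theorem integral_apply_subtype (h : Represents μ P N) {f : Ω → ℝ}
    (hf : Integrable f (onOpen Ω (totalMeas P N))) (i j : Fin n) :
    (μ.integral f (ContinuousLinearMap.lsmul ℝ ℝ) : SymMat n).1 (i, j)
      = ∫ x, f x ∂(onOpen Ω (P i j)) - ∫ x, f x ∂(onOpen Ω (N i j)) := by
  have := h.finite_onOpen
  rw [← symEntry_apply, VectorMeasure.continuousLinearMap_apply_integral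
    (hf.mono_measure h.variation_le)]
  have key := vectorIntegral_eq_sum (ι := Unit) μ
    ((ContinuousLinearMap.compL ℝ (SymMat n) (SymMat n) ℝ (symEntry i j)) ∘L
      (ContinuousLinearMap.lsmul ℝ ℝ)) (fun _ => onOpen Ω (P i j)) (fun _ => onOpen Ω (N i j))
    (fun _ => ContinuousLinearMap.id ℝ ℝ) h.variation_le
    (fun _ => onOpen_mono (pos_le_totalMeas P N i j))
    (fun _ => onOpen_mono (neg_le_totalMeas P N i j)) (fun s hs e => by
      simp only [Finset.univ_unique, Finset.sum_singleton, onOpen_real, ← h.apply s hs]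
      simp [mul_comm]) hf
  simpa using key

theorem integral_apply (h : Represents μ P N) {f : Rn n → ℝ}
    (hf : Integrable f (totalMeas P N)) (i j : Fin n) :
    (μ.integral (fun x : Ω => f x) (ContinuousLinearMap.lsmul ℝ ℝ) : SymMat n).1 (i, j)
      = ∫ x, f x ∂(P i j) - ∫ x, f x ∂(N i j) := by
  rw [h.integral_apply_subtype (h.integrable_onOpen hf), integral_onOpen (h.pos_compl i j),
    integral_onOpen (h.neg_compl i j)]

/-- The extension by zero of an entry of a matrix-valued function on `Ω`. -/
def extEntry (φ : C₀(Ω, SymMat n)) (i j : Fin n) (x : Rn n) : ℝ :=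
  open Classical in if hx : x ∈ Ω then (φ ⟨x, hx⟩).1 (i, j) else 0

theorem extEntry_coe (φ : C₀(Ω, SymMat n)) (i j : Fin n) (x : Ω) :
    extEntry φ i j x = (φ x).1 (i, j) := by
  simp [extEntry, x.2]

theorem extEntry_of_notMem (φ : C₀(Ω, SymMat n)) (i j : Fin n) {x : Rn n} (hx : x ∉ Ω) :
    extEntry φ i j x = 0 := by
  simp [extEntry, hx]

theorem abs_extEntry_le (φ : C₀(Ω, SymMat n)) (i j : Fin n) (x : Rn n) :
    |extEntry φ i j x| ≤ ‖φ‖ := by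
  by_cases hx : x ∈ Ω
  · rw [extEntry_coe φ i j ⟨x, hx⟩, ← Real.norm_eq_abs]
    refine (PiLp.norm_apply_le (φ ⟨x, hx⟩).1 (i, j)).trans ?_
    exact φ.toBCF.norm_coe_le_norm ⟨x, hx⟩
  · rw [extEntry_of_notMem φ i j hx]; simp

/-- Off `Ω`, continuity comes from vanishing at infinity: `φ` is below `ε` outside a compact subset
of `Ω`, and such a set stays at positive distance from any point not in `Ω`. -/
theorem continuous_extEntry (φ : C₀(Ω, SymMat n)) (i j : Fin n) :
    Continuous (extEntry φ i j) := by
  have hφc : Continuous fun x : Ω => (φ x).1 (i, j) :=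
    (symEntry i j).continuous.comp φ.continuous
  rw [continuous_iff_continuousAt]
  intro x
  by_cases hx : x ∈ Ω
  · have : ContinuousOn (extEntry φ i j) Ω := by
      rw [continuousOn_iff_continuous_domRestrict]
      refine hφc.congr fun y => ?_
      exact (extEntry_coe φ i j y).symm
    exact this.continuousAt (Ω.isOpen.mem_nhds hx)
  · rw [Metric.continuousAt_iff]
    intro ε hε
    have h0 := φ.zero_at_infty'
    rw [Metric.tendsto_nhds] at h0
    have h1 := h0 ε hε
    rw [Filter.eventually_iff, mem_cocompact] at h1
    obtain ⟨K, hK, hKs⟩ := h1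
    have hKc : IsCompact (Subtype.val '' K : Set (Rn n)) := hK.image continuous_subtype_val
    have hxK : x ∈ (Subtype.val '' K : Set (Rn n))ᶜ := by
      rintro ⟨y, -, rfl⟩
      exact hx y.2
    obtain ⟨δ, hδ, hball⟩ := Metric.isOpen_iff.1 hKc.isClosed.isOpen_compl x hxK
    refine ⟨δ, hδ, fun y hy => ?_⟩
    rw [extEntry_of_notMem φ i j hx, Real.dist_eq, sub_zero]
    by_cases hyΩ : y ∈ Ω
    · have hyK : (⟨y, hyΩ⟩ : Ω) ∈ Kᶜ := fun h => hball hy ⟨_, h, rfl⟩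
      have h2 : dist (φ ⟨y, hyΩ⟩) 0 < ε := hKs hyK
      rw [extEntry_coe φ i j ⟨y, hyΩ⟩, ← Real.norm_eq_abs]
      refine (PiLp.norm_apply_le (φ ⟨y, hyΩ⟩).1 (i, j)).trans_lt ?_
      rwa [dist_zero_right] at h2
    · rwa [extEntry_of_notMem φ i j hyΩ, abs_zero]

theorem integrable_extEntry (φ : C₀(Ω, SymMat n)) (i j : Fin n) (Q : Measure (Rn n))
    [IsFiniteMeasure Q] : Integrable (extEntry φ i j) Q :=
  Integrable.of_bound (continuous_extEntry φ i j).aestronglyMeasurable ‖φ‖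
    (Eventually.of_forall fun x => abs_extEntry_le φ i j x)

theorem pairing_eq (h : Represents μ P N) (φ : C₀(Ω, SymMat n)) :
    μ.pairing φ = ∑ i, ∑ j, (∫ x, extEntry φ i j x ∂(P i j) - ∫ x, extEntry φ i j x ∂(N i j)) := by
  have := h.finite_onOpen
  have h_int : Integrable φ (onOpen Ω (totalMeas P N)) :=
    Integrable.of_bound φ.continuous.aestronglyMeasurable ‖φ‖
      (Eventually.of_forall fun x => φ.toBCF.norm_coe_le_norm x)
  rw [MatMeasure.pairing, vectorIntegral_eq_sum (ι := Fin n × Fin n) μ _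
    (fun a => onOpen Ω (P a.1 a.2)) (fun a => onOpen Ω (N a.1 a.2)) (fun a => symEntry a.1 a.2)
    h.variation_le (fun a => onOpen_mono (pos_le_totalMeas P N _ _))
    (fun a => onOpen_mono (neg_le_totalMeas P N _ _)) (fun s hs e => ?_) h_int]
  · rw [Fintype.sum_prod_type]
    refine Finset.sum_congr rfl fun i _ => Finset.sum_congr rfl fun j _ => ?_
    rw [← integral_onOpen (h.pos_compl i j), ← integral_onOpen (h.neg_compl i j)]
    simp only [extEntry_coe, symEntry_apply]
  · rw [innerSL_apply_apply, inner_symMat, Fintype.sum_prod_type]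
    refine Finset.sum_congr rfl fun i _ => Finset.sum_congr rfl fun j _ => ?_
    rw [h.apply s hs, symEntry_apply, onOpen_real, onOpen_real, mul_comm]

end Represents

end Represents

end

noncomputable section

/-! ### Bounded signed densities -/

section Density

variable {X : Type*} [MeasurableSpace X]

theorem isFiniteMeasure_withDensity_of_le {Q : Measure X} [IsFiniteMeasure Q] {g : X → ℝ} {C : ℝ}
    (hg : ∀ᵐ x ∂Q, g x ≤ C) : IsFiniteMeasure (Q.withDensity fun x => ENNReal.ofReal (g x)) := by
  refine isFiniteMeasure_withDensity (ne_of_lt ?_)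
  refine (lintegral_mono_ae (hg.mono fun x hx => ENNReal.ofReal_le_ofReal hx)).trans_lt ?_
  rw [lintegral_const]
  exact ENNReal.mul_lt_top ENNReal.ofReal_lt_top (measure_lt_top _ _)

theorem withDensity_univ_le {Q : Measure X} {g : X → ℝ} {C : ℝ} (hg : ∀ᵐ x ∂Q, g x ≤ C) :
    Q.withDensity (fun x => ENNReal.ofReal (g x)) Set.univ ≤ ENNReal.ofReal C * Q Set.univ := by
  rw [withDensity_apply _ MeasurableSet.univ, Measure.restrict_univ, ← lintegral_const]
  exact lintegral_mono_ae (hg.mono fun x hx => ENNReal.ofReal_le_ofReal hx)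

theorem integral_withDensity_sub {Q : Measure X} [IsFiniteMeasure Q] {g f : X → ℝ}
    (hf : AEStronglyMeasurable f Q) {C D : ℝ} (hfC : ∀ᵐ x ∂Q, |f x| ≤ C)
    (hg : AEStronglyMeasurable g Q) (hgD : ∀ x, |g x| ≤ D) :
    ∫ x, g x ∂(Q.withDensity fun x => ENNReal.ofReal (f x))
      - ∫ x, g x ∂(Q.withDensity fun x => ENNReal.ofReal (-f x)) = ∫ x, g x * f x ∂Q := by
  have hC : ∀ r t : ℝ, |t| ≤ r → |max t 0| ≤ r ∧ |max (-t) 0| ≤ r := fun r t ht => by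
    rw [abs_le] at ht
    rw [abs_of_nonneg (le_max_right _ _), abs_of_nonneg (le_max_right _ _)]
    exact ⟨max_le ht.2 (by linarith [ht.1, ht.2]), max_le (by linarith [ht.1])
      (by linarith [ht.1, ht.2])⟩
  have h_int : ∀ w : X → ℝ, AEStronglyMeasurable w Q → (∀ᵐ x ∂Q, |w x| ≤ C) →
      Integrable (fun x => w x * g x) Q := fun w hw hwC =>
    (Integrable.of_bound hw C hwC).mul_bdd (c := D) hg (Eventually.of_forall hgD)
  have hfn : AEMeasurable (fun x => ENNReal.ofReal (-f x)) Q :=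
    hf.aemeasurable.neg.ennreal_ofReal
  rw [integral_withDensity_eq_integral_toReal_smul₀ hf.aemeasurable.ennreal_ofReal
      (Eventually.of_forall fun x => ENNReal.ofReal_lt_top),
    integral_withDensity_eq_integral_toReal_smul₀ hfn
      (Eventually.of_forall fun x => ENNReal.ofReal_lt_top)]
  simp only [ENNReal.toReal_ofReal', smul_eq_mul]
  rw [← integral_sub]
  · refine integral_congr_ae (Eventually.of_forall fun x => ?_)
    simp only
    rcases le_total 0 (f x) with h | h
    · rw [max_eq_left h, max_eq_right (by linarith)]; ring
    · rw [max_eq_right h, max_eq_left (by linarith)]; ring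
  · exact h_int _ (hf.sup aestronglyMeasurable_const) (hfC.mono fun x hx => (hC C _ hx).1)
  · exact h_int _ (hf.neg.sup aestronglyMeasurable_const) (hfC.mono fun x hx => (hC C _ hx).2)

end Density

/-! ### Jordan parts of the entries, and products with bounded functions -/

section Represents

variable {n : ℕ} {Ω : TopologicalSpace.Opens (Rn n)}

/-- The entry `(i, j)` of a matrix-valued measure. -/
def MatMeasure.entry (μ : MatMeasure Ω) (i j : Fin n) : SignedMeasure Ω :=
  μ.mapRange (symEntry i j).toLinearMap.toAddMonoidHom (symEntry i j).continuous

theorem MatMeasure.entry_apply (μ : MatMeasure Ω) (i j : Fin n) (s : Set Ω) :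
    MatMeasure.entry μ i j s = (μ s).1 (i, j) := rfl

theorem MatMeasure.entry_symm (μ : MatMeasure Ω) (i j : Fin n) :
    MatMeasure.entry μ i j = MatMeasure.entry μ j i := by
  ext s _
  rw [MatMeasure.entry_apply, MatMeasure.entry_apply]
  exact (μ s).2 i j

/-- The positive parts of the entries of a matrix-valued measure. -/
def MatMeasure.pos (μ : MatMeasure Ω) (i j : Fin n) : Measure (Rn n) :=
  (MatMeasure.entry μ i j).toJordanDecomposition.posPart.map Subtype.val

/-- The negative parts of the entries of a matrix-valued measure. -/
def MatMeasure.neg (μ : MatMeasure Ω) (i j : Fin n) : Measure (Rn n) :=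
  (MatMeasure.entry μ i j).toJordanDecomposition.negPart.map Subtype.val

theorem MatMeasure.pos_symm (μ : MatMeasure Ω) (i j : Fin n) :
    MatMeasure.pos μ i j = MatMeasure.pos μ j i := by
  rw [MatMeasure.pos, MatMeasure.entry_symm, MatMeasure.pos]

theorem MatMeasure.neg_symm (μ : MatMeasure Ω) (i j : Fin n) :
    MatMeasure.neg μ i j = MatMeasure.neg μ j i := by
  rw [MatMeasure.neg, MatMeasure.entry_symm, MatMeasure.neg]

theorem MatMeasure.pos_mutuallySingular_neg (μ : MatMeasure Ω) (i j : Fin n) :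
    MatMeasure.pos μ i j ⟂ₘ MatMeasure.neg μ i j := by
  have hme := measurableEmbedding_coe Ω
  obtain ⟨s, hs, h1, h2⟩ := (MatMeasure.entry μ i j).toJordanDecomposition.mutuallySingular
  refine ⟨Subtype.val '' s, hme.measurableSet_image.2 hs, ?_, ?_⟩
  · rw [MatMeasure.pos, hme.map_apply, Set.preimage_image_eq _ Subtype.val_injective, h1]
  · rw [MatMeasure.neg, hme.map_apply, Set.preimage_compl,
      Set.preimage_image_eq _ Subtype.val_injective, h2]

theorem MatMeasure.represents (μ : MatMeasure Ω) :
    Represents μ (MatMeasure.pos μ) (MatMeasure.neg μ) := by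
  have hme := measurableEmbedding_coe Ω
  have hcompl : (Subtype.val : Ω → Rn n) ⁻¹' (Ω : Set (Rn n))ᶜ = ∅ := by
    ext x; simp
  refine ⟨fun i j => ?_, fun i j => ?_, fun i j => ?_, fun i j => ?_, fun s hs i j => ?_⟩
  · rw [MatMeasure.pos]; infer_instance
  · rw [MatMeasure.neg]; infer_instance
  · rw [MatMeasure.pos, hme.map_apply, hcompl, measure_empty]
  · rw [MatMeasure.neg, hme.map_apply, hcompl, measure_empty]
  · rw [← MatMeasure.entry_apply, SignedMeasure.apply_eq_posPart_real_sub_negPart_real _ hs]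
    simp only [Measure.real, MatMeasure.pos, MatMeasure.neg, hme.map_apply,
      Set.preimage_image_eq _ Subtype.val_injective]

/-- The families of measures representing the product of a function with a measure represented by
`P` and `N`; `Represents.mulFn` holds for `mulPos f P N` and `mulPos f N P`. -/
def mulPos (f : Rn n → ℝ) (P N : Fin n → Fin n → Measure (Rn n)) (i j : Fin n) : Measure (Rn n) :=
  (P i j).withDensity (fun x => ENNReal.ofReal (f x))
    + (N i j).withDensity (fun x => ENNReal.ofReal (-f x))

/-- Sign bookkeeping: `f (P - N) = (f⁺ P + f⁻ N) - (f⁺ N + f⁻ P)`, where both brackets are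
nonnegative. -/
theorem integral_mulPos_sub {P N : Fin n → Fin n → Measure (Rn n)} {i j : Fin n}
    [IsFiniteMeasure (P i j)] [IsFiniteMeasure (N i j)] {f g : Rn n → ℝ} {C D : ℝ}
    (hf : AEStronglyMeasurable f (totalMeas P N)) (hfC : ∀ᵐ x ∂(totalMeas P N), |f x| ≤ C)
    (hg : StronglyMeasurable g) (hgD : ∀ x, |g x| ≤ D) :
    ∫ x, g x ∂(mulPos f P N i j) - ∫ x, g x ∂(mulPos f N P i j)
      = ∫ x, g x * f x ∂(P i j) - ∫ x, g x * f x ∂(N i j) := by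
  have hfP := hf.mono_measure (pos_le_totalMeas P N i j)
  have hfN := hf.mono_measure (neg_le_totalMeas P N i j)
  have hCP : ∀ᵐ x ∂(P i j), |f x| ≤ C := ae_mono (pos_le_totalMeas P N i j) hfC
  have hCN : ∀ᵐ x ∂(N i j), |f x| ≤ C := ae_mono (neg_le_totalMeas P N i j) hfC
  have f1 := isFiniteMeasure_withDensity_of_le (hCP.mono fun x hx => (le_abs_self _).trans hx)
  have f2 := isFiniteMeasure_withDensity_of_le (hCN.mono fun x hx => (le_abs_self _).trans hx)
  have f3 := isFiniteMeasure_withDensity_of_le (hCP.mono fun x hx => (neg_le_abs _).trans hx)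
  have f4 := isFiniteMeasure_withDensity_of_le (hCN.mono fun x hx => (neg_le_abs _).trans hx)
  have h_int : ∀ (Q : Measure (Rn n)) [IsFiniteMeasure Q], Integrable g Q := fun Q _ =>
    Integrable.of_bound hg.aestronglyMeasurable D (Eventually.of_forall hgD)
  rw [mulPos, mulPos, integral_add_measure (h_int _) (h_int _),
    integral_add_measure (h_int _) (h_int _),
    ← integral_withDensity_sub hfP hCP hg.aestronglyMeasurable hgD,
    ← integral_withDensity_sub hfN hCN hg.aestronglyMeasurable hgD]
  ring

theorem mulPos_univ_le {P N : Fin n → Fin n → Measure (Rn n)} {i j : Fin n} {f : Rn n → ℝ} {C : ℝ}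
    (hP : ∀ᵐ x ∂(P i j), |f x| ≤ C) (hN : ∀ᵐ x ∂(N i j), |f x| ≤ C) :
    mulPos f P N i j Set.univ ≤ ENNReal.ofReal C * (P i j Set.univ + N i j Set.univ) := by
  rw [mulPos, Measure.add_apply, mul_add]
  exact add_le_add (withDensity_univ_le (hP.mono fun x hx => (le_abs_self _).trans hx))
    (withDensity_univ_le (hN.mono fun x hx => (neg_le_abs _).trans hx))

theorem mulPos_compl {P N : Fin n → Fin n → Measure (Rn n)} {i j : Fin n} {f : Rn n → ℝ}
    {s : Set (Rn n)} (hP : P i j s = 0) (hN : N i j s = 0) : mulPos f P N i j s = 0 := by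
  rw [mulPos, Measure.add_apply, withDensity_absolutelyContinuous _ _ hP,
    withDensity_absolutelyContinuous _ _ hN, add_zero]

theorem Represents.mulFn {μ : MatMeasure Ω} {P N : Fin n → Fin n → Measure (Rn n)}
    (h : Represents μ P N) {f : Rn n → ℝ} {C : ℝ}
    (hf : AEStronglyMeasurable f (totalMeas P N)) (hfC : ∀ᵐ x ∂(totalMeas P N), |f x| ≤ C) :
    Represents (MatMeasure.mulFn f μ) (mulPos f P N) (mulPos f N P) := by
  have hfp := h.finite_pos
  have hfn := h.finite_neg
  have hft := h.finite_total
  have hCP : ∀ i j, ∀ᵐ x ∂(P i j), |f x| ≤ C := fun i j => ae_mono (pos_le_totalMeas P N i j) hfC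
  have hCN : ∀ i j, ∀ᵐ x ∂(N i j), |f x| ≤ C := fun i j => ae_mono (neg_le_totalMeas P N i j) hfC
  have hfin1 : ∀ i j, IsFiniteMeasure (mulPos f P N i j) := fun i j =>
    ⟨(mulPos_univ_le (hCP i j) (hCN i j)).trans_lt (ENNReal.mul_lt_top ENNReal.ofReal_lt_top
      (ENNReal.add_lt_top.2 ⟨measure_lt_top _ _, measure_lt_top _ _⟩))⟩
  have hfin2 : ∀ i j, IsFiniteMeasure (mulPos f N P i j) := fun i j =>
    ⟨(mulPos_univ_le (hCN i j) (hCP i j)).trans_lt (ENNReal.mul_lt_top ENNReal.ofReal_lt_top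
      (ENNReal.add_lt_top.2 ⟨measure_lt_top _ _, measure_lt_top _ _⟩))⟩
  refine ⟨hfin1, hfin2, fun i j => mulPos_compl (h.pos_compl i j) (h.neg_compl i j),
    fun i j => mulPos_compl (h.neg_compl i j) (h.pos_compl i j), fun s hs i j => ?_⟩
  have hme := measurableEmbedding_coe Ω
  have hs' : MeasurableSet (Subtype.val '' s : Set (Rn n)) := hme.measurableSet_image.2 hs
  have hfi : Integrable f (totalMeas P N) := Integrable.of_bound hf C hfC
  have hind : (s.indicator fun x : Ω => f x)
      = fun x : Ω => (Subtype.val '' s : Set (Rn n)).indicator f x := by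
    funext x
    by_cases hx : x ∈ s
    · rw [Set.indicator_of_mem hx, Set.indicator_of_mem (Set.mem_image_of_mem _ hx)]
    · rw [Set.indicator_of_notMem hx, Set.indicator_of_notMem]
      rintro ⟨y, hy, hyx⟩
      exact hx (Subtype.val_injective hyx ▸ hy)
  rw [MatMeasure.mulFn, VectorMeasure.withDensity_apply (h.integrable hfi),
    ← VectorMeasure.integral_indicator hs, hind, h.integral_apply (hfi.indicator hs')]
  have key := integral_mulPos_sub (P := P) (N := N) (i := i) (j := j) hf hfC
    (g := (Subtype.val '' s : Set (Rn n)).indicator fun _ => (1 : ℝ)) (D := 1)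
    (stronglyMeasurable_const.indicator hs') (fun x => by
      by_cases hx : x ∈ (Subtype.val '' s : Set (Rn n)) <;> simp [hx])
  have e1 : ∀ x, (Subtype.val '' s : Set (Rn n)).indicator (fun _ => (1 : ℝ)) x * f x
      = (Subtype.val '' s : Set (Rn n)).indicator f x := fun x => by
    by_cases hx : x ∈ (Subtype.val '' s : Set (Rn n)) <;> simp [hx]
  simp only [e1, integral_indicator_const _ hs', smul_eq_mul, mul_one] at key
  exact key.symm

/-- The symmetric matrix with entries `1 / 2` at `(i, j)` and `(j, i)` (and `1` if `i = j`). -/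
def symUnit (i j : Fin n) : SymMat n :=
  ⟨(1 / 2 : ℝ) • (EuclideanSpace.single (i, j) 1 + EuclideanSpace.single (j, i) 1), fun k l => by
    simp only [PiLp.smul_apply, PiLp.add_apply, EuclideanSpace.single, PiLp.single_apply,
      Prod.mk.injEq, smul_eq_mul]
    rw [add_comm]
    congr 2 <;> simp [and_comm]⟩

theorem symUnit_apply (i j k l : Fin n) :
    (symUnit i j).1 (k, l) = (1 / 2 : ℝ) * ((if (k, l) = (i, j) then 1 else 0)
      + if (l, k) = (i, j) then 1 else 0) := by
  simp only [symUnit, PiLp.smul_apply, PiLp.add_apply, EuclideanSpace.single, PiLp.single_apply,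
    Prod.mk.injEq, smul_eq_mul]
  congr 3
  simp [and_comm]

/-- For symmetric `D` the average of the entries `(i, j)` and `(j, i)` is `D i j`. Thus `symUnit`
reads off entries and rebuilds matrices while staying within symmetric ones. -/
theorem sum_mul_symUnit {D : Fin n → Fin n → ℝ} (hD : ∀ i j, D i j = D j i) (i j : Fin n) :
    ∑ k, ∑ l, D k l * (symUnit i j).1 (k, l) = D i j := by
  have : ∀ k l, D k l * (symUnit i j).1 (k, l)
      = (if (i, j) = (k, l) then D k l / 2 else 0) + if (j, i) = (k, l) then D k l / 2 else 0 := by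
    intro k l
    rw [symUnit_apply]
    simp only [Prod.mk.injEq]
    by_cases h1 : i = k <;> by_cases h2 : j = l <;> by_cases h3 : j = k <;> by_cases h4 : i = l <;>
      simp [h1, h2, h3, h4, eq_comm] <;> grind
  have hsum : ∀ a : Fin n × Fin n, ∑ k, ∑ l, (if a = (k, l) then D k l / 2 else 0)
      = D a.1 a.2 / 2 := fun a => by
    rw [← Fintype.sum_prod_type' (f := fun k l => if a = (k, l) then D k l / 2 else 0)]
    simp
  rw [Finset.sum_congr rfl fun k _ => Finset.sum_congr rfl fun l _ => this k l]
  simp only [Finset.sum_add_distrib]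
  rw [hsum, hsum, hD j i]
  ring

/-- The matrix-valued measure with given entries. -/
def MatMeasure.ofMeasures (Ω : TopologicalSpace.Opens (Rn n))
    (P N : Fin n → Fin n → Measure (Rn n)) [∀ i j, IsFiniteMeasure (onOpen Ω (P i j))]
    [∀ i j, IsFiniteMeasure (onOpen Ω (N i j))] : MatMeasure Ω :=
  ∑ i, ∑ j, ((onOpen Ω (P i j)).toSignedMeasure - (onOpen Ω (N i j)).toSignedMeasure).mapRange
    (ContinuousLinearMap.toSpanSingleton ℝ (symUnit i j)).toLinearMap.toAddMonoidHom
    (ContinuousLinearMap.toSpanSingleton ℝ (symUnit i j)).continuous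

theorem isFiniteMeasure_onOpen (Q : Measure (Rn n)) [IsFiniteMeasure Q] :
    IsFiniteMeasure (onOpen Ω Q) :=
  ⟨by rw [onOpen_apply]; exact measure_lt_top _ _⟩

theorem exists_represents {P N : Fin n → Fin n → Measure (Rn n)}
    (hP : ∀ i j, IsFiniteMeasure (P i j)) (hN : ∀ i j, IsFiniteMeasure (N i j))
    (hPΩ : ∀ i j, P i j (Ω : Set (Rn n))ᶜ = 0) (hNΩ : ∀ i j, N i j (Ω : Set (Rn n))ᶜ = 0)
    (hPs : ∀ i j, P i j = P j i) (hNs : ∀ i j, N i j = N j i) :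
    ∃ μ : MatMeasure Ω, Represents μ P N := by
  have h1 : ∀ i j, IsFiniteMeasure (onOpen Ω (P i j)) := fun i j => isFiniteMeasure_onOpen _
  have h2 : ∀ i j, IsFiniteMeasure (onOpen Ω (N i j)) := fun i j => isFiniteMeasure_onOpen _
  refine ⟨MatMeasure.ofMeasures Ω P N, hP, hN, hPΩ, hNΩ, fun s hs k l => ?_⟩
  have hval : (MatMeasure.ofMeasures Ω P N s).1 (k, l)
      = ∑ i, ∑ j, ((P i j).real (Subtype.val '' s) - (N i j).real (Subtype.val '' s))
        * (symUnit i j).1 (k, l) := by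
    rw [MatMeasure.ofMeasures, ← symEntry_apply]
    simp only [FunLike.coe_sum, Finset.sum_apply, map_sum]
    refine Finset.sum_congr rfl fun i _ => Finset.sum_congr rfl fun j _ => ?_
    simp [Measure.toSignedMeasure_apply_measurable hs, onOpen_real]
  have hval' : ∀ i j, (symUnit i j).1 (k, l) = (symUnit k l).1 (i, j) := fun i j => by
    simp only [symUnit_apply, Prod.mk.injEq]
    grind
  simp only [hval, hval']
  exact sum_mul_symUnit (D := fun i j => (P i j).real (Subtype.val '' s)
    - (N i j).real (Subtype.val '' s)) (fun i j => by simp only [hPs i j, hNs i j]) k l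

theorem BD.symGradData (u : BD Ω) {P N : Fin n → Fin n → Measure (Rn n)}
    (h : Represents (BD.E u) P N) :
    SymGradData Ω ((u : Lp (Rn n) 1 (volOn Ω)) : Rn n → Rn n) P N where
  measurable := Lp.stronglyMeasurable _
  integrable := L1.integrable_coeFn _
  finite_pos := h.finite_pos
  finite_neg := h.finite_neg
  eq φ i j := by
    have := h.finite_total
    rw [← BD.hasSymGrad_E u φ i j, h.integral_apply]
    obtain ⟨C, hC⟩ := φ.continuous.bounded_above_of_compact_support φ.hasCompactSupport
    exact Integrable.of_bound φ.continuous.aestronglyMeasurable C (Eventually.of_forall hC)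

end Represents

end

noncomputable section

/-! ### Weak* compactness of bounded families of measures -/

section Compactness

variable {n : ℕ} {Ω : TopologicalSpace.Opens (Rn n)}

theorem exists_notMem_of_isBounded [n.AtLeastTwo] (hΩ : Bornology.IsBounded (Ω : Set (Rn n))) :
    ∃ x : Rn n, x ∉ Ω := by
  have : NeZero n := neZero_dim n
  by_contra! h
  exact NoncompactSpace.noncompact_univ (X := Rn n)
    (Metric.isCompact_of_isClosed_isBounded isClosed_univ (hΩ.subset fun x _ => h x))

/-- Completion of a measure of mass at most `C` to a probability measure by an atom. -/
def normalizeAt (C : ℝ≥0) (x₀ : Rn n) (μ : Measure (Rn n)) : Measure (Rn n) :=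
  (C : ℝ≥0∞)⁻¹ • (μ + ((C : ℝ≥0∞) - μ Set.univ) • Measure.dirac x₀)

theorem isProbabilityMeasure_normalizeAt {C : ℝ≥0} (hC : C ≠ 0) (x₀ : Rn n) {μ : Measure (Rn n)}
    (hμ : μ Set.univ ≤ C) : IsProbabilityMeasure (normalizeAt C x₀ μ) := ⟨by
  simp only [normalizeAt, Measure.smul_apply, Measure.add_apply, smul_eq_mul, measure_univ, mul_one]
  rw [add_tsub_cancel_of_le hμ]
  exact ENNReal.inv_mul_cancel (by exact_mod_cast hC) ENNReal.coe_ne_top⟩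

theorem integral_normalizeAt {C : ℝ≥0} (hC : C ≠ 0) {x₀ : Rn n} {μ : Measure (Rn n)}
    (hμ : μ Set.univ ≤ C) {φ : Rn n → ℝ} (hφ : Continuous φ) {D : ℝ} (hD : ∀ x, |φ x| ≤ D)
    (h0 : φ x₀ = 0) :
    ∫ x, φ x ∂μ = C * ∫ x, φ x ∂(normalizeAt C x₀ μ) := by
  have hfin : IsFiniteMeasure μ := ⟨hμ.trans_lt ENNReal.coe_lt_top⟩
  have hfin' : IsFiniteMeasure (((C : ℝ≥0∞) - μ Set.univ) • Measure.dirac x₀) :=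
    Measure.smul_finite _ (ENNReal.sub_ne_top ENNReal.coe_ne_top)
  have hi : ∀ ν : Measure (Rn n), IsFiniteMeasure ν → Integrable φ ν := fun ν _ =>
    Integrable.of_bound hφ.aestronglyMeasurable D (Eventually.of_forall hD)
  rw [normalizeAt, integral_smul_measure, integral_add_measure (hi _ hfin) (hi _ hfin'),
    integral_smul_measure, integral_dirac, h0, smul_zero, add_zero, ENNReal.toReal_inv,
    ENNReal.coe_toReal, smul_eq_mul, mul_inv_cancel_left₀ (by exact_mod_cast hC)]

/-- Weak* compactness of bounded families of measures on a bounded open set. -/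
theorem exists_subseq_tendsto_integral [n.AtLeastTwo] {ι : Type*} [Fintype ι]
    (hΩ : Bornology.IsBounded (Ω : Set (Rn n))) {μ : ℕ → ι → Measure (Rn n)} {C : ℝ≥0}
    (hμ : ∀ k i, μ k i Set.univ ≤ C) (hμΩ : ∀ k i, μ k i (Ω : Set (Rn n))ᶜ = 0) :
    ∃ s : ℕ → ℕ, StrictMono s ∧ ∃ L : ι → Measure (Rn n), (∀ i, IsFiniteMeasure (L i)) ∧
      (∀ i, L i (Ω : Set (Rn n))ᶜ = 0) ∧ ∀ i (φ : Rn n → ℝ), Continuous φ →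
        (∃ D, ∀ x, |φ x| ≤ D) → (∀ x, x ∉ Ω → φ x = 0) →
        Tendsto (fun k => ∫ x, φ x ∂(μ (s k) i)) atTop (𝓝 (∫ x, φ x ∂(L i))) := by
  -- The mass missing from a probability measure is placed outside `Ω`, where the test functions
  -- vanish.
  obtain ⟨x₀, hx₀⟩ := exists_notMem_of_isBounded hΩ
  -- Increasing the bound by one keeps the normalising factor nonzero when `C = 0`.
  obtain ⟨B, hB, hCB⟩ : ∃ B : ℝ≥0, B ≠ 0 ∧ C ≤ B := ⟨C + 1, by positivity, by simp⟩
  have hμ' : ∀ k i, μ k i Set.univ ≤ B := fun k i => (hμ k i).trans (by exact_mod_cast hCB)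
  -- All the normalised measures are carried by this compact set, so tightness is immediate.
  set K : Set (Rn n) := closure Ω ∪ {x₀} with hK
  have hKc : IsCompact K := hΩ.isCompact_closure.union isCompact_singleton
  let S : Set (ProbabilityMeasure (Rn n)) :=
    {ν | ∀ m : ℕ, ν ((fun _ : ℕ => K) m)ᶜ ≤ (fun _ : ℕ => (0 : ℝ≥0)) m}
  have hS : IsCompact S := isCompact_setOfPred_probabilityMeasure_mass_eq_compl_isCompact_le
    tendsto_const_nhds (fun _ => hKc) (Or.inl inferInstance)
  let ν : ℕ → ι → ProbabilityMeasure (Rn n) := fun k i =>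
    ⟨normalizeAt B x₀ (μ k i), isProbabilityMeasure_normalizeAt hB x₀ (hμ' k i)⟩
  have hν : ∀ k, ν k ∈ Set.univ.pi fun _ : ι => S := by
    intro k i _ m
    have h0 : normalizeAt B x₀ (μ k i) Kᶜ = 0 := by
      have h1 : μ k i Kᶜ = 0 := measure_mono_null (Set.compl_subset_compl.2
        (subset_closure.trans Set.subset_union_left)) (hμΩ k i)
      have h2 : x₀ ∈ K := Or.inr rfl
      simp [normalizeAt, h1, h2]
    exact (ProbabilityMeasure.null_iff_toMeasure_null _ _).2 h0 |>.le
  obtain ⟨L, -, s, hs, hL⟩ := (isCompact_univ_pi fun _ : ι => hS).tendsto_subseq hν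
  rw [tendsto_pi_nhds] at hL
  -- Restricting the limit to `Ω` discards the mass that has reached the boundary or sits at `x₀`;
  -- test functions do not see it.
  refine ⟨s, hs, fun i => (B : ℝ≥0∞) • (L i : Measure (Rn n)).restrict Ω, fun i =>
    Measure.smul_finite _ ENNReal.coe_ne_top, fun i => by
      simp [Measure.restrict_apply Ω.isOpen.measurableSet.compl], fun i φ hφ ⟨D, hD⟩ h0 => ?_⟩
  have hlim := (ProbabilityMeasure.tendsto_iff_forall_integral_tendsto.1 (hL i))
    (BoundedContinuousFunction.ofNormedAddCommGroup φ hφ D hD)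
  simp only [integral_normalizeAt hB (hμ' _ i) hφ hD (h0 x₀ hx₀)]
  rw [integral_smul_measure, setIntegral_eq_integral_of_forall_compl_eq_zero fun x hx => h0 x hx]
  exact hlim.const_mul (B : ℝ)

end Compactness

/-! ### Uniform bounds from weak and weak* convergence -/

section Bounds

variable {n : ℕ} {Ω : TopologicalSpace.Opens (Rn n)}

/-- A cutoff equal to one on a compact set carrying almost all of `P`, and supported where `N` is
small, isolates `P` from the signed difference. -/
theorem measure_univ_le_of_forall_test {P N : Measure (Rn n)} [IsFiniteMeasure P]
    [IsFiniteMeasure N] (hPN : P ⟂ₘ N) (hP : P (Ω : Set (Rn n))ᶜ = 0) {B : ℝ}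
    (hB : ∀ χ : 𝓓(Ω, ℝ), (∀ x, 0 ≤ χ x ∧ χ x ≤ 1) → ∫ x, χ x ∂P - ∫ x, χ x ∂N ≤ B) :
    P.real Set.univ ≤ B := by
  obtain ⟨A, hA, hPA, hNA⟩ := hPN
  refine le_of_forall_pos_le_add fun ε hε => ?_
  have hε2 : (0 : ℝ) < ε / 2 := by positivity
  have hm : MeasurableSet (Aᶜ ∩ (Ω : Set (Rn n))) := hA.compl.inter Ω.isOpen.measurableSet
  obtain ⟨K, hKA, hK, hPK⟩ := hm.exists_isCompact_sdiff_lt (μ := P) (measure_ne_top _ _)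
    (ε := ENNReal.ofReal (ε / 2)) (by simpa using hε)
  have hNK : N K = 0 := measure_mono_null (hKA.trans Set.inter_subset_left) hNA
  obtain ⟨O, hKO, hO, hNO⟩ := K.exists_isOpen_lt_of_lt (μ := N) (ENNReal.ofReal (ε / 2))
    (by rw [hNK]; simpa using hε)
  obtain ⟨χ, hχ1, hχ, hχO⟩ := exists_testFunction_one (Ω := Ω) hK (hO.inter Ω.isOpen)
    (Set.subset_inter hKO (hKA.trans Set.inter_subset_right)) Set.inter_subset_right
  have h_int : ∀ μ : Measure (Rn n), IsFiniteMeasure μ → Integrable χ μ := fun μ _ =>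
    Integrable.of_bound χ.continuous.aestronglyMeasurable 1 (Eventually.of_forall fun x => by
      rw [Real.norm_of_nonneg (hχ x).1]; exact (hχ x).2)
  have h1 : P.real K ≤ ∫ x, χ x ∂P := by
    rw [← integral_indicator_one hK.measurableSet]
    refine integral_mono ((integrable_const (1 : ℝ)).indicator hK.measurableSet) (h_int P ‹_›)
      fun x => ?_
    by_cases hx : x ∈ K
    · simp [hx, hχ1 x hx]
    · simpa [hx] using (hχ x).1
  have h2 : ∫ x, χ x ∂N ≤ ε / 2 := by
    have : ∫ x, χ x ∂N ≤ N.real O := by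
      rw [← integral_indicator_one hO.measurableSet]
      refine integral_mono (h_int N ‹_›) ((integrable_const (1 : ℝ)).indicator hO.measurableSet)
        fun x => ?_
      by_cases hx : x ∈ O
      · simpa [hx] using (hχ x).2
      · simp [hx, image_eq_zero_of_notMem_tsupport fun h => hx (hχO h).1]
    refine this.trans ?_
    rw [measureReal_def]
    exact ENNReal.toReal_le_of_le_ofReal hε2.le hNO.le
  have h3 : P.real Set.univ ≤ P.real K + ε / 2 := by
    have hsub : P Set.univ ≤ P K + P ((Aᶜ ∩ (Ω : Set (Rn n))) \ K) := by
      rw [← measure_add_measure_compl hm]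
      have hz : P (Aᶜ ∩ (Ω : Set (Rn n)))ᶜ = 0 := by
        rw [Set.compl_inter, compl_compl]
        exact measure_union_null hPA hP
      rw [hz, add_zero]
      calc P (Aᶜ ∩ (Ω : Set (Rn n))) ≤ P (K ∪ (Aᶜ ∩ (Ω : Set (Rn n))) \ K) :=
            measure_mono (by rw [Set.union_sdiff_self]; exact Set.subset_union_right)
        _ ≤ _ := measure_union_le _ _
    rw [measureReal_def, measureReal_def]
    refine ENNReal.toReal_le_of_le_ofReal (by positivity) ?_
    rw [ENNReal.ofReal_add (by positivity) hε2.le, ENNReal.ofReal_toReal (measure_ne_top _ _)]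
    exact hsub.trans (by gcongr)
  linarith [hB χ hχ]

theorem WeakConvW1p.tendsto {p : ℝ≥0∞} [Fact (1 ≤ p)] {a : ℕ → W1p Ω p} {b : W1p Ω p}
    (h : WeakConvW1p a b) (f : StrongDual ℝ (W1p Ω p)) :
    Tendsto (fun k => f (a k)) atTop (𝓝 (f b)) :=
  ((WeakBilin.eval_continuous _ f).tendsto _).comp h

theorem exists_norm_le_of_tendsto {f : ℕ → ℝ} {b : ℝ} (h : Tendsto f atTop (𝓝 b)) :
    ∃ C, ∀ k, ‖f k‖ ≤ C := by
  obtain ⟨C, hC⟩ := h.norm.bddAbove_range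
  exact ⟨C, fun k => hC ⟨k, rfl⟩⟩

/-- A weakly convergent sequence in `W^{1,p}` is bounded. -/
theorem WeakConvW1p.exists_norm_le {p : ℝ≥0∞} [Fact (1 ≤ p)] {a : ℕ → W1p Ω p} {b : W1p Ω p}
    (h : WeakConvW1p a b) : ∃ C, ∀ k, ‖a k‖ ≤ C := by
  obtain ⟨C, hC⟩ := banach_steinhaus
    (g := fun k => NormedSpace.inclusionInDoubleDual ℝ (W1p Ω p) (a k)) fun f =>
      exists_norm_le_of_tendsto (h.tendsto f)
  refine ⟨C, fun k => ?_⟩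
  have := hC k
  exact ((NormedSpace.inclusionInDoubleDualLi ℝ (E := W1p Ω p)).norm_map (a k)).symm.le.trans this

theorem Represents.extEntry_add (φ ψ : C₀(Ω, SymMat n)) (i j : Fin n) (x : Rn n) :
    extEntry (φ + ψ) i j x = extEntry φ i j x + extEntry ψ i j x := by
  by_cases hx : x ∈ Ω
  · rw [extEntry_coe _ i j ⟨x, hx⟩, extEntry_coe φ i j ⟨x, hx⟩, extEntry_coe ψ i j ⟨x, hx⟩]
    rfl
  · simp only [extEntry_of_notMem _ _ _ hx, add_zero]

theorem Represents.extEntry_smul (c : ℝ) (φ : C₀(Ω, SymMat n)) (i j : Fin n) (x : Rn n) :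
    extEntry (c • φ) i j x = c * extEntry φ i j x := by
  by_cases hx : x ∈ Ω
  · rw [extEntry_coe _ i j ⟨x, hx⟩, extEntry_coe φ i j ⟨x, hx⟩]
    rfl
  · simp only [extEntry_of_notMem _ _ _ hx, mul_zero]

/-- Places the measure in the dual of the Banach space `C₀`, so that the uniform boundedness
principle applies to weak* convergent sequences. -/
theorem Represents.exists_clm {μ : MatMeasure Ω} {P N : Fin n → Fin n → Measure (Rn n)}
    (h : Represents μ P N) : ∃ T : C₀(Ω, SymMat n) →L[ℝ] ℝ, ∀ φ, T φ = μ.pairing φ := by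
  have hP := h.finite_pos
  have hN := h.finite_neg
  have hi : ∀ (φ : C₀(Ω, SymMat n)) i j (Q : Measure (Rn n)), IsFiniteMeasure Q →
      Integrable (extEntry φ i j) Q := fun φ i j Q _ => integrable_extEntry φ i j Q
  let T : C₀(Ω, SymMat n) →ₗ[ℝ] ℝ :=
    { toFun := fun φ => μ.pairing φ
      map_add' := fun φ ψ => by
        simp only [h.pairing_eq, extEntry_add, ← Finset.sum_add_distrib]
        refine Finset.sum_congr rfl fun i _ => Finset.sum_congr rfl fun j _ => ?_
        rw [integral_add (hi _ _ _ _ (hP i j)) (hi _ _ _ _ (hP i j)),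
          integral_add (hi _ _ _ _ (hN i j)) (hi _ _ _ _ (hN i j))]
        ring
      map_smul' := fun c φ => by
        simp only [h.pairing_eq, extEntry_smul, integral_const_mul, RingHom.id_apply, smul_eq_mul,
          Finset.mul_sum, mul_sub] }
  refine ⟨T.mkContinuous (∑ i, ∑ j, ((P i j).real Set.univ + (N i j).real Set.univ)) fun φ => ?_,
    fun φ => rfl⟩
  change |μ.pairing φ| ≤ _
  rw [h.pairing_eq, Finset.sum_mul]
  refine (Finset.abs_sum_le_sum_abs _ _).trans (Finset.sum_le_sum fun i _ => ?_)
  rw [Finset.sum_mul]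
  refine (Finset.abs_sum_le_sum_abs _ _).trans (Finset.sum_le_sum fun j _ => ?_)
  have hb : ∀ (Q : Measure (Rn n)), IsFiniteMeasure Q →
      |∫ x, extEntry φ i j x ∂Q| ≤ Q.real Set.univ * ‖φ‖ := fun Q _ => by
    rw [mul_comm]
    exact norm_integral_le_of_norm_le_const (f := extEntry φ i j)
      (Eventually.of_forall (abs_extEntry_le φ i j))
  refine (abs_sub _ _).trans ?_
  rw [add_mul]
  exact add_le_add (hb _ (hP i j)) (hb _ (hN i j))

/-- The field `χ symUnit i j` of symmetric matrices. -/
def testMat (χ : 𝓓(Ω, ℝ)) (i j : Fin n) : C₀(Ω, SymMat n) where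
  toFun := fun x => χ x • symUnit i j
  continuous_toFun := (χ.continuous.comp continuous_subtype_val).smul continuous_const
  zero_at_infty' := by
    refine HasCompactSupport.is_zero_at_infty (α := Ω)
      (HasCompactSupport.intro (K := Subtype.val ⁻¹' tsupport χ) ?_ fun x hx => ?_)
    · refine Topology.IsInducing.subtypeVal.isCompact_preimage' χ.hasCompactSupport ?_
      rw [Subtype.range_coe]
      exact χ.tsupport_subset
    · rw [image_eq_zero_of_notMem_tsupport hx, zero_smul]

theorem extEntry_testMat (χ : 𝓓(Ω, ℝ)) (i j k l : Fin n) (x : Rn n) :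
    Represents.extEntry (testMat χ i j) k l x = χ x * (symUnit i j).1 (k, l) := by
  by_cases hx : x ∈ Ω
  · rw [Represents.extEntry_coe _ k l ⟨x, hx⟩]
    rfl
  · rw [Represents.extEntry_of_notMem _ k l hx,
      image_eq_zero_of_notMem_tsupport fun h => hx (χ.tsupport_subset h), zero_mul]

theorem norm_testMat_le {χ : 𝓓(Ω, ℝ)} (hχ : ∀ x, 0 ≤ χ x ∧ χ x ≤ 1) (i j : Fin n) :
    ‖testMat χ i j‖ ≤ ‖symUnit i j‖ := by
  rw [← ZeroAtInftyContinuousMap.norm_toBCF_eq_norm,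
    BoundedContinuousFunction.norm_le (norm_nonneg _)]
  intro x
  change ‖χ x • symUnit i j‖ ≤ _
  rw [norm_smul, Real.norm_of_nonneg (hχ x).1]
  exact mul_le_of_le_one_left (norm_nonneg _) (hχ x).2

theorem Represents.pairing_testMat {μ : MatMeasure Ω} {P N : Fin n → Fin n → Measure (Rn n)}
    (h : Represents μ P N) (hP : ∀ i j, P i j = P j i) (hN : ∀ i j, N i j = N j i)
    (χ : 𝓓(Ω, ℝ)) (i j : Fin n) :
    μ.pairing (testMat χ i j) = ∫ x, χ x ∂(P i j) - ∫ x, χ x ∂(N i j) := by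
  rw [h.pairing_eq]
  simp only [extEntry_testMat, integral_mul_const, ← sub_mul]
  exact sum_mul_symUnit (D := fun i j => ∫ x, χ x ∂(P i j) - ∫ x, χ x ∂(N i j))
    (fun i j => by simp only [hP i j, hN i j]) i j

/-- Weakly* convergent sequences of measures are bounded. -/
theorem MatMeasure.WeakStarConv.exists_bound {μ : ℕ → MatMeasure Ω} {ν : MatMeasure Ω}
    (h : MatMeasure.WeakStarConv μ ν) : ∃ C : ℝ≥0, ∀ k i j,
      MatMeasure.pos (μ k) i j Set.univ ≤ C ∧ MatMeasure.neg (μ k) i j Set.univ ≤ C := by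
  choose T hT using fun k => (MatMeasure.represents (μ k)).exists_clm
  obtain ⟨C, hC⟩ := banach_steinhaus (g := T) fun φ => by
    simp only [hT]
    exact exists_norm_le_of_tendsto (h φ)
  have hC0 : 0 ≤ C := (norm_nonneg _).trans (hC 0)
  have hb : ∀ k i j (χ : 𝓓(Ω, ℝ)), (∀ x, 0 ≤ χ x ∧ χ x ≤ 1) →
      |∫ x, χ x ∂(MatMeasure.pos (μ k) i j) - ∫ x, χ x ∂(MatMeasure.neg (μ k) i j)|
        ≤ C * ∑ i : Fin n, ∑ j : Fin n, ‖symUnit i j‖ := fun k i j χ hχ => by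
    rw [← (MatMeasure.represents (μ k)).pairing_testMat (MatMeasure.pos_symm _)
      (MatMeasure.neg_symm _), ← hT]
    refine ((T k).le_opNorm _).trans (mul_le_mul (hC k) ?_ (norm_nonneg _) hC0)
    refine (norm_testMat_le hχ i j).trans ?_
    refine le_trans ?_ (Finset.single_le_sum (f := fun i => ∑ j, ‖symUnit i j‖)
      (fun i _ => Finset.sum_nonneg fun j _ => norm_nonneg _) (Finset.mem_univ i))
    exact Finset.single_le_sum (f := fun j => ‖symUnit i j‖) (fun j _ => norm_nonneg _)
      (Finset.mem_univ j)
  have hS : 0 ≤ C * ∑ i : Fin n, ∑ j : Fin n, ‖symUnit i j‖ := by positivity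
  obtain ⟨R, hR⟩ : ∃ R : ℝ≥0, (R : ℝ) = C * ∑ i : Fin n, ∑ j : Fin n, ‖symUnit i j‖ :=
    ⟨⟨_, hS⟩, rfl⟩
  refine ⟨R, fun k i j => ?_⟩
  have hr := MatMeasure.represents (μ k)
  have := hr.finite_pos i j
  have := hr.finite_neg i j
  have key : ∀ Q : Measure (Rn n), IsFiniteMeasure Q →
      Q.real Set.univ ≤ C * ∑ i : Fin n, ∑ j : Fin n, ‖symUnit i j‖ →
      Q Set.univ ≤ R := fun Q _ hQ => by
    rw [← ENNReal.ofReal_toReal (measure_ne_top Q Set.univ), ← ENNReal.ofReal_coe_nnreal, hR]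
    exact ENNReal.ofReal_le_ofReal hQ
  refine ⟨key _ ‹_› (measure_univ_le_of_forall_test (N := MatMeasure.neg (μ k) i j)
      (MatMeasure.pos_mutuallySingular_neg (μ k) i j) (hr.pos_compl i j) fun χ hχ =>
        (le_abs_self _).trans (hb k i j χ hχ)),
    key _ ‹_› (measure_univ_le_of_forall_test (N := MatMeasure.pos (μ k) i j)
      (MatMeasure.pos_mutuallySingular_neg (μ k) i j).symm (hr.neg_compl i j) fun χ hχ => ?_)⟩
  have := (abs_le.1 (hb k i j χ hχ)).1
  linarith

end Bounds

end

noncomputable section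

/-! ### A product estimate leaves mass only on atoms -/

section Concentration

variable {n : ℕ} {Ω : TopologicalSpace.Opens (Rn n)}

/-- Since `Λ` has no atoms in `B`, the set splits into countably many pieces of `Λ`-mass at most
`ε`. Summed over the pieces, the last term is at most `κ μ(B) ε^p`, because `μ` is additive; let `ε
→ 0`. -/
theorem measure_le_of_forall_le_add_mul {D E μ Λ : Measure (Rn n)} [IsFiniteMeasure μ]
    [IsFiniteMeasure Λ] {κ : ℝ≥0} {p : ℝ} (hp : 0 < p) {B : Set (Rn n)} (hB : MeasurableSet B)
    (h : ∀ A, MeasurableSet A → A ⊆ B → D A ≤ E A + κ * μ A * Λ A ^ p)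
    (h0 : ∀ x ∈ B, Λ {x} = 0) : D B ≤ E B := by
  have key : ∀ ε : ℝ≥0∞, ε ≠ 0 → D B ≤ E B + κ * μ B * ε ^ p := by
    intro ε hε
    -- Points outside `B` get the whole space as a dummy neighbourhood; the countable subcover uses
    -- only points of `B`.
    have hO : ∀ x : Rn n, ∃ O, IsOpen O ∧ x ∈ O ∧ (x ∈ B → Λ O ≤ ε) := by
      intro x
      by_cases hx : x ∈ B
      · obtain ⟨O, hxO, hO, hΛ⟩ := Set.exists_isOpen_lt_of_lt (μ := Λ) {x} ε
          (by rw [h0 x hx]; exact pos_iff_ne_zero.2 hε)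
        exact ⟨O, hO, hxO rfl, fun _ => hΛ.le⟩
      · exact ⟨Set.univ, isOpen_univ, trivial, fun h => absurd h hx⟩
    choose O hOo hxO hOΛ using hO
    obtain ⟨t, htB, htc, hBt⟩ := TopologicalSpace.countable_cover_nhdsWithin (s := B) (f := O)
      fun x _ => mem_nhdsWithin_of_mem_nhds ((hOo x).mem_nhds (hxO x))
    rcases t.eq_empty_or_nonempty with rfl | hne
    · have : B = ∅ := Set.subset_empty_iff.1 (by simpa using hBt)
      simp [this]
    obtain ⟨f, rfl⟩ := htc.exists_eq_range hne
    set A : ℕ → Set (Rn n) := fun m => B ∩ disjointed (fun k => O (f k)) m with hA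
    have hAm : ∀ m, MeasurableSet (A m) := fun m =>
      hB.inter (MeasurableSet.disjointed (fun k => (hOo (f k)).measurableSet) m)
    have hAd : Pairwise (Function.onFun Disjoint A) := fun i j hij =>
      ((disjoint_disjointed _) hij).mono Set.inter_subset_right Set.inter_subset_right
    have hAU : ⋃ m, A m = B := by
      rw [hA, ← Set.inter_iUnion, iUnion_disjointed]
      exact Set.inter_eq_left.2 (by simpa using hBt)
    have hΛ : ∀ m, Λ (A m) ≤ ε := fun m =>
      (measure_mono (Set.inter_subset_right.trans (disjointed_subset _ m))).trans
        (hOΛ _ (htB ⟨m, rfl⟩))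
    calc D B = ∑' m, D (A m) := by rw [← measure_iUnion hAd hAm, hAU]
      _ ≤ ∑' m, (E (A m) + κ * μ (A m) * ε ^ p) := by
          refine ENNReal.tsum_le_tsum fun m => (h _ (hAm m) Set.inter_subset_left).trans ?_
          gcongr
          exact hΛ m
      _ = E B + κ * μ B * ε ^ p := by
          rw [ENNReal.tsum_add, ENNReal.tsum_mul_right, ENNReal.tsum_mul_left,
            ← measure_iUnion hAd hAm, ← measure_iUnion hAd hAm, hAU]
  have hlim : Tendsto (fun ε : ℝ≥0∞ => E B + κ * μ B * ε ^ p) (𝓝[≠] 0)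
      (𝓝 (E B + κ * μ B * 0 ^ p)) := by
    refine Tendsto.mono_left ?_ nhdsWithin_le_nhds
    refine tendsto_const_nhds.add (ENNReal.Tendsto.const_mul
      (ENNReal.continuous_rpow_const.tendsto 0) (Or.inr ?_))
    exact ENNReal.mul_ne_top ENNReal.coe_ne_top (measure_ne_top _ _)
  rw [ENNReal.zero_rpow_of_pos hp, mul_zero, add_zero] at hlim
  exact ge_of_tendsto hlim (eventually_nhdsWithin_of_forall key)

/-- Take `ψ = 1` on `K` with support in an open `O ⊇ K`: then `ψ²` is at least the indicator of `K`,
and `ψ² ≤ ψ` is at most that of `O`. Then let `O` run through the thickenings of `K`. -/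
theorem measure_isCompact_le_of_forall_test {D E μ Λ : Measure (Rn n)} [IsFiniteMeasure D]
    [IsFiniteMeasure E] [IsFiniteMeasure μ] [IsFiniteMeasure Λ] {κ : ℝ≥0} {p : ℝ} (hp : 0 < p)
    (h : ∀ ψ : 𝓓(Ω, ℝ), (∀ x, 0 ≤ ψ x ∧ ψ x ≤ 1) → ∫ x, ψ x * ψ x ∂D
      ≤ ∫ x, ψ x * ψ x ∂E + κ * (∫ x, ψ x ∂μ) * (∫ x, ψ x ∂Λ) ^ p)
    {K : Set (Rn n)} (hK : IsCompact K) (hKΩ : K ⊆ Ω) :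
    D K ≤ E K + κ * μ K * Λ K ^ p := by
  have key : ∀ O : Set (Rn n), IsOpen O → K ⊆ O → D K ≤ E O + κ * μ O * Λ O ^ p := by
    intro O hO hKO
    obtain ⟨ψ, hψ1, hψ, hψO⟩ := exists_testFunction_one (Ω := Ω) hK (hO.inter Ω.isOpen)
      (Set.subset_inter hKO hKΩ) Set.inter_subset_right
    have hle : ∀ x, ψ x ≤ O.indicator 1 x := fun x => by
      by_cases hx : x ∈ O
      · simpa [hx] using (hψ x).2
      · simp [hx, image_eq_zero_of_notMem_tsupport fun h => hx (hψO h).1]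
    have h_int : ∀ Q : Measure (Rn n), IsFiniteMeasure Q → Integrable ψ Q := fun Q _ =>
      Integrable.of_bound ψ.continuous.aestronglyMeasurable 1 (Eventually.of_forall fun x => by
        rw [Real.norm_of_nonneg (hψ x).1]; exact (hψ x).2)
    have hint2 : ∀ Q : Measure (Rn n), IsFiniteMeasure Q → Integrable (fun x => ψ x * ψ x) Q :=
      fun Q _ => (h_int Q ‹_›).mul_bdd (c := 1) ψ.continuous.aestronglyMeasurable
        (Eventually.of_forall fun x => by
          rw [Real.norm_of_nonneg (hψ x).1]; exact (hψ x).2)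
    have h1 : D.real K ≤ ∫ x, ψ x * ψ x ∂D := by
      rw [← integral_indicator_one hK.measurableSet]
      refine integral_mono ((integrable_const (1 : ℝ)).indicator hK.measurableSet)
        (hint2 D ‹_›) fun x => ?_
      by_cases hx : x ∈ K
      · simp [hx, hψ1 x hx]
      · simpa [hx] using mul_self_nonneg (ψ x)
    have h2 : ∀ Q : Measure (Rn n), IsFiniteMeasure Q → ∫ x, ψ x ∂Q ≤ Q.real O := fun Q _ => by
      rw [← integral_indicator_one hO.measurableSet]
      exact integral_mono (h_int Q ‹_›) ((integrable_const (1 : ℝ)).indicator hO.measurableSet) hle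
    have h3 : ∫ x, ψ x * ψ x ∂E ≤ E.real O := (integral_mono (hint2 E ‹_›) (h_int E ‹_›)
      fun x => mul_le_of_le_one_left (hψ x).1 (hψ x).2).trans (h2 E ‹_›)
    have h0 : ∀ Q : Measure (Rn n), 0 ≤ ∫ x, ψ x ∂Q := fun Q => integral_nonneg fun x => (hψ x).1
    have hreal : D.real K ≤ E.real O + κ * μ.real O * Λ.real O ^ p := by
      refine h1.trans ((h ψ hψ).trans ?_)
      gcongr
      · exact Real.rpow_nonneg (h0 Λ) p
      · exact h2 μ ‹_›
      · exact h0 Λ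
      · exact h2 Λ ‹_›
    have := ENNReal.ofReal_le_ofReal hreal
    rw [ENNReal.ofReal_add (by positivity) (by positivity), ENNReal.ofReal_mul (by positivity),
      ENNReal.ofReal_mul (by positivity), ← ENNReal.ofReal_rpow_of_nonneg (by positivity) hp.le,
      ENNReal.ofReal_coe_nnreal] at this
    simpa only [measureReal_def, ENNReal.ofReal_toReal (measure_ne_top _ _)] using this
  have ht : ∀ Q : Measure (Rn n), IsFiniteMeasure Q →
      Tendsto (fun r => Q (Metric.thickening r K)) (𝓝[>] 0) (𝓝 (Q K)) := fun Q _ =>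
    tendsto_measure_thickening_of_isClosed ⟨1, one_pos, measure_ne_top _ _⟩ hK.isClosed
  have hlim : Tendsto (fun r => E (Metric.thickening r K) + κ * μ (Metric.thickening r K)
      * Λ (Metric.thickening r K) ^ p) (𝓝[>] 0) (𝓝 (E K + κ * μ K * Λ K ^ p)) := by
    refine (ht E ‹_›).add (ENNReal.Tendsto.mul (ENNReal.Tendsto.const_mul (ht μ ‹_›)
      (Or.inr ENNReal.coe_ne_top)) (Or.inr ?_)
      ((ENNReal.continuous_rpow_const.tendsto _).comp (ht Λ ‹_›)) (Or.inr ?_))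
    · exact ENNReal.rpow_ne_top_of_nonneg hp.le (measure_ne_top _ _)
    · exact ENNReal.mul_ne_top ENNReal.coe_ne_top (measure_ne_top _ _)
  refine ge_of_tendsto hlim (eventually_nhdsWithin_of_forall fun r hr => ?_)
  exact key _ Metric.isOpen_thickening (Metric.self_subset_thickening hr K)

/-- An estimate of `D - E` by a product of two measures forces `D ≤ E` off the atoms. -/
theorem measure_le_of_forall_test {D E μ Λ : Measure (Rn n)} [IsFiniteMeasure D]
    [IsFiniteMeasure E] [IsFiniteMeasure μ] [IsFiniteMeasure Λ] {κ : ℝ≥0} {p : ℝ} (hp : 0 < p)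
    (h : ∀ ψ : 𝓓(Ω, ℝ), (∀ x, 0 ≤ ψ x ∧ ψ x ≤ 1) → ∫ x, ψ x * ψ x ∂D
      ≤ ∫ x, ψ x * ψ x ∂E + κ * (∫ x, ψ x ∂μ) * (∫ x, ψ x ∂Λ) ^ p)
    {B : Set (Rn n)} (hB : MeasurableSet B) (hBΩ : B ⊆ Ω) (h0 : ∀ x ∈ B, Λ {x} = 0) :
    D B ≤ E B := by
  refine measure_le_of_forall_le_add_mul (κ := κ) (μ := μ) (Λ := Λ) hp hB (fun A hA hAB => ?_) h0
  rw [hA.measure_eq_iSup_isCompact_of_ne_top (measure_ne_top D A)]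
  refine iSup_le fun K => iSup_le fun hKA => iSup_le fun hK => ?_
  refine (measure_isCompact_le_of_forall_test hp h hK (hKA.trans (hAB.trans hBΩ))).trans ?_
  gcongr

end Concentration

end

noncomputable section

/-! ### The key bilinear estimate -/

section Estimate

variable {n : ℕ}

/-- The measure `∑ i, |b i| ^ n dx`. -/
def gradMeas (b : Fin n → Rn n → ℝ) : Measure (Rn n) :=
  ∑ i, volume.withDensity fun x => ‖b i x‖ₑ ^ (n : ℝ)

theorem lintegral_mul_le_gradMeas {b : Fin n → Rn n → ℝ}
    (hb : ∀ i, AEStronglyMeasurable (b i) volume) {g : Rn n → ℝ≥0∞} (hg : Measurable g)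
    (i : Fin n) : ∫⁻ x, ‖b i x‖ₑ ^ (n : ℝ) * g x ≤ ∫⁻ x, g x ∂(gradMeas b) := by
  rw [gradMeas, lintegral_finsetSum_measure]
  refine le_trans ?_ (Finset.single_le_sum (f := fun i => ∫⁻ x, g x
    ∂(volume.withDensity fun x => ‖b i x‖ₑ ^ (n : ℝ))) (fun _ _ => zero_le) (Finset.mem_univ i))
  rw [lintegral_withDensity_eq_lintegral_mul₀ ((hb i).enorm.pow_const _) hg.aemeasurable]
  rfl

theorem eLpNorm_natCast_eq [n.AtLeastTwo] {X : Type*} [MeasurableSpace X] (μ : Measure X)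
    (f : X → ℝ) : eLpNorm f n μ = (∫⁻ x, ‖f x‖ₑ ^ (n : ℝ) ∂μ) ^ (1 / (n : ℝ)) := by
  rw [eLpNorm_eq_lintegral_rpow_enorm_toReal (by exact_mod_cast (neZero_dim n).out)
    (ENNReal.natCast_ne_top n), ENNReal.toReal_natCast]

/-- From `|ψ| ≤ 1` one gets `|ψ|^n ≤ |ψ|`, which leaves an integral linear in `|ψ|`, suited to weak*
limits. -/
theorem eLpNorm_test_mul_le [n.AtLeastTwo] {b : Fin n → Rn n → ℝ}
    (hb : ∀ i, AEStronglyMeasurable (b i) volume) {ψ : Rn n → ℝ} (hψ : Continuous ψ)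
    (hψ1 : ∀ x, |ψ x| ≤ 1) (i : Fin n) :
    eLpNorm (fun x => ψ x * b i x) n volume
      ≤ (∫⁻ x, ‖ψ x‖ₑ ∂(gradMeas b)) ^ (1 / (n : ℝ)) := by
  rw [eLpNorm_natCast_eq]
  refine ENNReal.rpow_le_rpow ?_ (by positivity)
  refine le_trans (lintegral_mono fun x => ?_)
    (lintegral_mul_le_gradMeas hb hψ.measurable.enorm i)
  rw [enorm_mul, ENNReal.mul_rpow_of_nonneg _ _ (by positivity), mul_comm]
  gcongr
  have h1 : ‖ψ x‖ₑ ≤ 1 := by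
    rw [Real.enorm_eq_ofReal_abs]; exact ENNReal.ofReal_le_one.2 (hψ1 x)
  exact (ENNReal.rpow_le_rpow_of_exponent_ge h1 (by exact_mod_cast one_le_dim)).trans_eq
    (ENNReal.rpow_one _)

namespace SymGradData

/-- The pairing of the symmetrised gradient of `u` with `ψ² a`, up to a term which is small when
`u` is small in `L¹`, is controlled by `|Eu|(ψ)` and by the energy of `a` on the support of `ψ`. -/
theorem exists_enorm_productTerm_le (n : ℕ) [n.AtLeastTwo] :
    ∃ κ : ℝ≥0, ∀ (Ω : TopologicalSpace.Opens (Rn n)) (u : Rn n → Rn n)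
      (P N : Fin n → Fin n → Measure (Rn n)), SymGradData Ω u P N → ∀ ψ : 𝓓(Ω, ℝ),
      (∀ x, |ψ x| ≤ 1) → ∀ (a : Rn n → ℝ) (b : Fin n → Rn n → ℝ) (C : ℝ),
      (∀ i, AEStronglyMeasurable (b i) volume) →
      (∀ᵐ x, |a x| ≤ C) → ∀ i j,
      ‖productTerm u (fun x => ψ x * ψ x) a b i j‖ₑ ≤ 2 * (2 * ENNReal.ofReal C * gradTerm u ψ
        + κ * (∫⁻ x, ‖ψ x‖ₑ ∂(totalMeas P N) + 2 * gradTerm u ψ)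
          * (∫⁻ x, ‖ψ x‖ₑ ∂(gradMeas b)) ^ (1 / (n : ℝ))) := by
  obtain ⟨κ, hκ⟩ := exists_sobolev n
  have hq := conjExp_pos n
  -- The Sobolev inequality bounds the power `n / (n - 1)` of the norm, so its constant enters
  -- through a root.
  refine ⟨κ ^ (1 / conjExp n), fun Ω u P N h ψ hψ1 a b C hb haC => ?_⟩
  have hmu : ∀ i, Measurable fun x => u x i := fun i => (h.measurable_apply i)
  have hLq : ∀ i, eLpNorm (fun x => ψ x * u x i) (ENNReal.ofReal (conjExp n)) volume
      ≤ ((κ ^ (1 / conjExp n) : ℝ≥0) : ℝ≥0∞) *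
        (∫⁻ x, ‖ψ x‖ₑ ∂(totalMeas P N) + 2 * gradTerm u ψ) := by
    intro i
    rw [eLpNorm_eq_lintegral_rpow_enorm_toReal (by simpa using hq) ENNReal.ofReal_ne_top,
      ENNReal.toReal_ofReal hq.le]
    calc (∫⁻ x, ‖ψ x * u x i‖ₑ ^ conjExp n) ^ (1 / conjExp n)
        ≤ (κ * (∫⁻ x, ‖ψ x‖ₑ ∂(totalMeas P N) + 2 * gradTerm u ψ) ^ conjExp n)
            ^ (1 / conjExp n) := by
          gcongr
          refine le_trans (lintegral_mono fun x => ?_) (hκ Ω u P N h ψ)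
          gcongr
          rw [enorm_le_iff_norm_le]
          exact norm_le_pi_norm (fun i => ψ x * u x i) i
      _ = _ := by
          rw [ENNReal.mul_rpow_of_nonneg _ _ (by positivity), ← ENNReal.rpow_mul,
            mul_one_div_cancel hq.ne', ENNReal.rpow_one,
            ENNReal.coe_rpow_of_nonneg _ (by positivity)]
  have hterm : ∀ i j, ‖∫ x in tsupport fun x => ψ x * ψ x,
      u x i * mulDeriv (fun x => ψ x * ψ x) a b j x‖ₑ ≤ 2 * ENNReal.ofReal C * gradTerm u ψ
        + ((κ ^ (1 / conjExp n) : ℝ≥0) : ℝ≥0∞)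
          * (∫⁻ x, ‖ψ x‖ₑ ∂(totalMeas P N) + 2 * gradTerm u ψ)
          * (∫⁻ x, ‖ψ x‖ₑ ∂(gradMeas b)) ^ (1 / (n : ℝ)) := by
    intro i j
    calc ‖∫ x in tsupport fun x => ψ x * ψ x, u x i * mulDeriv (fun x => ψ x * ψ x) a b j x‖ₑ
        ≤ ∫⁻ x in tsupport fun x => ψ x * ψ x,
            ‖u x i * mulDeriv (fun x => ψ x * ψ x) a b j x‖ₑ := enorm_integral_le_lintegral_enorm _
      _ ≤ ∫⁻ x, ‖u x i * mulDeriv (fun x => ψ x * ψ x) a b j x‖ₑ := setLIntegral_le_lintegral _ _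
      _ ≤ ∫⁻ x, (2 * ENNReal.ofReal C * (‖partialD j ψ x‖ₑ * ‖u x i‖ₑ)
            + ‖(ψ x * u x i) * (ψ x * b j x)‖ₑ) := by
          refine lintegral_mono_ae (haC.mono fun x hx => ?_)
          have hd : partialD j (fun x => ψ x * ψ x) x = 2 * ψ x * partialD j ψ x := by
            rw [partialD_mul (contDiff_one_test ψ) (contDiff_one_test ψ) j x]; ring
          rw [mulDeriv, hd]
          -- One factor of `ψ²` goes with `u` and the other with the gradient of `a`; this is the
          -- reason for testing with a square. The rest contains `∇ψ` and is of lower order.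
          have heq : u x i * (2 * ψ x * partialD j ψ x * a x + ψ x * ψ x * b j x)
              = 2 * (ψ x * a x) * (partialD j ψ x * u x i)
                + (ψ x * u x i) * (ψ x * b j x) := by ring
          rw [heq]
          refine (enorm_add_le _ _).trans (add_le_add_left ?_ _)
          rw [enorm_mul, enorm_mul, enorm_mul (partialD j ψ x)]
          gcongr
          · rw [Real.enorm_eq_ofReal zero_le_two]; simp
          · rw [Real.enorm_eq_ofReal_abs, abs_mul]
            refine ENNReal.ofReal_le_ofReal ((mul_le_mul (hψ1 x) hx (abs_nonneg _) zero_le_one).trans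
              (one_mul C).le)
      _ = 2 * ENNReal.ofReal C * (∫⁻ x, ‖partialD j ψ x‖ₑ * ‖u x i‖ₑ)
            + ∫⁻ x, ‖(ψ x * u x i) * (ψ x * b j x)‖ₑ := by
          have hm : Measurable fun x => ‖partialD j ψ x‖ₑ * ‖u x i‖ₑ :=
            (continuous_partialD ψ j).measurable.enorm.mul (hmu i).enorm
          rw [lintegral_add_left (hm.const_mul _), lintegral_const_mul _ hm]
      _ ≤ _ := by
          gcongr
          · exact le_trans (Finset.single_le_sum (f := fun k => ∫⁻ x, ‖partialD k ψ x‖ₑ * ‖u x i‖ₑ)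
              (fun _ _ => zero_le) (Finset.mem_univ j))
              (Finset.single_le_sum (f := fun i => ∑ k, ∫⁻ x, ‖partialD k ψ x‖ₑ * ‖u x i‖ₑ)
              (fun _ _ => zero_le) (Finset.mem_univ i))
          · refine (lintegral_enorm_mul_le_conjExp (n := n)
              (ψ.continuous.measurable.mul (hmu i)).aestronglyMeasurable
              (ψ.continuous.aestronglyMeasurable.mul (hb j))).trans ?_
            exact mul_le_mul' (hLq i) (eLpNorm_test_mul_le hb ψ.continuous hψ1 j)
  intro i j
  rw [productTerm, neg_div, enorm_neg, two_mul]
  refine le_trans ?_ (add_le_add (hterm i j) (hterm j i))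
  refine le_trans ?_ (enorm_add_le _ _)
  rw [enorm_le_iff_norm_le, norm_div]
  exact div_le_self (norm_nonneg _) (by norm_num)

end SymGradData

end Estimate

end

noncomputable section

/-! ### Differences of fields, and vanishing of the lower order term -/

section Differences

variable {n : ℕ} {Ω : TopologicalSpace.Opens (Rn n)}

theorem Represents.sub {μ ν : MatMeasure Ω} {P N P' N' : Fin n → Fin n → Measure (Rn n)}
    (h : Represents μ P N) (h' : Represents ν P' N') :
    Represents (μ - ν) (fun i j => P i j + N' i j) (fun i j => N i j + P' i j) := by
  have := h.finite_pos
  have := h.finite_neg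
  have := h'.finite_pos
  have := h'.finite_neg
  refine ⟨fun i j => inferInstance, fun i j => inferInstance, fun i j => ?_, fun i j => ?_,
    fun s hs i j => ?_⟩
  · rw [Measure.add_apply, h.pos_compl, h'.neg_compl, add_zero]
  · rw [Measure.add_apply, h.neg_compl, h'.pos_compl, add_zero]
  · have e : ((μ - ν) s).1 (i, j) = (μ s).1 (i, j) - (ν s).1 (i, j) := rfl
    rw [e, h.apply s hs, h'.apply s hs, measureReal_add_apply, measureReal_add_apply]
    ring

namespace SymGradData

variable {u u' : Rn n → Rn n} {P N P' N' : Fin n → Fin n → Measure (Rn n)}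

theorem sub (h : SymGradData Ω u P N) (h' : SymGradData Ω u' P' N') :
    SymGradData Ω (u - u') (fun i j => P i j + N' i j) (fun i j => N i j + P' i j) where
  measurable := h.measurable.sub h'.measurable
  integrable := h.integrable.sub h'.integrable
  finite_pos i j := by
    have := h.finite_pos i j
    have := h'.finite_neg i j
    infer_instance
  finite_neg i j := by
    have := h.finite_neg i j
    have := h'.finite_pos i j
    infer_instance
  eq φ i j := by
    have := h.finite_pos i j
    have := h'.finite_neg i j
    have := h.finite_neg i j
    have := h'.finite_pos i j
    have hφ : ∀ Q : Measure (Rn n), IsFiniteMeasure Q → Integrable φ Q := fun Q _ => by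
      obtain ⟨C, hC⟩ := φ.continuous.bounded_above_of_compact_support φ.hasCompactSupport
      exact Integrable.of_bound φ.continuous.aestronglyMeasurable C (Eventually.of_forall hC)
    have h_int : ∀ {v : Rn n → Rn n}, Integrable v (volOn Ω) →
        Integrable (fun x => (v x i * partialD j φ x + v x j * partialD i φ x) / 2) (volOn Ω) := by
      intro v hv
      have hk : ∀ k l, Integrable (fun x => v x k * partialD l φ x) (volOn Ω) := fun k l => by
        obtain ⟨C, hC⟩ := (continuous_partialD φ l).bounded_above_of_compact_support
          (hasCompactSupport_partialD φ l)
        exact ((EuclideanSpace.proj k : Rn n →L[ℝ] ℝ).integrable_comp hv).mul_bdd (c := C)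
          (continuous_partialD φ l).aestronglyMeasurable (Eventually.of_forall hC)
      exact ((hk i j).add (hk j i)).div_const 2
    rw [integral_add_measure (hφ _ ‹_›) (hφ _ ‹_›), integral_add_measure (hφ _ ‹_›) (hφ _ ‹_›)]
    have e1 := h.eq φ i j
    have e2 := h'.eq φ i j
    have e3 : ∫ x, ((u - u') x i * partialD j φ x + (u - u') x j * partialD i φ x) / 2 ∂(volOn Ω)
        = (∫ x, (u x i * partialD j φ x + u x j * partialD i φ x) / 2 ∂(volOn Ω))
          - ∫ x, (u' x i * partialD j φ x + u' x j * partialD i φ x) / 2 ∂(volOn Ω) := by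
      rw [← integral_sub (h_int h.integrable) (h_int h'.integrable)]
      refine integral_congr_ae (Eventually.of_forall fun x => ?_)
      simp only [Pi.sub_apply, PiLp.sub_apply]
      ring
    rw [e3]
    linarith

theorem productTerm_sub [n.AtLeastTwo] (h : SymGradData Ω u P N) (h' : SymGradData Ω u' P' N')
    {a : Rn n → ℝ} {b : Fin n → Rn n → ℝ} (ha : SobOn Ω a b) (φ : 𝓓(Ω, ℝ)) (i j : Fin n) :
    productTerm (u - u') φ a b i j = productTerm u φ a b i j - productTerm u' φ a b i j := by
  have hm := memLp_mulDeriv φ (ha.memLp.restrict _) fun i => (ha.memLp_grad i).restrict _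
  have hK : IsCompact (tsupport φ) := φ.hasCompactSupport
  have key : ∀ i j, ∫ x in tsupport φ, (u - u') x i * mulDeriv φ a b j x
      = (∫ x in tsupport φ, u x i * mulDeriv φ a b j x)
        - ∫ x in tsupport φ, u' x i * mulDeriv φ a b j x := fun i j => by
    rw [← integral_sub]
    · refine integral_congr_ae (Eventually.of_forall fun x => ?_)
      simp only [Pi.sub_apply, PiLp.sub_apply]
      ring
    · exact (h.memLp hK φ.tsupport_subset i).integrable_mul (hm j)
    · exact (h'.memLp hK φ.tsupport_subset i).integrable_mul (hm j)
  simp only [productTerm, key]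
  ring

theorem tendsto_gradTerm {v : ℕ → Lp (Rn n) 1 (volOn Ω)} {w : Lp (Rn n) 1 (volOn Ω)}
    (h : Tendsto v atTop (𝓝 w)) (ψ : 𝓓(Ω, ℝ)) :
    Tendsto (fun k => gradTerm ((v k : Rn n → Rn n) - (w : Rn n → Rn n)) ψ) atTop (𝓝 0) := by
  have h1 : Tendsto (fun k => eLpNorm ((v k : Rn n → Rn n) - (w : Rn n → Rn n)) 1 (volOn Ω)) atTop
      (𝓝 0) :=
    (Lp.tendsto_Lp_iff_tendsto_eLpNorm' _ _).1 h
  rw [show (0 : ℝ≥0∞) = ∑ _i : Fin n, ∑ _k : Fin n, 0 by simp]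
  refine tendsto_finsetSum _ fun i _ => tendsto_finsetSum _ fun l _ => ?_
  obtain ⟨C, hC⟩ := (continuous_partialD ψ l).bounded_above_of_compact_support
    (hasCompactSupport_partialD ψ l)
  have h2 : Tendsto (fun k => ENNReal.ofReal C
      * eLpNorm ((v k : Rn n → Rn n) - (w : Rn n → Rn n)) 1 (volOn Ω)) atTop (𝓝 0) := by
    simpa using ENNReal.Tendsto.const_mul h1 (Or.inr ENNReal.ofReal_ne_top)
  refine tendsto_of_tendsto_of_tendsto_of_le_of_le tendsto_const_nhds h2 (fun _ => zero_le)
    fun k => ?_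
  change ∫⁻ x, ‖partialD l ψ x‖ₑ * ‖((v k : Rn n → Rn n) - (w : Rn n → Rn n)) x i‖ₑ ≤ _
  rw [eLpNorm_one_eq_lintegral_enorm, ← lintegral_const_mul' _ _ ENNReal.ofReal_ne_top,
    ← setLIntegral_eq_of_support_subset (s := (Ω : Set (Rn n)))]
  · refine lintegral_mono fun x => mul_le_mul' ?_ ?_
    · rw [← ofReal_norm]
      exact ENNReal.ofReal_le_ofReal (hC x)
    · rw [enorm_le_iff_norm_le]
      exact PiLp.norm_apply_le (((v k : Rn n → Rn n) - (w : Rn n → Rn n)) x) i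
  · intro x hx
    by_contra hxΩ
    exact hx (by
      simp [partialD_eq_zero_of_notMem (fun h => hxΩ (ψ.tsupport_subset h)) l])

end SymGradData

theorem memLp_indicator_volOn {K : Set (Rn n)} (hK : MeasurableSet K) (hKΩ : K ⊆ Ω) {p : ℝ≥0∞}
    {g : Rn n → ℝ} (hg : MemLp g p (volume.restrict K)) : MemLp (K.indicator g) p (volOn Ω) := by
  rw [memLp_indicator_iff_restrict hK, Measure.restrict_restrict hK, Set.inter_eq_left.2 hKΩ]
  exact hg

theorem integral_indicator_mul_volOn {K : Set (Rn n)} (hK : MeasurableSet K) (hKΩ : K ⊆ Ω)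
    (g f : Rn n → ℝ) : ∫ x, K.indicator g x * f x ∂(volOn Ω)
      = ∫ x in K, g x * (Ω : Set (Rn n)).indicator f x := by
  have : ∀ x, K.indicator g x * f x
      = K.indicator (fun x => g x * (Ω : Set (Rn n)).indicator f x) x := fun x => by
    by_cases hx : x ∈ K
    · simp only [Set.indicator_of_mem hx, Set.indicator_of_mem (hKΩ hx)]
    · simp only [Set.indicator_of_notMem hx, zero_mul]
  simp only [this]
  rw [integral_indicator hK, Measure.restrict_restrict hK, Set.inter_eq_left.2 hKΩ]

end Differences

/-! ### Consequences of weak convergence in `W^{1,n}` -/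

section Weak

variable {n : ℕ} [n.AtLeastTwo] {Ω : TopologicalSpace.Opens (Rn n)}

theorem one_le_conjExp (n : ℕ) [n.AtLeastTwo] : Fact (1 ≤ ENNReal.ofReal (conjExp n)) :=
  ⟨by
    rw [← ENNReal.ofReal_one]
    exact ENNReal.ofReal_le_ofReal (holderConjugate_conjExp n).symm.lt.le⟩

theorem W1p.exists_dual_fn {g : Rn n → ℝ}
    (hg : MemLp g (ENNReal.ofReal (conjExp n)) (volOn Ω)) :
    ∃ T : StrongDual ℝ (W1p Ω (n : ℝ≥0∞)), ∀ w, T w = ∫ x, g x * W1p.fn w x ∂(volOn Ω) := by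
  have := one_le_conjExp n
  refine ⟨((ContinuousLinearMap.mul ℝ ℝ).lpPairing (volOn Ω) (ENNReal.ofReal (conjExp n)) n
    (hg.toLp g)) ∘L (ContinuousLinearMap.fst ℝ _ _) ∘L (W1p Ω (n : ℝ≥0∞)).subtypeL, fun w => ?_⟩
  refine (ContinuousLinearMap.lpPairing_eq_integral _ _ _).trans (integral_congr_ae ?_)
  filter_upwards [hg.coeFn_toLp] with x hx
  simp only [hx]
  rfl

theorem W1p.exists_dual_grad {g : Rn n → ℝ}
    (hg : MemLp g (ENNReal.ofReal (conjExp n)) (volOn Ω)) (j : Fin n) :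
    ∃ T : StrongDual ℝ (W1p Ω (n : ℝ≥0∞)), ∀ w, T w = ∫ x, g x * W1p.grad w x j ∂(volOn Ω) := by
  have := one_le_conjExp n
  refine ⟨((ContinuousLinearMap.mul ℝ ℝ).lpPairing (volOn Ω) (ENNReal.ofReal (conjExp n)) n
    (hg.toLp g)) ∘L ((EuclideanSpace.proj j : Rn n →L[ℝ] ℝ).compLpL n (volOn Ω))
      ∘L (ContinuousLinearMap.snd ℝ _ _) ∘L (W1p Ω (n : ℝ≥0∞)).subtypeL, fun w => ?_⟩
  refine (ContinuousLinearMap.lpPairing_eq_integral _ _ _).trans (integral_congr_ae ?_)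
  filter_upwards [hg.coeFn_toLp,
    (EuclideanSpace.proj j : Rn n →L[ℝ] ℝ).coeFn_compLpL (p := n) (μ := volOn Ω) w.1.2]
    with x hx hx'
  simp only [hx]
  exact congrArg (g x * ·) hx'

variable {α : ℕ → W1p Ω (n : ℝ≥0∞)} {α₀ : W1p Ω (n : ℝ≥0∞)}

/-- For fixed `u` the functions `u ∂φ` and `u φ` are in `L^{n/(n-1)}` on the support of `φ`, so
`productTerm` is a bounded linear functional of the pair formed by a Sobolev function and its
gradient. -/
theorem WeakConvW1p.tendsto_productTerm (hα : WeakConvW1p α α₀) {u : Rn n → Rn n}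
    {P N : Fin n → Fin n → Measure (Rn n)} (h : SymGradData Ω u P N) (φ : 𝓓(Ω, ℝ)) (i j : Fin n) :
    Tendsto (fun k => SymGradData.productTerm u φ (W1p.ext (α k)) (W1p.extGrad (α k)) i j) atTop
      (𝓝 (SymGradData.productTerm u φ (W1p.ext α₀) (W1p.extGrad α₀) i j)) := by
  have hK : IsCompact (tsupport φ) := φ.hasCompactSupport
  have hKΩ : tsupport φ ⊆ Ω := φ.tsupport_subset
  have hmul : ∀ (i : Fin n) {f : Rn n → ℝ}, Continuous f → HasCompactSupport f →
      MemLp (fun x => u x i * f x) (ENNReal.ofReal (conjExp n)) (volume.restrict (tsupport φ)) := by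
    intro i f hf hfs
    obtain ⟨C, hC⟩ := hf.bounded_above_of_compact_support hfs
    have hu := h.memLp hK hKΩ i
    refine hu.of_le_mul (c := C) (hu.1.mul hf.aestronglyMeasurable)
      (Eventually.of_forall fun x => ?_)
    rw [norm_mul, mul_comm]
    exact mul_le_mul_of_nonneg_right (hC x) (norm_nonneg _)
  have hsplit : ∀ (w : W1p Ω (n : ℝ≥0∞)) i j,
      ∫ x in tsupport φ, u x i * SymGradData.mulDeriv φ (W1p.ext w) (W1p.extGrad w) j x
      = (∫ x in tsupport φ, u x i * partialD j φ x * W1p.ext w x)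
        + ∫ x in tsupport φ, u x i * φ x * W1p.extGrad w j x := fun w i j => by
    rw [← integral_add]
    · refine integral_congr_ae (Eventually.of_forall fun x => ?_)
      simp only [SymGradData.mulDeriv]
      ring
    · exact (hmul i (continuous_partialD φ j) (hasCompactSupport_partialD φ j)).integrable_mul
        ((W1p.sobOn w).memLp.restrict _)
    · exact (hmul i φ.continuous φ.hasCompactSupport).integrable_mul
        (((W1p.sobOn w).memLp_grad j).restrict _)
  have key : ∀ i j, Tendsto (fun k => ∫ x in tsupport φ,
      u x i * SymGradData.mulDeriv φ (W1p.ext (α k)) (W1p.extGrad (α k)) j x) atTop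
      (𝓝 (∫ x in tsupport φ,
        u x i * SymGradData.mulDeriv φ (W1p.ext α₀) (W1p.extGrad α₀) j x)) := by
    intro i j
    simp only [hsplit]
    obtain ⟨T, hT⟩ := W1p.exists_dual_fn (memLp_indicator_volOn hK.measurableSet hKΩ
      (hmul i (continuous_partialD φ j) (hasCompactSupport_partialD φ j)))
    obtain ⟨S, hS⟩ := W1p.exists_dual_grad (memLp_indicator_volOn hK.measurableSet hKΩ
      (hmul i φ.continuous φ.hasCompactSupport)) j
    have := (hα.tendsto T).add (hα.tendsto S)
    simp only [hT, hS, integral_indicator_mul_volOn hK.measurableSet hKΩ] at this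
    exact this
  exact (((key i j).add (key j i)).neg).div_const 2

theorem ae_abs_fn_le {M : ℝ≥0} {w : W1p Ω (n : ℝ≥0∞)}
    (hM : eLpNorm (W1p.fn w) ∞ (volOn Ω) ≤ M) : ∀ᵐ x ∂(volOn Ω), |W1p.fn w x| ≤ M := by
  rw [eLpNorm_exponent_top] at hM
  filter_upwards [enorm_ae_le_eLpNormEssSup (W1p.fn w) (volOn Ω)] with x hx
  have := hx.trans hM
  rw [Real.enorm_eq_ofReal_abs] at this
  simpa using (ENNReal.ofReal_le_iff_le_toReal ENNReal.coe_ne_top).1 this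

theorem ae_abs_ext_le {C : ℝ} (hC : 0 ≤ C) {w : W1p Ω (n : ℝ≥0∞)}
    (h : ∀ᵐ x ∂(volOn Ω), |W1p.fn w x| ≤ C) : ∀ᵐ x, |W1p.ext w x| ≤ C := by
  rw [ae_restrict_iff' Ω.isOpen.measurableSet] at h
  filter_upwards [h] with x hx
  by_cases hxΩ : x ∈ (Ω : Set (Rn n))
  · rw [W1p.ext, Set.indicator_of_mem hxΩ]; exact hx hxΩ
  · rw [W1p.ext, Set.indicator_of_notMem hxΩ, abs_zero]; exact hC

/-- Integration over a measurable subset of the bounded set `Ω` is a continuous functional, so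
two-sided bounds on averages pass to the weak limit. -/
theorem WeakConvW1p.ae_abs_fn_le (hΩ : Bornology.IsBounded (Ω : Set (Rn n)))
    (hα : WeakConvW1p α α₀) {C : ℝ} (h : ∀ k, ∀ᵐ x ∂(volOn Ω), |W1p.fn (α k) x| ≤ C) :
    ∀ᵐ x ∂(volOn Ω), |W1p.fn α₀ x| ≤ C := by
  have hfin : IsFiniteMeasure (volOn Ω) := ⟨by
    rw [Measure.restrict_apply_univ]; exact hΩ.measure_lt_top⟩
  have h_int : ∀ w : W1p Ω (n : ℝ≥0∞), Integrable (W1p.fn w) (volOn Ω) := fun w =>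
    (Lp.memLp w.1.1).integrable Fact.out
  have hlim : ∀ s, MeasurableSet s → Tendsto (fun k => ∫ x in s, W1p.fn (α k) x ∂(volOn Ω)) atTop
      (𝓝 (∫ x in s, W1p.fn α₀ x ∂(volOn Ω))) := fun s hs => by
    obtain ⟨T, hT⟩ := W1p.exists_dual_fn (Ω := Ω) (n := n) (g := s.indicator fun _ => 1)
      ((memLp_const 1).indicator hs)
    have := hα.tendsto T
    have e : ∀ w : W1p Ω (n : ℝ≥0∞), T w = ∫ x in s, W1p.fn w x ∂(volOn Ω) := fun w => by
      rw [hT, ← integral_indicator hs]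
      refine integral_congr_ae (Eventually.of_forall fun x => ?_)
      by_cases hx : x ∈ s <;> simp [hx]
    simpa only [e] using this
  have h1 : W1p.fn α₀ ≤ᵐ[volOn Ω] fun _ => C := by
    refine ae_le_of_forall_setIntegral_le (h_int α₀) (integrable_const C) fun s hs _ => ?_
    refine le_of_tendsto (hlim s hs) (Eventually.of_forall fun k => ?_)
    refine setIntegral_mono_ae (h_int _).integrableOn (integrable_const C).integrableOn ?_
    filter_upwards [h k] with x hx using (abs_le.1 hx).2
  have h2 : (fun _ => -C) ≤ᵐ[volOn Ω] W1p.fn α₀ := by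
    refine ae_le_of_forall_setIntegral_le (integrable_const (-C)) (h_int α₀) fun s hs _ => ?_
    refine ge_of_tendsto (hlim s hs) (Eventually.of_forall fun k => ?_)
    refine setIntegral_mono_ae (integrable_const (-C)).integrableOn (h_int _).integrableOn ?_
    filter_upwards [h k] with x hx using (abs_le.1 hx).1
  filter_upwards [h1, h2] with x hx1 hx2 using abs_le.2 ⟨hx2, hx1⟩

theorem gradMeas_compl (w : W1p Ω (n : ℝ≥0∞)) :
    gradMeas (W1p.extGrad w) (Ω : Set (Rn n))ᶜ = 0 := by
  rw [gradMeas, Measure.finsetSum_apply]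
  refine Finset.sum_eq_zero fun i _ => ?_
  have hm := Ω.isOpen.measurableSet.compl
  rw [withDensity_apply _ hm]
  refine (setLIntegral_congr_fun hm fun x hx => ?_).trans lintegral_zero
  have hn : (0 : ℝ) < n := by exact_mod_cast NeZero.pos n
  simp only [W1p.extGrad, Set.indicator_of_notMem hx, enorm_zero, ENNReal.zero_rpow_of_pos hn]

theorem gradMeas_univ_le (w : W1p Ω (n : ℝ≥0∞)) :
    gradMeas (W1p.extGrad w) Set.univ ≤ n * ENNReal.ofReal ‖w‖ ^ (n : ℝ) := by
  have hn : (0 : ℝ) < n := by exact_mod_cast NeZero.pos n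
  rw [gradMeas, Measure.finsetSum_apply]
  refine (Finset.sum_le_sum (g := fun _ => ENNReal.ofReal ‖w‖ ^ (n : ℝ)) fun i _ => ?_).trans
    (by simp)
  rw [withDensity_apply _ MeasurableSet.univ, Measure.restrict_univ]
  have h1 : eLpNorm (W1p.extGrad w i) n volume ≤ ENNReal.ofReal ‖w‖ := by
    refine (W1p.eLpNorm_extGrad_le w i).trans ?_
    have h2 : ‖w.1.2‖ ≤ ‖w‖ := norm_snd_le w.1
    rw [Lp.norm_def] at h2
    exact (ENNReal.le_ofReal_iff_toReal_le (Lp.eLpNorm_ne_top w.1.2) (norm_nonneg _)).2 h2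
  rw [eLpNorm_natCast_eq] at h1
  have := ENNReal.rpow_le_rpow h1 hn.le
  rwa [← ENNReal.rpow_mul, one_div_mul_cancel hn.ne', ENNReal.rpow_one] at this

end Weak

end

noncomputable section

/-! ### The defect measure and the conclusion -/

section Main

variable {n : ℕ} {Ω : TopologicalSpace.Opens (Rn n)}

/-- The countable set is that of the atoms of the finite measure `Λ`. Away from it the estimate,
used with both signs, gives `D ≤ E` and `E ≤ D` on every measurable set, so each entry of `η`
cancels. -/
theorem Represents.concentratedOnCountable {η : MatMeasure Ω}
    {D E : Fin n → Fin n → Measure (Rn n)} (h : Represents η D E) {μ Λ : Measure (Rn n)}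
    [IsFiniteMeasure μ] [IsFiniteMeasure Λ] {κ : ℝ≥0} {p : ℝ} (hp : 0 < p)
    (hb : ∀ (ψ : 𝓓(Ω, ℝ)), (∀ x, 0 ≤ ψ x ∧ ψ x ≤ 1) → ∀ i j,
      |∫ x, ψ x * ψ x ∂(D i j) - ∫ x, ψ x * ψ x ∂(E i j)|
        ≤ κ * (∫ x, ψ x ∂μ) * (∫ x, ψ x ∂Λ) ^ p) :
    η.ConcentratedOnCountable := by
  have hfD := h.finite_pos
  have hfE := h.finite_neg
  have hcount : {x : Rn n | 0 < Λ {x}}.Countable :=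
    Measure.countable_meas_pos_of_disjoint_iUnion (fun x => measurableSet_singleton x)
      fun x y hxy => Set.disjoint_singleton.2 hxy
  have hS : ((Subtype.val : Ω → Rn n) ⁻¹' {x : Rn n | 0 < Λ {x}}).Countable :=
    hcount.preimage Subtype.val_injective
  refine ⟨_, hS, ?_⟩
  rw [VectorMeasure.variation_apply_eq_zero hS.measurableSet.compl]
  intro t ht htm
  have htm' : MeasurableSet (Subtype.val '' t : Set (Rn n)) :=
    (measurableEmbedding_coe Ω).measurableSet_image.2 htm
  have htΩ : (Subtype.val '' t : Set (Rn n)) ⊆ Ω := by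
    rintro _ ⟨x, -, rfl⟩; exact x.2
  have ht0 : ∀ x ∈ (Subtype.val '' t : Set (Rn n)), Λ {x} = 0 := by
    rintro _ ⟨x, hx, rfl⟩
    have : ¬ 0 < Λ {(x : Rn n)} := ht hx
    simpa using this
  refine Subtype.ext (PiLp.ext fun ij => ?_)
  obtain ⟨i, j⟩ := ij
  rw [h.apply t htm i j]
  have h1 : D i j (Subtype.val '' t) ≤ E i j (Subtype.val '' t) :=
    measure_le_of_forall_test (μ := μ) (Λ := Λ) (κ := κ) hp
      (fun ψ hψ => by linarith [(abs_le.1 (hb ψ hψ i j)).2]) htm' htΩ ht0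
  have h2 : E i j (Subtype.val '' t) ≤ D i j (Subtype.val '' t) :=
    measure_le_of_forall_test (μ := μ) (Λ := Λ) (κ := κ) hp
      (fun ψ hψ => by linarith [(abs_le.1 (hb ψ hψ i j)).1]) htm' htΩ ht0
  rw [measureReal_def, measureReal_def, le_antisymm h1 h2, sub_self]
  rfl

theorem lintegral_enorm_test {ψ : 𝓓(Ω, ℝ)} (hψ : ∀ x, 0 ≤ ψ x ∧ ψ x ≤ 1) (Q : Measure (Rn n))
    [IsFiniteMeasure Q] : ∫⁻ x, ‖ψ x‖ₑ ∂Q = ENNReal.ofReal (∫ x, ψ x ∂Q) := by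
  rw [ofReal_integral_eq_lintegral_ofReal]
  · exact lintegral_congr fun x => Real.enorm_eq_ofReal (hψ x).1
  · exact Integrable.of_bound ψ.continuous.aestronglyMeasurable 1 (Eventually.of_forall fun x => by
      rw [Real.norm_of_nonneg (hψ x).1]; exact (hψ x).2)
  · exact Eventually.of_forall fun x => (hψ x).1

/-- The square of a test function. -/
def testSq (ψ : 𝓓(Ω, ℝ)) : 𝓓(Ω, ℝ) :=
  ⟨fun y => ψ y * ψ y, ψ.contDiff.mul ψ.contDiff, ψ.hasCompactSupport.mul_right,
    (tsupport_mul_subset_left).trans ψ.tsupport_subset⟩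

/-- Limit of the bilinear estimate: the lower order terms vanish with `gradTerm`, and the two
remaining factors converge because they are integrals of the fixed function `ψ`. -/
theorem SymGradData.exists_abs_limit_le (n : ℕ) [n.AtLeastTwo] :
    ∃ κ : ℝ≥0, ∀ (Ω : TopologicalSpace.Opens (Rn n)) (v : ℕ → Rn n → Rn n)
      (P N : ℕ → Fin n → Fin n → Measure (Rn n)), (∀ k, SymGradData Ω (v k) (P k) (N k)) →
      ∀ ψ : 𝓓(Ω, ℝ), (∀ x, 0 ≤ ψ x ∧ ψ x ≤ 1) →
      Tendsto (fun k => gradTerm (v k) ψ) atTop (𝓝 0) →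
      ∀ (a : ℕ → Rn n → ℝ) (b : ℕ → Fin n → Rn n → ℝ) (C : ℝ),
      (∀ k i, AEStronglyMeasurable (b k i) volume) →
      (∀ k, ∀ᵐ x, |a k x| ≤ C) → (∀ k, IsFiniteMeasure (gradMeas (b k))) →
      ∀ μ Λ : Measure (Rn n),
      Tendsto (fun k => ∫ x, ψ x ∂(totalMeas (P k) (N k))) atTop (𝓝 (∫ x, ψ x ∂μ)) →
      Tendsto (fun k => ∫ x, ψ x ∂(gradMeas (b k))) atTop (𝓝 (∫ x, ψ x ∂Λ)) →
      ∀ i j t, Tendsto (fun k => productTerm (v k) (testSq ψ) (a k) (b k) i j) atTop (𝓝 t) →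
        |t| ≤ κ * (∫ x, ψ x ∂μ) * (∫ x, ψ x ∂Λ) ^ (1 / (n : ℝ)) := by
  obtain ⟨κ, hκ⟩ := exists_enorm_productTerm_le n
  refine ⟨2 * κ, fun Ω v P N h ψ hψ hg a b C hb haC hfin μ Λ hμ hΛ i j t ht => ?_⟩
  have hψ1 : ∀ x, |ψ x| ≤ 1 := fun x => by rw [abs_of_nonneg (hψ x).1]; exact (hψ x).2
  have h0 : ∀ Q : Measure (Rn n), 0 ≤ ∫ x, ψ x ∂Q := fun Q => integral_nonneg fun x => (hψ x).1
  have hle := fun k => hκ Ω (v k) (P k) (N k) (h k) ψ hψ1 (a k) (b k) C (hb k) (haC k) i j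
  have e1 : ∀ k, ∫⁻ x, ‖ψ x‖ₑ ∂(totalMeas (P k) (N k))
      = ENNReal.ofReal (∫ x, ψ x ∂(totalMeas (P k) (N k))) := fun k =>
    have := (h k).isFiniteMeasure_totalMeas
    lintegral_enorm_test hψ _
  have e2 : ∀ k, ∫⁻ x, ‖ψ x‖ₑ ∂(gradMeas (b k)) = ENNReal.ofReal (∫ x, ψ x ∂(gradMeas (b k))) :=
    fun k => lintegral_enorm_test hψ _
  simp only [e1, e2] at hle
  have hn : (0 : ℝ) ≤ 1 / (n : ℝ) := by positivity
  have l1 : Tendsto (fun k => 2 * ENNReal.ofReal C * gradTerm (v k) ψ) atTop (𝓝 0) := by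
    simpa using ENNReal.Tendsto.const_mul hg
      (Or.inr (ENNReal.mul_ne_top ENNReal.ofNat_ne_top ENNReal.ofReal_ne_top) : _ ∨
        2 * ENNReal.ofReal C ≠ ∞)
  have l2 : Tendsto (fun k => ENNReal.ofReal (∫ x, ψ x ∂(totalMeas (P k) (N k)))
      + 2 * gradTerm (v k) ψ) atTop (𝓝 (ENNReal.ofReal (∫ x, ψ x ∂μ))) := by
    have : Tendsto (fun k => 2 * gradTerm (v k) ψ) atTop (𝓝 0) := by
      simpa using ENNReal.Tendsto.const_mul hg (Or.inr ENNReal.ofNat_ne_top : _ ∨ (2 : ℝ≥0∞) ≠ ∞)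
    simpa using (ENNReal.tendsto_ofReal hμ).add this
  have l3 : Tendsto (fun k => ENNReal.ofReal (∫ x, ψ x ∂(gradMeas (b k))) ^ (1 / (n : ℝ))) atTop
      (𝓝 (ENNReal.ofReal (∫ x, ψ x ∂Λ) ^ (1 / (n : ℝ)))) :=
    (ENNReal.continuous_rpow_const.tendsto _).comp (ENNReal.tendsto_ofReal hΛ)
  have l4 := ENNReal.Tendsto.mul (ENNReal.Tendsto.const_mul l2
      (Or.inr ENNReal.coe_ne_top : _ ∨ (κ : ℝ≥0∞) ≠ ∞))
    (Or.inr (ENNReal.rpow_ne_top_of_nonneg hn ENNReal.ofReal_ne_top)) l3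
    (Or.inr (ENNReal.mul_ne_top ENNReal.coe_ne_top ENNReal.ofReal_ne_top))
  have l5 := ENNReal.Tendsto.const_mul (l1.add l4)
    (Or.inr ENNReal.ofNat_ne_top : _ ∨ (2 : ℝ≥0∞) ≠ ∞)
  have htwo : ∀ r : ℝ, 2 * ENNReal.ofReal r = ENNReal.ofReal (2 * r) := fun r => by
    rw [ENNReal.ofReal_mul zero_le_two, ENNReal.ofReal_ofNat]
  have := le_of_tendsto_of_tendsto ht.enorm l5 (Eventually.of_forall hle)
  rw [zero_add, ENNReal.ofReal_rpow_of_nonneg (h0 Λ) hn, Real.enorm_eq_ofReal_abs,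
    ← ENNReal.ofReal_coe_nnreal, ← ENNReal.ofReal_mul (by positivity),
    ← ENNReal.ofReal_mul (mul_nonneg (by positivity) (h0 μ)), htwo] at this
  refine ((ENNReal.ofReal_le_ofReal_iff (mul_nonneg zero_le_two (mul_nonneg (mul_nonneg
    (by positivity) (h0 μ)) (Real.rpow_nonneg (h0 Λ) _)))).1 this).trans (le_of_eq ?_)
  push_cast
  ring

/-- The product of a quasicontinuous representative with a symmetrised gradient. -/
theorem BD.mulFn_spec [n.AtLeastTwo] (hΩ : Bornology.IsBounded (Ω : Set (Rn n))) (u : BD Ω)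
    {w : W1p Ω (n : ℝ≥0∞)} {f : Rn n → ℝ} (hf : IsQuasicontinuousRep w f) {C : ℝ} (hC : 1 ≤ C)
    (hwC : ∀ᵐ x ∂(volOn Ω), |W1p.fn w x| ≤ C) :
    (BD.E u).Integrable (fun x : Ω => f x) ∧
    Represents (MatMeasure.mulFn f (BD.E u))
      (mulPos f (MatMeasure.pos (BD.E u)) (MatMeasure.neg (BD.E u)))
      (mulPos f (MatMeasure.neg (BD.E u)) (MatMeasure.pos (BD.E u))) ∧
    (∀ i j, mulPos f (MatMeasure.pos (BD.E u)) (MatMeasure.neg (BD.E u)) i j Set.univ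
      ≤ ENNReal.ofReal C * (MatMeasure.pos (BD.E u) i j Set.univ
        + MatMeasure.neg (BD.E u) i j Set.univ) ∧
      mulPos f (MatMeasure.neg (BD.E u)) (MatMeasure.pos (BD.E u)) i j Set.univ
      ≤ ENNReal.ofReal C * (MatMeasure.pos (BD.E u) i j Set.univ
        + MatMeasure.neg (BD.E u) i j Set.univ)) ∧
    ∀ (φ : 𝓓(Ω, ℝ)) (i j : Fin n),
      ∫ x, φ x ∂(mulPos f (MatMeasure.pos (BD.E u)) (MatMeasure.neg (BD.E u)) i j)
        - ∫ x, φ x ∂(mulPos f (MatMeasure.neg (BD.E u)) (MatMeasure.pos (BD.E u)) i j)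
        = SymGradData.productTerm ((u : Lp (Rn n) 1 (volOn Ω)) : Rn n → Rn n) φ
          (W1p.ext w) (W1p.extGrad w) i j := by
  have hr := MatMeasure.represents (BD.E u)
  have hs := BD.symGradData u hr
  have hfp := hr.finite_pos
  have hfn := hr.finite_neg
  have hft := hr.finite_total
  have hPN := MatMeasure.pos_mutuallySingular_neg (BD.E u)
  obtain ⟨z, c, U, hz⟩ := hf.1.exists_hasPotentials hΩ
  have hext := ae_abs_ext_le (zero_le_one.trans hC) hwC
  have hfa : ∀ᵐ x, x ∈ Ω → f x = W1p.ext w x := by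
    have := (ae_restrict_iff' Ω.isOpen.measurableSet).1 hf.2
    filter_upwards [this] with x hx hxΩ
    rw [hx hxΩ, W1p.ext, Set.indicator_of_mem (show x ∈ (Ω : Set (Rn n)) from hxΩ)]
  obtain ⟨hfm, hfC⟩ := hs.rep_spec hΩ hr.total_compl hPN (W1p.sobOn w) hC hext hz hfa
  have hCP := fun i j => ae_mono (pos_le_totalMeas (MatMeasure.pos (BD.E u))
    (MatMeasure.neg (BD.E u)) i j) hfC
  have hCN := fun i j => ae_mono (neg_le_totalMeas (MatMeasure.pos (BD.E u))
    (MatMeasure.neg (BD.E u)) i j) hfC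
  refine ⟨hr.integrable (Integrable.of_bound hfm C hfC), hr.mulFn hfm hfC, fun i j =>
    ⟨mulPos_univ_le (hCP i j) (hCN i j), ?_⟩, fun φ i j => ?_⟩
  · rw [add_comm (MatMeasure.pos (BD.E u) i j Set.univ)]
    exact mulPos_univ_le (hCN i j) (hCP i j)
  · obtain ⟨D, hD⟩ := φ.continuous.bounded_above_of_compact_support φ.hasCompactSupport
    rw [integral_mulPos_sub hfm hfC φ.continuous.stronglyMeasurable hD]
    exact hs.integral_test_mul_rep hPN (W1p.sobOn w) hC hext hz hfa φ i j

theorem mulPos_symm (f : Rn n → ℝ) {P N : Fin n → Fin n → Measure (Rn n)}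
    (hP : ∀ i j, P i j = P j i) (hN : ∀ i j, N i j = N j i) (i j : Fin n) :
    mulPos f P N i j = mulPos f P N j i := by
  rw [mulPos, mulPos, hP i j, hN i j]

end Main

end

theorem theorem3p2 {n : ℕ} [n.AtLeastTwo] (Ω : TopologicalSpace.Opens (Rn n))
    (hΩb : Bornology.IsBounded (Ω : Set (Rn n))) (hΩL : HasLipschitzBoundary Ω)
    (α : ℕ → W1p Ω (n : ℝ≥0∞)) (α₀ : W1p Ω (n : ℝ≥0∞)) (u : ℕ → BD Ω) (u₀ : BD Ω)
    (M : ℝ≥0) (hM : ∀ k, eLpNorm (W1p.fn (α k)) ∞ (volOn Ω) ≤ M)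
    (hα : WeakConvW1p α α₀) (hu : BD.WeakStarConv u u₀)
    (αt : ℕ → Rn n → ℝ) (αt₀ : Rn n → ℝ)
    (hαt : ∀ k, IsQuasicontinuousRep (α k) (αt k)) (hαt₀ : IsQuasicontinuousRep α₀ αt₀) :
    (∀ k, (BD.E (u k)).Integrable (fun x : Ω => αt k x)) ∧
    (BD.E u₀).Integrable (fun x : Ω => αt₀ x) ∧
    ∃ s : ℕ → ℕ, StrictMono s ∧
      ∃ η : MatMeasure Ω, η.ConcentratedOnCountable ∧
        MatMeasure.WeakStarConv (fun k => MatMeasure.mulFn (αt (s k)) (BD.E (u (s k))))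
          (MatMeasure.mulFn αt₀ (BD.E u₀) + η) := by
  -- The bound is raised to at least `1` because the same constant must also bound the capacitary
  -- potentials.
  obtain ⟨C, hC1, hαC⟩ : ∃ C : ℝ, 1 ≤ C ∧ ∀ k, ∀ᵐ x ∂(volOn Ω), |W1p.fn (α k) x| ≤ C :=
    ⟨max M 1, le_max_right _ _, fun k => (ae_abs_fn_le (hM k)).mono fun x hx =>
      hx.trans (le_max_left _ _)⟩
  have hαC₀ := hα.ae_abs_fn_le hΩb hαC
  have hspec := fun k => BD.mulFn_spec hΩb (u k) (hαt k) hC1 (hαC k)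
  obtain ⟨h_int₀, hrep₀, -, hprod₀⟩ := BD.mulFn_spec hΩb u₀ hαt₀ hC1 hαC₀
  refine ⟨fun k => (hspec k).1, h_int₀, ?_⟩
  set P : ℕ → Fin n → Fin n → Measure (Rn n) := fun k => MatMeasure.pos (BD.E (u k)) with hP
  set N : ℕ → Fin n → Fin n → Measure (Rn n) := fun k => MatMeasure.neg (BD.E (u k)) with hN
  set P₀ := MatMeasure.pos (BD.E u₀) with hP₀
  set N₀ := MatMeasure.neg (BD.E u₀) with hN₀
  set A : ℕ → Fin n → Fin n → Measure (Rn n) := fun k => mulPos (αt k) (P k) (N k) with hA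
  set B : ℕ → Fin n → Fin n → Measure (Rn n) := fun k => mulPos (αt k) (N k) (P k) with hB
  have hr := fun k => MatMeasure.represents (BD.E (u k))
  have hr₀ := MatMeasure.represents (BD.E u₀)
  have hPs : ∀ k i j, P k i j = P k j i := fun k => MatMeasure.pos_symm _
  have hNs : ∀ k i j, N k i j = N k j i := fun k => MatMeasure.neg_symm _
  -- The difference `Eu_k - Eu` is represented by sums of Jordan parts that need not be mutually
  -- singular; the bilinear estimate does not ask for it.
  have hv : ∀ k, SymGradData Ω ((((u k : Lp (Rn n) 1 (volOn Ω)) : Rn n → Rn n))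
      - ((u₀ : Lp (Rn n) 1 (volOn Ω)) : Rn n → Rn n)) (fun i j => P k i j + N₀ i j)
      (fun i j => N k i j + P₀ i j) := fun k =>
    (BD.symGradData (u k) (hr k)).sub (BD.symGradData u₀ hr₀)
  have hfP₀ := hr₀.finite_pos
  have hfN₀ := hr₀.finite_neg
  set m : ℕ → Measure (Rn n) := fun k =>
    totalMeas (fun i j => P k i j + N₀ i j) (fun i j => N k i j + P₀ i j) with hm
  obtain ⟨c, hc⟩ := MatMeasure.WeakStarConv.exists_bound hu.2
  obtain ⟨R, hR⟩ := hα.exists_norm_le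
  have hmb : ∀ k, m k Set.univ
      ≤ ∑ i, ∑ j, ((c + N₀ i j Set.univ) + (c + P₀ i j Set.univ)) := fun k => by
    simp only [hm, totalMeas, Measure.finsetSum_apply, Measure.add_apply]
    gcongr with i _ j _
    · exact (hc k i j).1
    · exact (hc k i j).2
  have hΛb : ∀ k, gradMeas (W1p.extGrad (α k)) Set.univ ≤ n * ENNReal.ofReal R ^ (n : ℝ) :=
    fun k => (gradMeas_univ_le (α k)).trans (by gcongr; exact hR k)
  have hΛfin : n * ENNReal.ofReal R ^ (n : ℝ) < ∞ :=
    ENNReal.mul_lt_top (ENNReal.natCast_lt_top n)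
      (ENNReal.rpow_lt_top_of_nonneg (by positivity) ENNReal.ofReal_ne_top)
  set X : ℝ≥0∞ := ENNReal.ofReal C * (c + c)
    + (∑ i, ∑ j, ((c + N₀ i j Set.univ) + (c + P₀ i j Set.univ))
      + n * ENNReal.ofReal R ^ (n : ℝ)) with hX
  have hXfin : X ≠ ∞ := by
    refine (ENNReal.add_lt_top.2 ⟨ENNReal.mul_lt_top ENNReal.ofReal_lt_top
      (ENNReal.add_lt_top.2 ⟨ENNReal.coe_lt_top, ENNReal.coe_lt_top⟩),
      ENNReal.add_lt_top.2 ⟨?_, hΛfin⟩⟩).ne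
    exact ENNReal.sum_lt_top.2 fun i _ => ENNReal.sum_lt_top.2 fun j _ => ENNReal.add_lt_top.2
      ⟨ENNReal.add_lt_top.2 ⟨ENNReal.coe_lt_top, measure_lt_top _ _⟩,
        ENNReal.add_lt_top.2 ⟨ENNReal.coe_lt_top, measure_lt_top _ _⟩⟩
  have hAB : ∀ k i j, P k i j Set.univ + N k i j Set.univ ≤ c + c := fun k i j =>
    add_le_add (hc k i j).1 (hc k i j).2
  have hAX : ∀ k i j, A k i j Set.univ ≤ X := fun k i j =>
    ((hspec k).2.2.1 i j).1.trans ((mul_le_mul_right (hAB k i j) _).trans le_self_add)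
  have hBX : ∀ k i j, B k i j Set.univ ≤ X := fun k i j =>
    ((hspec k).2.2.1 i j).2.trans ((mul_le_mul_right (hAB k i j) _).trans le_self_add)
  have hmX : ∀ k, m k Set.univ ≤ X := fun k =>
    (hmb k).trans (le_self_add.trans le_add_self)
  have hΛX : ∀ k, gradMeas (W1p.extGrad (α k)) Set.univ ≤ X := fun k =>
    (hΛb k).trans (le_add_self.trans le_add_self)
  -- One extraction serves all families: the two parts of every entry of `α̃_k Eu_k`, the measures
  -- `m k` dominating `E(u_k - u)`, and the energy measures of `α_k`.
  obtain ⟨s, hs, L, hLfin, hLΩ, hL⟩ := exists_subseq_tendsto_integral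
    (ι := (Bool × Fin n × Fin n) ⊕ Bool) (C := X.toNNReal) hΩb
    (μ := fun k => Sum.elim (fun p => cond p.1 (A k p.2.1 p.2.2) (B k p.2.1 p.2.2))
      fun b => cond b (m k) (gradMeas (W1p.extGrad (α k))))
    (by
      rw [ENNReal.coe_toNNReal hXfin]
      rintro k (⟨_ | _, i, j⟩ | _ | _)
      · exact hBX k i j
      · exact hAX k i j
      · exact hΛX k
      · exact hmX k)
    (by
      rintro k (⟨_ | _, i, j⟩ | _ | _)
      · exact (hspec k).2.1.neg_compl i j
      · exact (hspec k).2.1.pos_compl i j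
      · exact gradMeas_compl (α k)
      · exact ((hr k).sub hr₀).total_compl)
  refine ⟨s, hs, ?_⟩
  -- Limits are read at the ordered pair of indices, which makes the limiting families symmetric by
  -- construction.
  have hAs : ∀ k i j, A k i j = A k (min i j) (max i j) := fun k i j => by
    rcases le_total i j with h | h
    · rw [min_eq_left h, max_eq_right h]
    · rw [min_eq_right h, max_eq_left h]; exact mulPos_symm _ (hPs k) (hNs k) i j
  have hBs : ∀ k i j, B k i j = B k (min i j) (max i j) := fun k i j => by
    rcases le_total i j with h | h
    · rw [min_eq_left h, max_eq_right h]
    · rw [min_eq_right h, max_eq_left h]; exact mulPos_symm _ (hNs k) (hPs k) i j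
  set LA : Fin n → Fin n → Measure (Rn n) := fun i j => L (Sum.inl (true, min i j, max i j))
  set LB : Fin n → Fin n → Measure (Rn n) := fun i j => L (Sum.inl (false, min i j, max i j))
  set μ := L (Sum.inr true)
  set Λ := L (Sum.inr false)
  have hLA : ∀ i j (φ : Rn n → ℝ), Continuous φ → (∃ D, ∀ x, |φ x| ≤ D) →
      (∀ x, x ∉ Ω → φ x = 0) → Tendsto (fun k => ∫ x, φ x ∂(A (s k) i j)) atTop
        (𝓝 (∫ x, φ x ∂(LA i j))) := fun i j φ h1 h2 h3 => by
    simp only [fun k => hAs (s k) i j]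
    exact hL (Sum.inl (true, min i j, max i j)) φ h1 h2 h3
  have hLB : ∀ i j (φ : Rn n → ℝ), Continuous φ → (∃ D, ∀ x, |φ x| ≤ D) →
      (∀ x, x ∉ Ω → φ x = 0) → Tendsto (fun k => ∫ x, φ x ∂(B (s k) i j)) atTop
        (𝓝 (∫ x, φ x ∂(LB i j))) := fun i j φ h1 h2 h3 => by
    simp only [fun k => hBs (s k) i j]
    exact hL (Sum.inl (false, min i j, max i j)) φ h1 h2 h3
  obtain ⟨T, hT⟩ := exists_represents (Ω := Ω) (P := LA) (N := LB) (fun i j => hLfin _)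
    (fun i j => hLfin _) (fun i j => hLΩ _) (fun i j => hLΩ _)
    (fun i j => by simp only [LA, min_comm i j, max_comm i j])
    (fun i j => by simp only [LB, min_comm i j, max_comm i j])
  -- The defect is defined as the limit `T` minus the expected product, so the convergence is
  -- immediate and the content lies in its concentration.
  refine ⟨T - MatMeasure.mulFn αt₀ (BD.E u₀), ?_, ?_⟩
  · have hη := hT.sub hrep₀
    have hfLA := hT.finite_pos
    have hfLB := hT.finite_neg
    have hfA₀ := hrep₀.finite_pos
    have hfB₀ := hrep₀.finite_neg
    have : IsFiniteMeasure μ := hLfin _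
    have : IsFiniteMeasure Λ := hLfin _
    obtain ⟨κ, hκ⟩ := SymGradData.exists_abs_limit_le n
    have hn : (0 : ℝ) < 1 / (n : ℝ) := one_div_pos.2 (by exact_mod_cast NeZero.pos n)
    refine hη.concentratedOnCountable (μ := μ) (Λ := Λ) (κ := κ) hn fun ψ hψ i j => ?_
    have htest : ∀ φ : 𝓓(Ω, ℝ), Continuous φ ∧ (∃ D, ∀ x, |φ x| ≤ D) ∧
        ∀ x, x ∉ Ω → φ x = 0 := fun φ =>
      ⟨φ.continuous, φ.continuous.bounded_above_of_compact_support φ.hasCompactSupport,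
        fun x hx => image_eq_zero_of_notMem_tsupport fun h => hx (φ.tsupport_subset h)⟩
    obtain ⟨t1, t2, t3⟩ := htest ψ
    obtain ⟨q1, ⟨D, q2⟩, q3⟩ := htest (testSq ψ)
    have hqi : ∀ Q : Measure (Rn n), IsFiniteMeasure Q → Integrable (testSq ψ) Q := fun Q _ =>
      Integrable.of_bound q1.aestronglyMeasurable D (Eventually.of_forall q2)
    -- The part of `α̃_k Eu_k` due to `u_k - u` converges to the pairing with the defect: the full
    -- product converges by compactness, and the part with the fixed `u` by weak convergence of
    -- `α_k`.
    have hlim : Tendsto (fun k => SymGradData.productTerm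
        ((((u (s k) : Lp (Rn n) 1 (volOn Ω)) : Rn n → Rn n))
          - ((u₀ : Lp (Rn n) 1 (volOn Ω)) : Rn n → Rn n)) (testSq ψ)
        (W1p.ext (α (s k))) (W1p.extGrad (α (s k))) i j) atTop
        (𝓝 (∫ x, testSq ψ x ∂(LA i j) - ∫ x, testSq ψ x ∂(LB i j)
          - SymGradData.productTerm ((u₀ : Lp (Rn n) 1 (volOn Ω)) : Rn n → Rn n) (testSq ψ)
            (W1p.ext α₀) (W1p.extGrad α₀) i j)) := by
      simp only [fun k => SymGradData.productTerm_sub (BD.symGradData (u (s k)) (hr (s k)))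
        (BD.symGradData u₀ hr₀) (W1p.sobOn (α (s k))) (testSq ψ) i j]
      refine Tendsto.sub ?_ ((hα.tendsto_productTerm (BD.symGradData u₀ hr₀)
        (testSq ψ) i j).comp hs.tendsto_atTop)
      simp only [fun k => ((hspec (s k)).2.2.2 (testSq ψ) i j).symm]
      exact (hLA i j _ q1 ⟨D, q2⟩ q3).sub (hLB i j _ q1 ⟨D, q2⟩ q3)
    have hmain := hκ Ω _ _ _ (fun k => hv (s k)) ψ hψ
      ((SymGradData.tendsto_gradTerm hu.1 ψ).comp hs.tendsto_atTop) _ _ C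
      (fun k i => ((W1p.sobOn (α (s k))).memLp_grad i).1)
      (fun k => ae_abs_ext_le (zero_le_one.trans hC1) (hαC (s k)))
      (fun k => ⟨(hΛb (s k)).trans_lt hΛfin⟩) μ Λ (hL (Sum.inr true) ψ t1 t2 t3)
      (hL (Sum.inr false) ψ t1 t2 t3) i j _ hlim
    refine le_trans (le_of_eq ?_) hmain
    rw [← hprod₀ (testSq ψ) i j]
    change |∫ x, testSq ψ x ∂_ - ∫ x, testSq ψ x ∂_| = _
    rw [integral_add_measure (hqi _ (hfLA i j)) (hqi _ (hfB₀ i j)),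
      integral_add_measure (hqi _ (hfLB i j)) (hqi _ (hfA₀ i j))]
    congr 1
    ring
  · rw [add_sub_cancel]
    intro φ
    simp only [hT.pairing_eq, fun k => (hspec (s k)).2.1.pairing_eq]
    have hφ := fun i j => Represents.continuous_extEntry φ i j
    refine tendsto_finsetSum _ fun i _ => tendsto_finsetSum _ fun j _ => Tendsto.sub ?_ ?_
    · exact hLA i j _ (hφ i j) ⟨_, Represents.abs_extEntry_le φ i j⟩
        fun x hx => Represents.extEntry_of_notMem φ i j hx
    · exact hLB i j _ (hφ i j) ⟨_, Represents.abs_extEntry_le φ i j⟩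
        fun x hx => Represents.extEntry_of_notMem φ i j hx
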